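/- **Setting.** Consider an episodic MDP with horizon $H$, fixed initial state $s_1$, reward distributions on $[0,1]$ with mean $r_h(s,a)$ and total reward per episode in $[0,1]$ almost surely, and known feature maps $\phi_h(s,a)\in\mathbb{R}^{d_h}$. Put $\mathcal{B}_h=\{\theta: |\phi_h(s,a)^\top\theta|\le 1\ \forall (s,a)\}$, and assume $\|\phi_h(s,a)\|_2\le 1$, $\|\theta\|_2\le\sqrt{d_h}$ for $\theta\in\mathcal{B}_h$, and that $\max_a\phi_h(s,a)^\top\theta$ is attained for $\theta\in\mathcal B_h$ (e.g. finitely many actions). The inherent Bellman error is $\max_h\sup_{\theta'\in\mathcal{B}_{h+1}}\inf_{\theta\in\mathcal{B}_h}\sup_{s,a}|\phi_h(s,a)^\top\theta-r_h(s,a)-\mathbb{E}_{s'\sim P_h(\cdot|s,a)}V_{h+1}(\theta')(s')|$, where $V_h(\theta)(s)=\max_a\phi_h(s,a)^\top\theta$ and $V_{H+1}=0$; $\mathcal I\ge0$ is a known upper bound on it. **Algorithm (ELEANOR-LowSwitching)**, with inputs $K\ge1$, $\delta\in(0,1)$, $\mathcal I$. In episode $k$ let $\Sigma_h^k=I+\sum_{\tau<k}\phi_h^\tau(\phi_h^\tau)^\top$,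 where $\phi_h^\tau$ is the feature vector visited at step $h$ of episode $\tau$. If $k=1$ or $\det\Sigma_h^k\ge 2\det\Sigma_h^{b}$ for some $h$, where $b$ is the last earlier episode with an update, maximize $V_1(\bar\theta_1)(s_1)$ over $(\bar\xi_h,\hat\theta_h,\bar\theta_h)_h$ subject to $\hat\theta_h=(\Sigma_h^k)^{-1}\sum_{\tau<k}\phi_h^\tau(r_h^\tau+V_{h+1}(\bar\theta_{h+1})(s_{h+1}^\tau))$, $\bar\theta_h=\hat\theta_h+\bar\xi_h\in\mathcal{B}_h$, $\|\bar\xi_h\|_{\Sigma_h^k}\le\sqrt{\alpha_h^k}$, and let $\pi_k$ be greedy for the maximizer; otherwise $\pi_k=\pi_{k-1}$. (If the constraints have no solution, the new policy is arbitrary.) Here $\sqrt{\alpha_h^k}=\sqrt{d_h\log(1+k/d_h)+2d_{h+1}\log(1+4\sqrt{kd_h})+\log(2KH/\delta)}+1+\sqrt{k}\,\mathcal I+\sqrt{d_h}$, with $d_{H+1}=0$. The regret is $\sum_{k=1}^K(V_1^\star(s_1)-V_1^{\pi_k}(s_1))$, and the switching cost is the number of $k\in\{1,\dots,K-1\}$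 with $\pi_k\ne\pi_{k+1}$. **Result.** Suppose $H=1$ and $\mathcal I=0$, and write $d=d_1$, $\phi=\phi_1$, $\mathcal{B}=\mathcal{B}_1$. 1. The MDP is a $d$-dimensional linear bandit with decision set $D=\{\phi(s_1,a): a\}$: there is $\theta^\star\in\mathcal{B}$ with $r(s,a)=\phi(s,a)^\top\theta^\star$ for all $s,a$; in any interaction with the MDP the reward of each episode lies in $[0,1]$ and has conditional mean $X_k^\top\theta^\star$ given the past and the chosen vector $X_k=\phi(s_1,a_k)\in D$; and the regret is $\sum_{k=1}^K(\sup_{x\in D}x^\top\theta^\star-X_k^\top\theta^\star)$. 2. The sequences of played vectors and observed rewards that the algorithm can produce are exactly those of Rarely Switching OFUL on $D$: in round 1, and whenever the determinant of the design matrix $I+\sum_{\tau<t}X_\tau X_\tau^\top$ has at least doubled since the last computation, it plays the vector of a pair maximizing $x^\top\theta$ over $x\in D$ and over the $\theta\in\mathcal{B}$ at distance at most $\sqrt{d\log(1+t/d)+\log(2K/\delta)}+1+\sqrt d$ from the ridge estimate, in the norm of the design matrix (an arbitrary vector of $D$ if there is no such $\theta$); otherwise it repeats the previous vector. 3. The algorithm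 is computationally efficient: for finitely many states and actions, one program over the reals (unit-cost arithmetic and comparisons) decides in each episode whether to update and, if the optimization problem is feasible, solves it up to an error $1/N$ in the constraints and in the objective, in a number of steps polynomial in $|\mathcal{S}|,|\mathcal{A}|,d,k,N$. 4. The switching cost is $O(d\log K)$: at most $C\,d\log K$ on every run, with an absolute constant $C$. 5. With probability at least $1-\delta$, the regret is $\tilde O(d\sqrt K)$: at most $C\,d\sqrt K\,\log(2K/\delta)$, with an absolute constant $C$. -/

import Mathlib

open MeasureTheory ProbabilityTheory Matrix

universe u v w

/-! ## Vectors and matrices -/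

/-- The weighted norm `‖x‖_Λ = √(xᵀ Λ x)`. -/
noncomputable def weightedNorm {d : ℕ} (Λ : Matrix (Fin d) (Fin d) ℝ) (x : Fin d → ℝ) : ℝ :=
  Real.sqrt (x ⬝ᵥ (Λ *ᵥ x))

/-! ## Episodic MDPs with a linear feature map -/

/-- A finite-horizon episodic MDP with horizon `H`, fixed initial state `s₁`, non-stationary
transition kernels and reward distributions, and a feature map `φ h : S → A → ℝ^(d h)` for every
layer. Layers are numbered `0, …, H - 1`. -/
structure FeatureMDP (S : Type u) (A : Type v) [MeasurableSpace S] [MeasurableSpace A]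
    (H : ℕ) where
  s₁ : S
  trans : Fin H → Kernel (S × A) S
  rew : Fin H → Kernel (S × A) ℝ
  trans_markov : ∀ h, IsMarkovKernel (trans h)
  rew_markov : ∀ h, IsMarkovKernel (rew h)
  d : Fin H → ℕ
  φ : (h : Fin H) → S → A → (Fin (d h) → ℝ)
  φ_measurable : ∀ h, Measurable (fun p : S × A => φ h p.1 p.2)

/-- What is observed in one episode: `s_1, …, s_{H+1}`, `a_1, …, a_H`, `r_1, …, r_H`. -/
structure Episode (S : Type u) (A : Type v) (H : ℕ) where
  state : Fin (H + 1) → S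
  action : Fin H → A
  reward : Fin H → ℝ

namespace FeatureMDP

variable {S : Type u} {A : Type v} [MeasurableSpace S] [MeasurableSpace A] {H : ℕ}

/-- A deterministic policy for an MDP with horizon `H`. -/
abbrev Policy (S : Type u) (A : Type v) (H : ℕ) : Type (max u v) := Fin H → S → A

/-- A choice of one parameter vector per layer. -/
abbrev Params (M : FeatureMDP S A H) : Type := (h : Fin H) → Fin (M.d h) → ℝ

/-- The expected immediate reward `r_h(s, a)`. -/
noncomputable def meanReward (M : FeatureMDP S A H) (h : Fin H) (s : S) (a : A) : ℝ :=
  ∫ r, r ∂(M.rew h (s, a))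

/-- The value from state `s` of a (possibly randomized) policy when `n` steps remain,
i.e. at layer `H - n`. -/
noncomputable def valueToGo (M : FeatureMDP S A H) (π : Fin H → S → Measure A) : ℕ → S → ℝ
  | 0, _ => 0
  | n + 1, s =>
    if hn : n + 1 ≤ H then
      ∫ a, (M.meanReward ⟨H - (n + 1), by omega⟩ s a +
        ∫ s', M.valueToGo π n s' ∂(M.trans ⟨H - (n + 1), by omega⟩ (s, a)))
        ∂(π ⟨H - (n + 1), by omega⟩ s)
    else 0

/-- `V_1^π(s_1)` for a deterministic policy. -/
noncomputable def value (M : FeatureMDP S A H) (π : Policy S A H) : ℝ :=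
  M.valueToGo (fun h s => Measure.dirac (π h s)) H M.s₁

/-- `V_1^⋆(s_1)`: the best value over all randomized (Markov kernel) policies. -/
noncomputable def optValue (M : FeatureMDP S A H) : ℝ :=
  ⨆ π : {π : Fin H → Kernel S A // ∀ h, IsMarkovKernel (π h)},
    M.valueToGo (fun h s => π.1 h s) H M.s₁

/-- The regret of a sequence of deployed policies over `K` episodes. -/
noncomputable def regret (M : FeatureMDP S A H) (K : ℕ) (π : ℕ → Policy S A H) : ℝ :=
  ∑ k ∈ Finset.range K, (M.optValue - M.value (π k))

open Classical in
/-- The global switching cost: the number of `k < K - 1` with `π_k ≠ π_{k+1}`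
(episodes numbered from `0`). -/
noncomputable def switchingCost (K : ℕ) (π : ℕ → Policy S A H) : ℕ :=
  ∑ k ∈ Finset.range (K - 1), if π k ≠ π (k + 1) then 1 else 0

/-- The feasible parameter class `𝓑_h`. -/
def paramSet (M : FeatureMDP S A H) (h : Fin H) : Set (Fin (M.d h) → ℝ) :=
  {θ | ∀ s a, |M.φ h s a ⬝ᵥ θ| ≤ 1}

/-- `V_j(θ_j)(s) = max_a φ_j(s,a)ᵀ θ_j`; it is `0` beyond the last layer. -/
noncomputable def layerValue (M : FeatureMDP S A H) (j : ℕ) (θ : M.Params) (s : S) : ℝ :=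
  if hj : j < H then ⨆ a, M.φ ⟨j, hj⟩ s a ⬝ᵥ θ ⟨j, hj⟩ else 0

/-- The Bellman operator `(𝓣_h Q_{h+1}(θ_{h+1}))(s, a)`. -/
noncomputable def bellman (M : FeatureMDP S A H) (h : Fin H) (θ : M.Params) (s : S) (a : A) : ℝ :=
  M.meanReward h s a + ∫ s', M.layerValue (h + 1) θ s' ∂(M.trans h (s, a))

/-- The inherent Bellman error
`max_h sup_{θ' ∈ 𝓑_{h+1}} inf_{θ ∈ 𝓑_h} sup_{s,a} |φ_h(s,a)ᵀ θ - (𝓣_h Q_{h+1}(θ'))(s,a)|`,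
as an extended nonnegative real; only the component `h + 1` of `θ'` matters in layer `h`. -/
noncomputable def inherentBellmanError (M : FeatureMDP S A H) : ENNReal :=
  ⨆ h : Fin H, ⨆ θ' ∈ {θ' : M.Params | ∀ j, θ' j ∈ M.paramSet j}, ⨅ θ ∈ M.paramSet h,
    ⨆ s, ⨆ a, ENNReal.ofReal |M.φ h s a ⬝ᵥ θ - M.bellman h θ' s a|

/-- With `n` steps remaining in state `s` and reward `c` collected so far, the total reward lies
in `[0,1]` almost surely, whatever actions are taken. -/
def TotalRewardBounded (M : FeatureMDP S A H) : ℕ → S → ℝ → Prop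
  | 0, _, c => c ∈ Set.Icc (0 : ℝ) 1
  | n + 1, s, c => ∀ (hn : n + 1 ≤ H) (a : A),
      ∀ᵐ r ∂(M.rew ⟨H - (n + 1), by omega⟩ (s, a)),
      ∀ᵐ s' ∂(M.trans ⟨H - (n + 1), by omega⟩ (s, a)),
        TotalRewardBounded M n s' (c + r)

/-- The standing normalization assumptions of the setting, and the existence of the maxima over
actions in the definition of the greedy policies (automatic for finitely many actions). -/
structure Standing (M : FeatureMDP S A H) : Prop where
  reward_mem : ∀ h s a, ∀ᵐ r ∂(M.rew h (s, a)), r ∈ Set.Icc (0 : ℝ) 1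
  total_reward_mem : M.TotalRewardBounded H M.s₁ 0
  feature_norm_le : ∀ h s a, ‖WithLp.toLp 2 (M.φ h s a)‖ ≤ 1
  param_norm_le : ∀ h, ∀ θ ∈ M.paramSet h, ‖WithLp.toLp 2 θ‖ ≤ Real.sqrt (M.d h)
  max_attained : ∀ h s, ∀ θ ∈ M.paramSet h, ∃ a, ∀ a', M.φ h s a' ⬝ᵥ θ ≤ M.φ h s a ⬝ᵥ θ

/-! ## The algorithm ELEANOR-LowSwitching

Episodes are numbered from `0` here: in episode `k` there are `k` earlier episodes, so the
index of that episode when counting from `1` is `k + 1`. -/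

/-- The feature vector `φ_h^τ` visited in layer `h` of an episode. -/
def visited (M : FeatureMDP S A H) (e : Episode S A H) (h : Fin H) : Fin (M.d h) → ℝ :=
  M.φ h (e.state h.castSucc) (e.action h)

/-- The empirical covariance matrix at the start of episode `k`, with regularization `1`. -/
noncomputable def gram (M : FeatureMDP S A H) (ep : ℕ → Episode S A H) (h : Fin H) (k : ℕ) :
    Matrix (Fin (M.d h)) (Fin (M.d h)) ℝ :=
  1 + ∑ τ ∈ Finset.range k, vecMulVec (M.visited (ep τ) h) (M.visited (ep τ) h)

open Classical in
/-- The reference matrices kept by the algorithm at the start of episode `k` are those of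
episode `refIndex k`. They are replaced whenever a determinant has doubled. -/
noncomputable def refIndex (M : FeatureMDP S A H) (ep : ℕ → Episode S A H) : ℕ → ℕ
  | 0 => 0
  | k + 1 =>
    if ∃ h, 2 * (M.gram ep h (M.refIndex ep k)).det ≤ (M.gram ep h k).det then k
    else M.refIndex ep k

/-- Planning takes place in the first episode, and in every episode in which the determinant of
the covariance matrix of some layer is at least twice its reference value. -/
def Updates (M : FeatureMDP S A H) (ep : ℕ → Episode S A H) (k : ℕ) : Prop :=
  k = 0 ∨ ∃ h, 2 * (M.gram ep h (M.refIndex ep k)).det ≤ (M.gram ep h k).det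

/-- The dimension `d_{h+1}` of the next layer, which is `0` after the last layer. -/
def nextDim (M : FeatureMDP S A H) (h : Fin H) : ℕ :=
  if hh : (h : ℕ) + 1 < H then M.d ⟨h + 1, hh⟩ else 0

/-- `√β_h^k` for the episode index `k`, counted from `1`. -/
noncomputable def sqrtBeta (M : FeatureMDP S A H) (K : ℕ) (δ : ℝ) (h : Fin H) (k : ℕ) : ℝ :=
  Real.sqrt (M.d h * Real.log (1 + k / M.d h)
    + 2 * M.nextDim h * Real.log (1 + 4 * Real.sqrt (k * M.d h))
    + Real.log (2 * K * H / δ)) + 1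

/-- `√α_h^k = √β_h^k + √k 𝓘 + √d_h` for the episode index `k`, counted from `1`. -/
noncomputable def sqrtAlpha (M : FeatureMDP S A H) (K : ℕ) (δ I : ℝ) (h : Fin H) (k : ℕ) : ℝ :=
  M.sqrtBeta K δ h k + Real.sqrt k * I + Real.sqrt (M.d h)

/-- The regularized least squares solution in layer `h`, given parameters `θ` of later layers. -/
noncomputable def leastSquares (M : FeatureMDP S A H) (ep : ℕ → Episode S A H) (k : ℕ)
    (θ : M.Params) (h : Fin H) : Fin (M.d h) → ℝ :=
  (M.gram ep h k)⁻¹ *ᵥ ∑ τ ∈ Finset.range k,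
    ((ep τ).reward h + M.layerValue (h + 1) θ ((ep τ).state h.succ)) • M.visited (ep τ) h

/-- The constraints of the optimistic planning problem of episode `k`. -/
structure PlanFeasible (M : FeatureMDP S A H) (K : ℕ) (δ I : ℝ) (ep : ℕ → Episode S A H) (k : ℕ)
    (ξ θhat θbar : M.Params) : Prop where
  least_squares : ∀ h, θhat h = M.leastSquares ep k θbar h
  perturbed : ∀ h, θbar h = θhat h + ξ h
  radius : ∀ h, weightedNorm (M.gram ep h k) (ξ h) ≤ M.sqrtAlpha K δ I h (k + 1)
  mem : ∀ h, θbar h ∈ M.paramSet h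

/-- A maximizer of the optimistic planning problem of episode `k`. -/
def PlanOptimal (M : FeatureMDP S A H) (K : ℕ) (δ I : ℝ) (ep : ℕ → Episode S A H) (k : ℕ)
    (ξ θhat θbar : M.Params) : Prop :=
  M.PlanFeasible K δ I ep k ξ θhat θbar ∧
    ∀ ξ' θhat' θbar', M.PlanFeasible K δ I ep k ξ' θhat' θbar' →
      M.layerValue 0 θbar' M.s₁ ≤ M.layerValue 0 θbar M.s₁

/-- `π` is a greedy policy with respect to the parameters `θ`. -/
def Greedy (M : FeatureMDP S A H) (π : Policy S A H) (θ : M.Params) : Prop :=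
  ∀ h s a, M.φ h s a ⬝ᵥ θ h ≤ M.φ h s (π h s) ⬝ᵥ θ h

/-- The episode starts in `s₁` and its actions are those of the policy `π`. -/
def Deploys (M : FeatureMDP S A H) (π : Policy S A H) (e : Episode S A H) : Prop :=
  e.state 0 = M.s₁ ∧ ∀ h : Fin H, e.action h = π h (e.state h.castSucc)

/-- `ep`, `π` is a possible run over `K` episodes of ELEANOR-LowSwitching with failure
probability `δ` and inherent Bellman error bound `I` as inputs. In an episode with planning, the
policy is greedy for an optimal solution of the planning problem; nothing is required of the new
policy in case the constraints of the planning problem have no solution at all. -/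
structure IsEleanorRun (M : FeatureMDP S A H) (K : ℕ) (δ I : ℝ) (ep : ℕ → Episode S A H)
    (π : ℕ → Policy S A H) : Prop where
  deploy : ∀ k < K, M.Deploys (π k) (ep k)
  update : ∀ k < K, M.Updates ep k →
    (∃ ξ θhat θbar, M.PlanFeasible K δ I ep k ξ θhat θbar) →
    ∃ ξ θhat θbar, M.PlanOptimal K δ I ep k ξ θhat θbar ∧ M.Greedy (π k) θbar
  keep : ∀ k < K, ¬ M.Updates ep k → π k = π (k - 1)

/-! ## Interaction with the MDP -/

/-- On the probability space `(Ω, P)`, the episodes `ep` are generated over `K` episodes by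
deploying the policies `π`, chosen without looking ahead: `ℱ (k * H + h)` is the information
available when the action of layer `h` of episode `k` has been chosen, and, given it, the reward
and the next state are drawn independently from the reward distribution and the transition
kernel. -/
structure IsInteraction (M : FeatureMDP S A H) {Ω : Type w} {mΩ : MeasurableSpace Ω}
    (P : Measure Ω) (ℱ : Filtration ℕ mΩ) (K : ℕ) (ep : ℕ → Ω → Episode S A H)
    (π : ℕ → Ω → Policy S A H) : Prop where
  deploy : ∀ k < K, ∀ ω, M.Deploys (π k ω) (ep k ω)
  policy_measurable : ∀ k < K, ∀ h s, Measurable[ℱ (k * H)] (fun ω => π k ω h s)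
  state_measurable : ∀ k < K, ∀ h : Fin H,
    Measurable[ℱ (k * H + h)] (fun ω => (ep k ω).state h.castSucc)
  action_measurable : ∀ k < K, ∀ h : Fin H,
    Measurable[ℱ (k * H + h)] (fun ω => (ep k ω).action h)
  reward_measurable : ∀ k < K, ∀ h : Fin H,
    Measurable[ℱ (k * H + h + 1)] (fun ω => (ep k ω).reward h)
  next_state_measurable : ∀ k < K, ∀ h : Fin H,
    Measurable[ℱ (k * H + h + 1)] (fun ω => (ep k ω).state h.succ)
  law : ∀ k < K, ∀ h : Fin H, ∀ B : Set (ℝ × S), MeasurableSet B →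
    P⟦{ω | ((ep k ω).reward h, (ep k ω).state h.succ) ∈ B} | ℱ (k * H + h)⟧ =ᵐ[P]
      fun ω => ((M.rew h ((ep k ω).state h.castSucc, (ep k ω).action h)).prod
        (M.trans h ((ep k ω).state h.castSucc, (ep k ω).action h))).real B

end FeatureMDP

/-! ## Linear bandits and RARELY SWITCHING OFUL -/

namespace LinearBandit

/-- The vectors `X` and the rewards `Y` are those of `K` rounds of a stochastic linear bandit with
decision set `D` and unknown parameter `θstar`, with rewards in `[0,1]`: the vector `X k` is chosen
from `D` on the basis of the past, and the reward `Y k` has conditional mean `⟨X k, θstar⟩`. -/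
structure IsInteraction {d : ℕ} {Ω : Type w} {mΩ : MeasurableSpace Ω} (P : Measure Ω)
    (ℱ : Filtration ℕ mΩ) (D : Set (Fin d → ℝ)) (θstar : Fin d → ℝ) (K : ℕ)
    (X : ℕ → Ω → Fin d → ℝ) (Y : ℕ → Ω → ℝ) : Prop where
  mem : ∀ k < K, ∀ ω, X k ω ∈ D
  predictable : ∀ k < K, Measurable[ℱ k] (X k)
  reward_measurable : ∀ k < K, Measurable[ℱ (k + 1)] (Y k)
  reward_mem : ∀ k < K, ∀ᵐ ω ∂P, Y k ω ∈ Set.Icc (0 : ℝ) 1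
  mean : ∀ k < K, P[Y k | ℱ k] =ᵐ[P] fun ω => X k ω ⬝ᵥ θstar

/-- The (pseudo-)regret of `K` rounds of a linear bandit. -/
noncomputable def regret {d : ℕ} (D : Set (Fin d → ℝ)) (θstar : Fin d → ℝ) (K : ℕ)
    (X : ℕ → Fin d → ℝ) : ℝ :=
  ∑ k ∈ Finset.range K, (sSup ((fun x => x ⬝ᵥ θstar) '' D) - X k ⬝ᵥ θstar)

variable {d : ℕ}

/-- The regularized design matrix before round `t`. -/
noncomputable def design (lam : ℝ) (X : ℕ → Fin d → ℝ) (t : ℕ) : Matrix (Fin d) (Fin d) ℝ :=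
  lam • (1 : Matrix (Fin d) (Fin d) ℝ) + ∑ τ ∈ Finset.range t, vecMulVec (X τ) (X τ)

/-- The ridge regression estimate before round `t`. -/
noncomputable def ridge (lam : ℝ) (X : ℕ → Fin d → ℝ) (Y : ℕ → ℝ) (t : ℕ) : Fin d → ℝ :=
  (design lam X t)⁻¹ *ᵥ ∑ τ ∈ Finset.range t, Y τ • X τ

/-- The confidence ellipsoid of radius `ρ t` around the ridge estimate, within the set `Θ` of
parameters that are possible a priori. -/
def confSet (lam : ℝ) (Θ : Set (Fin d → ℝ)) (ρ : ℕ → ℝ) (X : ℕ → Fin d → ℝ) (Y : ℕ → ℝ) (t : ℕ) :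
    Set (Fin d → ℝ) :=
  {θ | θ ∈ Θ ∧ weightedNorm (design lam X t) (θ - ridge lam X Y t) ≤ ρ t}

open Classical in
/-- The round in which the played vector was last recomputed, as known at the start of round `t`. -/
noncomputable def lastChange (lam C : ℝ) (X : ℕ → Fin d → ℝ) : ℕ → ℕ
  | 0 => 0
  | t + 1 =>
    if (1 + C) * (design lam X (lastChange lam C X t)).det ≤ (design lam X t).det then t
    else lastChange lam C X t

/-- `X`, `Y` is a possible run over `K` rounds of RARELY SWITCHING OFUL with constant `C` on the
fixed decision set `D`: the optimistic pair in `D × confSet` is computed in the first round and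
whenever the determinant has grown by the factor `1 + C` since the last computation; in between the
played vector is kept. -/
structure IsRarelySwitchingOFUL (D : Set (Fin d → ℝ)) (lam C : ℝ) (Θ : Set (Fin d → ℝ))
    (ρ : ℕ → ℝ) (K : ℕ) (X : ℕ → Fin d → ℝ) (Y : ℕ → ℝ) : Prop where
  mem : ∀ t < K, X t ∈ D
  update : ∀ t < K,
    (t = 0 ∨ (1 + C) * (design lam X (lastChange lam C X t)).det ≤ (design lam X t).det) →
    (confSet lam Θ ρ X Y t).Nonempty →
    ∃ θ ∈ confSet lam Θ ρ X Y t, ∀ x ∈ D, ∀ θ' ∈ confSet lam Θ ρ X Y t, x ⬝ᵥ θ' ≤ X t ⬝ᵥ θ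
  keep : ∀ t < K,
    ¬ (t = 0 ∨ (1 + C) * (design lam X (lastChange lam C X t)).det ≤ (design lam X t).det) →
    X t = X (t - 1)

end LinearBandit

/-! ## A programming language over the reals with unit-cost arithmetic -/

namespace RealProgram

/-- The memory: natural number registers, and two-dimensional arrays of reals
(array name, row, column). -/
structure Memory where
  nat : ℕ → ℕ
  real : ℕ → ℕ → ℕ → ℝ

/-- Natural number expressions. -/
inductive NExp where
  | lit : ℕ → NExp
  | reg : ℕ → NExp
  | add : NExp → NExp → NExp
  | mul : NExp → NExp → NExp

/-- Real expressions; `entry a i j` is the entry in row `i`, column `j` of the array `a`. -/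
inductive RExp where
  | ofNat : NExp → RExp
  | entry : ℕ → NExp → NExp → RExp
  | add : RExp → RExp → RExp
  | sub : RExp → RExp → RExp
  | mul : RExp → RExp → RExp
  | div : RExp → RExp → RExp

/-- Programs: assignments, sequencing, branching on a comparison of reals, bounded loops
`for i = 0, …, e - 1`, where the bound `e` is evaluated once. -/
inductive Prog where
  | skip : Prog
  | setNat : ℕ → NExp → Prog
  | setReal : ℕ → NExp → NExp → RExp → Prog
  | seq : Prog → Prog → Prog
  | ifLe : RExp → RExp → Prog → Prog → Prog
  | loop : ℕ → NExp → Prog → Prog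

def NExp.eval (m : Memory) : NExp → ℕ
  | .lit n => n
  | .reg i => m.nat i
  | .add a b => a.eval m + b.eval m
  | .mul a b => a.eval m * b.eval m

/-- The number of operations in an expression. -/
def NExp.cost : NExp → ℕ
  | .lit _ => 1
  | .reg _ => 1
  | .add a b => a.cost + b.cost + 1
  | .mul a b => a.cost + b.cost + 1

noncomputable def RExp.eval (m : Memory) : RExp → ℝ
  | .ofNat e => (e.eval m : ℝ)
  | .entry a i j => m.real a (i.eval m) (j.eval m)
  | .add x y => x.eval m + y.eval m
  | .sub x y => x.eval m - y.eval m
  | .mul x y => x.eval m * y.eval m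
  | .div x y => x.eval m / y.eval m

/-- The number of operations in an expression. -/
def RExp.cost : RExp → ℕ
  | .ofNat e => e.cost + 1
  | .entry _ i j => i.cost + j.cost + 1
  | .add x y => x.cost + y.cost + 1
  | .sub x y => x.cost + y.cost + 1
  | .mul x y => x.cost + y.cost + 1
  | .div x y => x.cost + y.cost + 1

def Memory.setNat (m : Memory) (i n : ℕ) : Memory :=
  { m with nat := Function.update m.nat i n }

noncomputable def Memory.setReal (m : Memory) (a i j : ℕ) (x : ℝ) : Memory :=
  { m with real := fun a' i' j' => if a' = a ∧ i' = i ∧ j' = j then x else m.real a' i' j' }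

open Classical in
/-- Execution: the final memory and the number of steps taken. -/
noncomputable def Prog.run : Prog → Memory → Memory × ℕ
  | .skip, m => (m, 1)
  | .setNat i e, m => (m.setNat i (e.eval m), e.cost + 1)
  | .setReal a i j e, m =>
    (m.setReal a (i.eval m) (j.eval m) (e.eval m), i.cost + j.cost + e.cost + 1)
  | .seq p q, m =>
    ((q.run (p.run m).1).1, (p.run m).2 + (q.run (p.run m).1).2)
  | .ifLe x y p q, m =>
    if x.eval m ≤ y.eval m then ((p.run m).1, x.cost + y.cost + 1 + (p.run m).2)
    else ((q.run m).1, x.cost + y.cost + 1 + (q.run m).2)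
  | .loop i e p, m =>
    Nat.rec (m, e.cost + 1)
      (fun n acc => ((p.run (acc.1.setNat i n)).1, acc.2 + 1 + (p.run (acc.1.setNat i n)).2))
      (e.eval m)

end RealProgram

/-! ## The computations in one episode of a one-step problem -/

namespace FeatureMDP

/-- The memory `m` holds the data with which a learner enters episode `k` of a one-step problem
with `nS` states and `nA` actions: the sizes, the initial state, the number of past episodes, the
episode of the last update, the accuracy parameter `N`, the features of all state-action pairs, the
visited features and observed rewards of the past episodes, and the radius `√α` of this episode.
Nothing is assumed about the rest of the memory. -/
structure EncodesEpisode {nS nA : ℕ} (M : FeatureMDP (Fin nS) (Fin nA) 1) (K : ℕ) (δ : ℝ)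
    (ep : ℕ → Episode (Fin nS) (Fin nA) 1) (k N : ℕ) (m : RealProgram.Memory) : Prop where
  dim : m.nat 0 = M.d 0
  states : m.nat 1 = nS
  actions : m.nat 2 = nA
  initial : m.nat 3 = M.s₁
  past : m.nat 4 = k
  ref : m.nat 5 = M.refIndex ep k
  accuracy : m.nat 6 = N
  features : ∀ (s : Fin nS) (a : Fin nA) (j : Fin (M.d 0)),
    m.real 0 (s * nA + a) j = M.φ 0 s a j
  visited : ∀ τ < k, ∀ j : Fin (M.d 0), m.real 1 τ j = M.visited (ep τ) 0 j
  rewards : ∀ τ < k, m.real 2 τ 0 = (ep τ).reward 0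
  radius : m.real 3 0 0 = M.sqrtAlpha K δ 0 0 (k + 1)

/-- The memory `m` holds the results of the computations of episode `k`: whether planning takes
place in this episode, and, if the planning problem is feasible, an action `a` and a parameter `θ`
that solve the problem of maximizing `φ(s₁, a)ᵀ θ` up to an error `1 / N` in the constraints and in
the objective. -/
structure SolvesEpisode {nS nA : ℕ} (M : FeatureMDP (Fin nS) (Fin nA) 1) (K : ℕ) (δ : ℝ)
    (ep : ℕ → Episode (Fin nS) (Fin nA) 1) (k N : ℕ) (m : RealProgram.Memory) : Prop where
  update : (m.nat 0 = 1 ↔ M.Updates ep k)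
  plan : (∃ ξ θhat θbar, M.PlanFeasible K δ 0 ep k ξ θhat θbar) →
    ∃ (a : Fin nA) (θ : M.Params),
      m.nat 1 = a ∧ (∀ j : Fin (M.d 0), m.real 4 0 j = θ 0 j) ∧
      (∀ s a', |M.φ 0 s a' ⬝ᵥ θ 0| ≤ 1 + 1 / N) ∧
      weightedNorm (M.gram ep 0 k) (θ 0 - M.leastSquares ep k θ 0) ≤
        M.sqrtAlpha K δ 0 0 (k + 1) + 1 / N ∧
      ∀ ξ θhat θbar, M.PlanFeasible K δ 0 ep k ξ θhat θbar →
        M.layerValue 0 θbar M.s₁ ≤ M.φ 0 M.s₁ a ⬝ᵥ θ 0 + 1 / N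

end FeatureMDP

section LinearAlgebra

variable {d : ℕ}

theorem vecMulVec_mulVec_eq (x y z : Fin d → ℝ) : vecMulVec x y *ᵥ z = (y ⬝ᵥ z) • x := by
  ext i
  simp only [mulVec, vecMulVec, dotProduct, of_apply, Pi.smul_apply, smul_eq_mul, Finset.sum_mul]
  exact Finset.sum_congr rfl fun j _ => by ring

theorem mul_vecMulVec_eq (A : Matrix (Fin d) (Fin d) ℝ) (x y : Fin d → ℝ) :
    A * vecMulVec x y = vecMulVec (A *ᵥ x) y := by
  ext i j
  simp only [mul_apply, mulVec, vecMulVec, dotProduct, of_apply, Finset.sum_mul]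
  exact Finset.sum_congr rfl fun j _ => by ring

theorem Matrix.PosDef.mulVec_dotProduct_comm {V : Matrix (Fin d) (Fin d) ℝ} (hV : V.IsHermitian)
    (x y : Fin d → ℝ) : x ⬝ᵥ (V *ᵥ y) = y ⬝ᵥ (V *ᵥ x) := by
  have h : Vᵀ = V := by simpa [IsHermitian, conjTranspose_eq_transpose_of_trivial] using hV
  rw [dotProduct_mulVec, ← mulVec_transpose, h, dotProduct_comm]

theorem vecMul_eq_mulVec_of_isHermitian {V : Matrix (Fin d) (Fin d) ℝ} (hV : V.IsHermitian)
    (x : Fin d → ℝ) : x ᵥ* V = V *ᵥ x := by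
  have h : Vᵀ = V := by simpa [IsHermitian, conjTranspose_eq_transpose_of_trivial] using hV
  rw [← mulVec_transpose, h]

/-- The quadratic form of a positive definite matrix is nonnegative. -/
theorem posDef_quad_nonneg {V : Matrix (Fin d) (Fin d) ℝ} (hV : V.PosDef) (x : Fin d → ℝ) :
    0 ≤ x ⬝ᵥ (V *ᵥ x) := by
  simpa using hV.posSemidef.dotProduct_mulVec_nonneg x

theorem posDef_isUnit_det {V : Matrix (Fin d) (Fin d) ℝ} (hV : V.PosDef) : IsUnit V.det :=
  (isUnit_iff_isUnit_det V).1 hV.isUnit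

theorem vecMulVec_posSemidef (x : Fin d → ℝ) : (vecMulVec x x).PosSemidef := by
  simpa using posSemidef_vecMulVec_self_star x

theorem posDef_add_vecMulVec {V : Matrix (Fin d) (Fin d) ℝ} (hV : V.PosDef) (x : Fin d → ℝ) :
    (V + vecMulVec x x).PosDef := hV.add_posSemidef (vecMulVec_posSemidef x)

/-- The matrix determinant lemma for a symmetric rank-one update. -/
theorem det_add_vecMulVec_self {V : Matrix (Fin d) (Fin d) ℝ} (hV : V.PosDef) (x : Fin d → ℝ) :
    (V + vecMulVec x x).det = V.det * (1 + x ⬝ᵥ (V⁻¹ *ᵥ x)) := by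
  rw [vecMulVec_eq Unit, det_add_replicateCol_mul_replicateRow (posDef_isUnit_det hV)]
  congr 1
  rw [det_unique]
  simp only [Matrix.add_apply, Matrix.one_apply_eq, Matrix.mul_assoc]
  congr 1

/-- The Sherman–Morrison formula. -/
theorem inv_add_vecMulVec_self {V : Matrix (Fin d) (Fin d) ℝ} (hV : V.PosDef) (x : Fin d → ℝ) :
    (V + vecMulVec x x)⁻¹ = V⁻¹ -
      (1 + x ⬝ᵥ (V⁻¹ *ᵥ x))⁻¹ • vecMulVec (V⁻¹ *ᵥ x) (V⁻¹ *ᵥ x) := by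
  have hw : 0 ≤ x ⬝ᵥ (V⁻¹ *ᵥ x) := posDef_quad_nonneg hV.inv x
  set u := V⁻¹ *ᵥ x with hu
  set w := x ⬝ᵥ u with hwd
  apply inv_eq_right_inv
  have h1 : V * V⁻¹ = 1 := mul_nonsing_inv V (posDef_isUnit_det hV)
  have h2 : V *ᵥ u = x := by rw [hu, mulVec_mulVec, h1, one_mulVec]
  have h3 : vecMulVec x x * V⁻¹ = vecMulVec x u := by
    rw [vecMulVec_mul, vecMul_eq_mulVec_of_isHermitian hV.inv.isHermitian]
  have h4 : vecMulVec x x * vecMulVec u u = w • vecMulVec x u := by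
    rw [mul_vecMulVec_eq, vecMulVec_mulVec_eq, smul_vecMulVec]
  rw [add_mul, mul_sub, mul_sub, h1, mul_smul_comm, mul_smul_comm, mul_vecMulVec_eq, h2, h3, h4,
    smul_smul]
  have h5 : (1 + w)⁻¹ • vecMulVec x u + ((1 + w)⁻¹ * w) • vecMulVec x u = vecMulVec x u := by
    rw [← add_smul, ← mul_one_add, inv_mul_cancel₀ (by positivity), one_smul]
  rw [sub_add_sub_comm, h5, add_sub_cancel_right]

/-- Cauchy–Schwarz for the dual pair of norms of a positive definite matrix. -/
theorem dotProduct_sq_le_inv_mul {V : Matrix (Fin d) (Fin d) ℝ} (hV : V.PosDef)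
    (x y : Fin d → ℝ) : (x ⬝ᵥ y) ^ 2 ≤ (x ⬝ᵥ (V⁻¹ *ᵥ x)) * (y ⬝ᵥ (V *ᵥ y)) := by
  set u := V⁻¹ *ᵥ x with hu
  have h2 : V *ᵥ u = x := by
    rw [hu, mulVec_mulVec, mul_nonsing_inv V (posDef_isUnit_det hV), one_mulVec]
  have key : ∀ t : ℝ, 0 ≤ (y ⬝ᵥ (V *ᵥ y)) * (t * t) + (2 * (x ⬝ᵥ y)) * t + x ⬝ᵥ u := by
    intro t
    have := posDef_quad_nonneg hV (t • y + u)
    have e : (t • y + u) ⬝ᵥ (V *ᵥ (t • y + u)) =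
        (y ⬝ᵥ (V *ᵥ y)) * (t * t) + (2 * (x ⬝ᵥ y)) * t + x ⬝ᵥ u := by
      simp only [mulVec_add, mulVec_smul, h2, dotProduct_add, add_dotProduct, smul_dotProduct,
        dotProduct_smul, smul_eq_mul]
      rw [Matrix.PosDef.mulVec_dotProduct_comm hV.isHermitian u y, h2, dotProduct_comm y x,
        dotProduct_comm u x]
      ring
    rwa [e] at this
  have := discrim_le_zero key
  unfold discrim at this
  nlinarith

/-- The inequality of the arithmetic and geometric means for the eigenvalues of a matrix. -/
theorem det_le_of_trace_le {V : Matrix (Fin d) (Fin d) ℝ} (hV : V.PosDef) (hd : 0 < d) {c : ℝ}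
    (hc : V.trace ≤ d * c) : V.det ≤ c ^ d := by
  have hdet : V.det = ∏ i, hV.isHermitian.eigenvalues i := by
    simpa using hV.isHermitian.det_eq_prod_eigenvalues
  have htr : V.trace = ∑ i, hV.isHermitian.eigenvalues i := by
    simpa using hV.isHermitian.trace_eq_sum_eigenvalues
  have hpos : ∀ i, 0 ≤ hV.isHermitian.eigenvalues i := fun i => (hV.eigenvalues_pos i).le
  have hd' : (0 : ℝ) < d := by exact_mod_cast hd
  have h := Real.geom_mean_le_arith_mean Finset.univ (fun _ : Fin d => (1 : ℝ))
    hV.isHermitian.eigenvalues (fun _ _ => zero_le_one) (by simpa using hd') (fun i _ => hpos i)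
  simp only [Real.rpow_one, Finset.sum_const, Finset.card_univ, Fintype.card_fin, nsmul_eq_mul,
    mul_one, one_mul] at h
  rw [← hdet, ← htr] at h
  have h2 : V.det ^ ((d : ℝ)⁻¹) ≤ c := h.trans (by rw [div_le_iff₀ hd']; linarith)
  have h3 : (V.det ^ ((d : ℝ)⁻¹)) ^ d = V.det :=
    Real.rpow_inv_natCast_pow hV.det_pos.le hd.ne'
  rw [← h3]
  exact pow_le_pow_left₀ (Real.rpow_nonneg hV.det_pos.le _) h2 d

end LinearAlgebra

namespace LinearBandit

variable {d : ℕ} (X : ℕ → Fin d → ℝ)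

theorem design_zero : design 1 X 0 = 1 := by simp [design]

theorem design_succ (t : ℕ) : design 1 X (t + 1) = design 1 X t + vecMulVec (X t) (X t) := by
  simp [design, Finset.sum_range_succ, add_assoc]

theorem design_posDef (t : ℕ) : (design 1 X t).PosDef := by
  induction t with
  | zero => rw [design_zero]; exact PosDef.one
  | succ t ih => rw [design_succ]; exact posDef_add_vecMulVec ih _

theorem design_mulVec (t : ℕ) (y : Fin d → ℝ) :
    design 1 X t *ᵥ y = y + ∑ τ ∈ Finset.range t, (X τ ⬝ᵥ y) • X τ := by
  induction t with
  | zero => simp [design_zero]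
  | succ t ih => rw [design_succ, add_mulVec, ih, vecMulVec_mulVec_eq, Finset.sum_range_succ,
      add_assoc]

theorem design_quad (t : ℕ) (y : Fin d → ℝ) :
    y ⬝ᵥ (design 1 X t *ᵥ y) = y ⬝ᵥ y + ∑ τ ∈ Finset.range t, (X τ ⬝ᵥ y) ^ 2 := by
  rw [design_mulVec, dotProduct_add, dotProduct_sum]
  congr 1
  exact Finset.sum_congr rfl fun τ _ => by rw [dotProduct_smul, dotProduct_comm y, smul_eq_mul, sq]

theorem design_det_pos (t : ℕ) : 0 < (design 1 X t).det := (design_posDef X t).det_pos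

theorem design_congr {X X' : ℕ → Fin d → ℝ} {t : ℕ} (h : ∀ τ < t, X τ = X' τ) :
    design 1 X t = design 1 X' t := by
  unfold design
  congr 1
  exact Finset.sum_congr rfl fun τ hτ => by rw [h τ (Finset.mem_range.1 hτ)]

theorem design_det_succ (t : ℕ) : (design 1 X (t + 1)).det =
    (design 1 X t).det * (1 + X t ⬝ᵥ ((design 1 X t)⁻¹ *ᵥ X t)) := by
  rw [design_succ, det_add_vecMulVec_self (design_posDef X t)]

theorem design_det_mono : Monotone fun t => (design 1 X t).det := by
  refine monotone_nat_of_le_succ fun t => ?_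
  rw [design_det_succ]
  exact le_mul_of_one_le_right (design_det_pos X t).le
    (by linarith [posDef_quad_nonneg (design_posDef X t).inv (X t)])

theorem one_le_design_det (t : ℕ) : 1 ≤ (design 1 X t).det := by
  simpa [design_zero] using design_det_mono X (Nat.zero_le t)

theorem design_trace_le {t : ℕ} (hX : ∀ τ < t, X τ ⬝ᵥ X τ ≤ 1) :
    (design 1 X t).trace ≤ d + t := by
  induction t with
  | zero => simp [design_zero]
  | succ t ih =>
    rw [design_succ, trace_add, trace_vecMulVec]
    have := ih fun τ hτ => hX τ (by omega)
    have := hX t (by omega)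
    push_cast
    linarith

theorem design_det_le {t : ℕ} (hX : ∀ τ < t, X τ ⬝ᵥ X τ ≤ 1) :
    (design 1 X t).det ≤ (1 + t / d) ^ d := by
  rcases Nat.eq_zero_or_pos d with rfl | hd
  · simp
  · refine det_le_of_trace_le (design_posDef X t) hd ((design_trace_le X hX).trans_eq ?_)
    have : (d : ℝ) ≠ 0 := by positivity
    field_simp

theorem log_design_det_le {t : ℕ} (hX : ∀ τ < t, X τ ⬝ᵥ X τ ≤ 1) :
    Real.log (design 1 X t).det ≤ d * Real.log (1 + t / d) := by
  rw [← Real.log_pow]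
  exact Real.log_le_log (design_det_pos X t) (design_det_le X hX)

/-- `‖V y‖² ≤ (t + 1) ‖y‖_V²` for the design matrix `V` of `t` unit-bounded vectors. -/
theorem design_mulVec_sq_le {t : ℕ} (hX : ∀ τ < t, X τ ⬝ᵥ X τ ≤ 1) (y : Fin d → ℝ) :
    (design 1 X t *ᵥ y) ⬝ᵥ (design 1 X t *ᵥ y) ≤ (t + 1) * (y ⬝ᵥ (design 1 X t *ᵥ y)) := by
  induction t with
  | zero => simp [design_zero]
  | succ t ih =>
    have ih := ih fun τ hτ => hX τ (by omega)
    have hx := hX t (by omega)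
    rw [design_succ, add_mulVec, vecMulVec_mulVec_eq]
    set g := design 1 X t *ᵥ y
    set x := X t
    have hyg : 0 ≤ y ⬝ᵥ g := posDef_quad_nonneg (design_posDef X t) y
    simp only [add_dotProduct, dotProduct_add, smul_dotProduct, dotProduct_smul, smul_eq_mul]
    rw [dotProduct_comm y x, dotProduct_comm g x]
    set q := x ⬝ᵥ y
    have hcs : (x ⬝ᵥ g) ^ 2 ≤ (x ⬝ᵥ x) * (g ⬝ᵥ g) := by
      simpa using dotProduct_sq_le_inv_mul (PosDef.one (R := ℝ) (n := Fin d)) x g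
    have h1 : (x ⬝ᵥ g) ^ 2 ≤ (t + 1) * (y ⬝ᵥ g) := by
      have : 0 ≤ g ⬝ᵥ g := by simpa using posDef_quad_nonneg (PosDef.one (R := ℝ) (n := Fin d)) g
      nlinarith
    have ht : (0 : ℝ) < t + 1 := by positivity
    have h2 : 2 * (q * (x ⬝ᵥ g)) ≤ (t + 1) * q ^ 2 + y ⬝ᵥ g := by
      have : 0 ≤ ((t + 1) * q - x ⬝ᵥ g) ^ 2 := sq_nonneg _
      have h3 : (t + 1) * (2 * (q * (x ⬝ᵥ g))) ≤ (t + 1) * ((t + 1) * q ^ 2 + y ⬝ᵥ g) := by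
        nlinarith
      exact le_of_mul_le_mul_left h3 ht
    push_cast
    nlinarith [sq_nonneg q, mul_nonneg (sq_nonneg q) (sub_nonneg.2 hx)]

end LinearBandit

theorem norm_toLp_sq {d : ℕ} (x : Fin d → ℝ) : ‖WithLp.toLp 2 x‖ ^ 2 = x ⬝ᵥ x := by
  rw [EuclideanSpace.real_norm_sq_eq]
  exact Finset.sum_congr rfl fun i _ => by simp [sq]

namespace LinearBandit

variable {d : ℕ}

/-- The confidence radius of the algorithm. -/
noncomputable def confRadius (d K : ℕ) (δ : ℝ) (t : ℕ) : ℝ :=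
  Real.sqrt (d * Real.log (1 + (t + 1) / d) + Real.log (2 * K / δ)) + 1 + Real.sqrt d

theorem lastChange_le (lam C : ℝ) (X : ℕ → Fin d → ℝ) (t : ℕ) : lastChange lam C X t ≤ t := by
  induction t with
  | zero => simp [lastChange]
  | succ t ih => unfold lastChange; split_ifs <;> omega

theorem lastChange_congr {X X' : ℕ → Fin d → ℝ} {C : ℝ} {t : ℕ} (h : ∀ τ < t, X τ = X' τ) :
    lastChange 1 C X t = lastChange 1 C X' t := by
  induction t with
  | zero => simp [lastChange]
  | succ t ih =>
    have ih := ih fun τ hτ => h τ (by omega)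
    have hle := lastChange_le 1 C X' t
    unfold lastChange
    rw [ih, design_congr (X := X) (X' := X') (t := t) fun τ hτ => h τ (by omega),
      design_congr (X := X) (X' := X') (t := lastChange 1 C X' t) fun τ hτ => h τ (by omega)]

theorem ridge_congr {X X' : ℕ → Fin d → ℝ} {Y Y' : ℕ → ℝ} {t : ℕ} (h : ∀ τ < t, X τ = X' τ)
    (h' : ∀ τ < t, Y τ = Y' τ) : ridge 1 X Y t = ridge 1 X' Y' t := by
  unfold ridge
  rw [design_congr h]
  congr 1
  refine Finset.sum_congr rfl fun τ hτ => ?_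
  rw [h τ (Finset.mem_range.1 hτ), h' τ (Finset.mem_range.1 hτ)]

theorem confSet_congr {X X' : ℕ → Fin d → ℝ} {Y Y' : ℕ → ℝ} {t : ℕ} (Θ : Set (Fin d → ℝ))
    (ρ : ℕ → ℝ) (h : ∀ τ < t, X τ = X' τ) (h' : ∀ τ < t, Y τ = Y' τ) :
    confSet 1 Θ ρ X Y t = confSet 1 Θ ρ X' Y' t := by
  unfold confSet
  rw [design_congr h, ridge_congr h h']

theorem IsRarelySwitchingOFUL.congr {D : Set (Fin d → ℝ)} {C : ℝ} {Θ : Set (Fin d → ℝ)}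
    {ρ : ℕ → ℝ} {K : ℕ} {X X' : ℕ → Fin d → ℝ} {Y Y' : ℕ → ℝ}
    (H : IsRarelySwitchingOFUL D 1 C Θ ρ K X Y) (h : ∀ τ < K, X τ = X' τ)
    (h' : ∀ τ < K, Y τ = Y' τ) : IsRarelySwitchingOFUL D 1 C Θ ρ K X' Y' := by
  have e1 : ∀ t < K, design 1 X' t = design 1 X t := fun t ht =>
    design_congr fun τ hτ => (h τ (hτ.trans ht)).symm
  have e2 : ∀ t < K, lastChange 1 C X' t = lastChange 1 C X t := fun t ht =>
    lastChange_congr fun τ hτ => (h τ (hτ.trans ht)).symm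
  have e3 : ∀ t < K, confSet 1 Θ ρ X' Y' t = confSet 1 Θ ρ X Y t := fun t ht =>
    confSet_congr Θ ρ (fun τ hτ => (h τ (hτ.trans ht)).symm) fun τ hτ => (h' τ (hτ.trans ht)).symm
  refine ⟨fun t ht => h t ht ▸ H.mem t ht, fun t ht => ?_, fun t ht => ?_⟩
  · rw [e2 t ht, e1 t ht, e1 _ ((lastChange_le _ _ _ _).trans_lt ht), e3 t ht, ← h t ht]
    exact H.update t ht
  · rw [e2 t ht, e1 t ht, e1 _ ((lastChange_le _ _ _ _).trans_lt ht), ← h t ht,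
      ← h (t - 1) (by omega)]
    exact H.keep t ht

/-- At each recomputation the determinant of the design matrix has doubled. -/
theorem two_pow_updates_le_det (X : ℕ → Fin d → ℝ) (n : ℕ) :
    2 ^ (((Finset.range (n + 1)).filter fun t =>
        (1 + 1) * (design 1 X (lastChange 1 1 X t)).det ≤ (design 1 X t).det).card) ≤
      (design 1 X (lastChange 1 1 X (n + 1))).det := by
  induction n with
  | zero =>
    have : ¬ ((1 + 1 : ℝ) * (design 1 X (lastChange 1 1 X 0)).det ≤ (design 1 X 0).det) := by
      simp [lastChange, design_zero]
    rw [Finset.range_one, Finset.filter_singleton, if_neg this]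
    simpa using one_le_design_det X _
  | succ n ih =>
    rw [Finset.range_add_one, Finset.filter_insert]
    by_cases h : (1 + 1 : ℝ) * (design 1 X (lastChange 1 1 X (n + 1))).det ≤
        (design 1 X (n + 1)).det
    · rw [if_pos h, Finset.card_insert_of_notMem (by simp), pow_succ]
      conv_rhs => rw [lastChange, if_pos h]
      linarith
    · rw [if_neg h]
      conv_rhs => rw [lastChange, if_neg h]
      exact ih

end LinearBandit

namespace FeatureMDP

open LinearBandit

variable {S : Type u} {A : Type v} [MeasurableSpace S] [MeasurableSpace A]
  (M : FeatureMDP S A 1)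

theorem feature_dotProduct_self_le (hM : M.Standing) (s : S) (a : A) :
    M.φ 0 s a ⬝ᵥ M.φ 0 s a ≤ 1 := by
  have := hM.feature_norm_le 0 s a
  rw [← norm_toLp_sq]
  exact pow_le_one₀ (norm_nonneg _) this

theorem param_dotProduct_self_le (hM : M.Standing) {θ : Fin (M.d 0) → ℝ}
    (hθ : θ ∈ M.paramSet 0) : θ ⬝ᵥ θ ≤ M.d 0 := by
  have := hM.param_norm_le 0 θ hθ
  rw [← norm_toLp_sq, ← Real.sq_sqrt (Nat.cast_nonneg (M.d 0))]
  exact pow_le_pow_left₀ (norm_nonneg _) this 2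

theorem isCompact_paramSet (hM : M.Standing) : IsCompact (M.paramSet 0) := by
  refine Metric.isCompact_of_isClosed_isBounded ?_ ?_
  · have : M.paramSet 0 = ⋂ s, ⋂ a, {θ | |M.φ 0 s a ⬝ᵥ θ| ≤ 1} := by
      ext θ; simp [paramSet]
    rw [this]
    refine isClosed_iInter fun s => isClosed_iInter fun a => isClosed_le ?_ continuous_const
    exact (Continuous.dotProduct continuous_const continuous_id).abs
  · refine (Metric.isBounded_closedBall (x := 0) (r := Real.sqrt (M.d 0))).subset fun θ hθ => ?_
    rw [mem_closedBall_zero_iff, pi_norm_le_iff_of_nonneg (Real.sqrt_nonneg _)]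
    exact fun i => (PiLp.norm_apply_le (WithLp.toLp 2 θ) i).trans (hM.param_norm_le 0 θ hθ)

theorem layerValue_one (θ : M.Params) (s : S) : M.layerValue (0 + 1) θ s = 0 := by
  simp [layerValue]

/-- With a single layer and inherent Bellman error zero the rewards are linear. -/
theorem exists_meanReward_eq (hM : M.Standing) (h0 : M.inherentBellmanError = 0) :
    ∃ θstar ∈ M.paramSet 0, ∀ s a, M.meanReward 0 s a = M.φ 0 s a ⬝ᵥ θstar := by
  have h1 : (⨅ θ ∈ M.paramSet 0, ⨆ s, ⨆ a,
      ENNReal.ofReal |M.φ 0 s a ⬝ᵥ θ - M.meanReward 0 s a|) = 0 := by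
    rw [inherentBellmanError, ENNReal.iSup_eq_zero] at h0
    have h := ENNReal.iSup_eq_zero.1 (h0 0) (fun _ => 0)
    rw [ENNReal.iSup_eq_zero] at h
    have h := h (fun j => by simp [paramSet])
    simpa [bellman, layerValue] using h
  have h2 : ∀ n : ℕ, ∃ θ ∈ M.paramSet 0, ∀ s a,
      |M.φ 0 s a ⬝ᵥ θ - M.meanReward 0 s a| ≤ 1 / ((n : ℝ) + 1) := by
    intro n
    have hpos : (0 : ENNReal) < ENNReal.ofReal (1 / ((n : ℝ) + 1)) := by
      rw [ENNReal.ofReal_pos]; positivity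
    rw [← h1] at hpos
    simp only [iInf_lt_iff] at hpos
    obtain ⟨θ, hθ, hlt⟩ := hpos
    refine ⟨θ, hθ, fun s a => ?_⟩
    have := (le_iSup₂ (f := fun s a => ENNReal.ofReal |M.φ 0 s a ⬝ᵥ θ - M.meanReward 0 s a|)
      s a).trans hlt.le
    exact (ENNReal.ofReal_le_ofReal_iff (by positivity)).1 this
  choose θ hθ hle using h2
  obtain ⟨θs, hθs, f, hf, hlim⟩ := (M.isCompact_paramSet hM).tendsto_subseq hθ
  refine ⟨θs, hθs, fun s a => ?_⟩
  have hc : Filter.Tendsto (fun n => |M.φ 0 s a ⬝ᵥ θ (f n) - M.meanReward 0 s a|) Filter.atTop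
      (nhds |M.φ 0 s a ⬝ᵥ θs - M.meanReward 0 s a|) := by
    have : Continuous fun θ : Fin (M.d 0) → ℝ => |M.φ 0 s a ⬝ᵥ θ - M.meanReward 0 s a| :=
      ((Continuous.dotProduct continuous_const continuous_id).sub continuous_const).abs
    exact (this.tendsto θs).comp hlim
  have h0' := le_of_tendsto_of_tendsto' hc
    (tendsto_one_div_add_atTop_nhds_zero_nat.comp hf.tendsto_atTop) fun n => hle (f n) s a
  have := abs_eq_zero.1 (le_antisymm h0' (abs_nonneg _))
  linarith

theorem valueToGo_one (π : Fin 1 → S → Measure A) (s : S) :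
    M.valueToGo π 1 s = ∫ a, M.meanReward 0 s a ∂(π 0 s) := by
  simp [valueToGo]

variable {M} {θstar : Fin (M.d 0) → ℝ}

theorem measurable_dotProduct_right (s : S) :
    Measurable fun a => M.φ 0 s a ⬝ᵥ θstar := by
  have h : Measurable fun a => M.φ 0 s a :=
    (M.φ_measurable 0).comp (measurable_const.prodMk measurable_id)
  exact (Continuous.dotProduct continuous_id continuous_const).measurable.comp h

theorem value_eq (hr : ∀ s a, M.meanReward 0 s a = M.φ 0 s a ⬝ᵥ θstar) (π : Policy S A 1) :
    M.value π = M.φ 0 M.s₁ (π 0 M.s₁) ⬝ᵥ θstar := by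
  rw [value, valueToGo_one]
  simp_rw [hr]
  exact integral_dirac' _ _ (measurable_dotProduct_right M.s₁).stronglyMeasurable

theorem bddAbove_range_dotProduct {θ : Fin (M.d 0) → ℝ} (hθ : θ ∈ M.paramSet 0) (s : S) :
    BddAbove (Set.range fun a => M.φ 0 s a ⬝ᵥ θ) :=
  ⟨1, by rintro _ ⟨a, rfl⟩; exact (abs_le.1 (hθ s a)).2⟩

theorem optValue_eq (hM : M.Standing) (hθ : θstar ∈ M.paramSet 0)
    (hr : ∀ s a, M.meanReward 0 s a = M.φ 0 s a ⬝ᵥ θstar) :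
    M.optValue = sSup ((fun x => x ⬝ᵥ θstar) '' Set.range (M.φ 0 M.s₁)) := by
  obtain ⟨a₀, ha₀⟩ := hM.max_attained 0 M.s₁ θstar hθ
  have hS : IsGreatest ((fun x => x ⬝ᵥ θstar) '' Set.range (M.φ 0 M.s₁))
      (M.φ 0 M.s₁ a₀ ⬝ᵥ θstar) :=
    ⟨⟨_, ⟨a₀, rfl⟩, rfl⟩, by rintro _ ⟨_, ⟨a, rfl⟩, rfl⟩; exact ha₀ a⟩
  rw [hS.csSup_eq]
  unfold optValue
  refine IsGreatest.csSup_eq ⟨⟨⟨fun _ => Kernel.const S (Measure.dirac a₀), fun _ => inferInstance⟩,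
    ?_⟩, ?_⟩
  · simp only [valueToGo_one, Kernel.const_apply, hr]
    exact integral_dirac' _ _ (measurable_dotProduct_right M.s₁).stronglyMeasurable
  · rintro _ ⟨⟨π, hπ⟩, rfl⟩
    have := hπ 0
    simp only [valueToGo_one, hr]
    have hint : Integrable (fun a => M.φ 0 M.s₁ a ⬝ᵥ θstar) (π 0 M.s₁) :=
      Integrable.of_bound (measurable_dotProduct_right M.s₁).aestronglyMeasurable 1
        (Filter.Eventually.of_forall fun a => hθ M.s₁ a)
    calc ∫ a, M.φ 0 M.s₁ a ⬝ᵥ θstar ∂(π 0 M.s₁)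
        ≤ ∫ _, M.φ 0 M.s₁ a₀ ⬝ᵥ θstar ∂(π 0 M.s₁) :=
          integral_mono hint (integrable_const _) ha₀
      _ = _ := by simp

theorem visited_eq_of_deploys {π : Policy S A 1} {e : Episode S A 1} (h : M.Deploys π e) :
    M.visited e 0 = M.φ 0 M.s₁ (π 0 M.s₁) := by
  have h0 : e.state (Fin.castSucc (0 : Fin 1)) = M.s₁ := h.1
  rw [visited, h.2 0, h0]

theorem regret_eq (hM : M.Standing) (hθ : θstar ∈ M.paramSet 0)
    (hr : ∀ s a, M.meanReward 0 s a = M.φ 0 s a ⬝ᵥ θstar) {K : ℕ} {ep : ℕ → Episode S A 1}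
    {π : ℕ → Policy S A 1} (hd : ∀ k < K, M.Deploys (π k) (ep k)) :
    M.regret K π = LinearBandit.regret (Set.range (M.φ 0 M.s₁)) θstar K
      fun k => M.visited (ep k) 0 := by
  unfold FeatureMDP.regret LinearBandit.regret
  refine Finset.sum_congr rfl fun k hk => ?_
  simp only [optValue_eq hM hθ hr, value_eq hr, visited_eq_of_deploys
      (hd k (Finset.mem_range.1 hk))]

section Run

variable (M) (ep : ℕ → Episode S A 1)

theorem gram_eq_design (k : ℕ) :
    M.gram ep 0 k = design 1 (fun τ => M.visited (ep τ) 0) k := by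
  simp [gram, design]

theorem refIndex_eq_lastChange (k : ℕ) :
    M.refIndex ep k = lastChange 1 1 (fun τ => M.visited (ep τ) 0) k := by
  induction k with
  | zero => simp [refIndex, lastChange]
  | succ k ih =>
    unfold refIndex lastChange
    rw [ih]
    simp only [Fin.exists_fin_one, gram_eq_design, one_add_one_eq_two]

theorem updates_iff (k : ℕ) : M.Updates ep k ↔
    (k = 0 ∨ (1 + 1) * (design 1 (fun τ => M.visited (ep τ) 0)
      (lastChange 1 1 (fun τ => M.visited (ep τ) 0) k)).det ≤
      (design 1 (fun τ => M.visited (ep τ) 0) k).det) := by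
  unfold Updates
  rw [refIndex_eq_lastChange]
  simp only [Fin.exists_fin_one, gram_eq_design, one_add_one_eq_two]

theorem leastSquares_eq_ridge (k : ℕ) (θ : M.Params) : M.leastSquares ep k θ 0 =
    ridge 1 (fun τ => M.visited (ep τ) 0) (fun τ => (ep τ).reward 0) k := by
  have h : ∀ s, M.layerValue ((0 : Fin 1) + 1) θ s = 0 := M.layerValue_one θ
  simp only [leastSquares, ridge, gram_eq_design, h, add_zero]

theorem sqrtAlpha_eq (K : ℕ) (δ : ℝ) (k : ℕ) :
    M.sqrtAlpha K δ 0 0 (k + 1) = confRadius (M.d 0) K δ k := by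
  simp [sqrtAlpha, sqrtBeta, nextDim, confRadius]

theorem planFeasible_of_mem_confSet {K : ℕ} {δ : ℝ} {k : ℕ} {θ : M.Params}
    (hθ : θ 0 ∈ confSet 1 (M.paramSet 0) (confRadius (M.d 0) K δ)
      (fun τ => M.visited (ep τ) 0) (fun τ => (ep τ).reward 0) k) :
    M.PlanFeasible K δ 0 ep k (fun h => θ h - M.leastSquares ep k θ h)
      (fun h => M.leastSquares ep k θ h) θ where
  least_squares _ := rfl
  perturbed h := by simp
  radius h := by
    obtain rfl := Subsingleton.elim 0 h
    rw [leastSquares_eq_ridge, gram_eq_design, sqrtAlpha_eq]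
    exact hθ.2
  mem h := by
    obtain rfl := Subsingleton.elim 0 h
    exact hθ.1

variable {M ep}

theorem PlanFeasible.mem_confSet {K : ℕ} {δ : ℝ} {k : ℕ} {ξ θhat θ : M.Params}
    (h : M.PlanFeasible K δ 0 ep k ξ θhat θ) :
    θ 0 ∈ confSet 1 (M.paramSet 0) (confRadius (M.d 0) K δ)
      (fun τ => M.visited (ep τ) 0) (fun τ => (ep τ).reward 0) k := by
  refine ⟨h.mem 0, ?_⟩
  have h1 := h.radius 0
  have h2 : ξ 0 = θ 0 - M.leastSquares ep k θ 0 := by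
    rw [h.perturbed 0, h.least_squares 0, add_sub_cancel_left]
  rwa [h2, leastSquares_eq_ridge, gram_eq_design, sqrtAlpha_eq] at h1

theorem layerValue_zero (θ : M.Params) (s : S) :
    M.layerValue 0 θ s = ⨆ a, M.φ 0 s a ⬝ᵥ θ 0 := by
  simp [layerValue]

theorem IsEleanorRun.isRarelySwitchingOFUL [Nonempty A] {K : ℕ} {δ : ℝ} {π : ℕ → Policy S A 1}
    (h : M.IsEleanorRun K δ 0 ep π) :
    IsRarelySwitchingOFUL (Set.range (M.φ 0 M.s₁)) 1 1 (M.paramSet 0) (confRadius (M.d 0) K δ) K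
      (fun τ => M.visited (ep τ) 0) (fun τ => (ep τ).reward 0) where
  mem t ht := ⟨_, (visited_eq_of_deploys (h.deploy t ht)).symm⟩
  update t ht hup hne := by
    obtain ⟨θ, hθ⟩ := hne
    let θ' : M.Params := fun i => Fin.cases (motive := fun i => Fin (M.d i) → ℝ)
        θ (fun j => j.elim0) i
    have hθ' : θ' 0 = θ := rfl
    obtain ⟨ξ, θhat, θbar, hopt, hgr⟩ := h.update t ht ((M.updates_iff ep t).2 hup)
      ⟨_, _, θ', M.planFeasible_of_mem_confSet ep (by rw [hθ']; exact hθ)⟩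
    refine ⟨θbar 0, hopt.1.mem_confSet, ?_⟩
    rintro _ ⟨a, rfl⟩ ψ hψ
    let ψ' : M.Params := fun i => Fin.cases (motive := fun i => Fin (M.d i) → ℝ)
        ψ (fun j => j.elim0) i
    have hψ' : ψ' 0 = ψ := rfl
    have h1 := hopt.2 _ _ ψ' (M.planFeasible_of_mem_confSet ep (by rw [hψ']; exact hψ))
    rw [layerValue_zero, layerValue_zero] at h1
    rw [visited_eq_of_deploys (h.deploy t ht)]
    calc M.φ 0 M.s₁ a ⬝ᵥ ψ ≤ ⨆ a, M.φ 0 M.s₁ a ⬝ᵥ ψ' 0 :=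
          le_ciSup (f := fun a => M.φ 0 M.s₁ a ⬝ᵥ ψ) (bddAbove_range_dotProduct hψ.1 _) a
      _ ≤ _ := h1
      _ ≤ _ := ciSup_le fun a' => hgr 0 M.s₁ a'
  keep t ht hup := by
    have h1 := h.keep t ht fun hu => hup ((M.updates_iff ep t).1 hu)
    rw [visited_eq_of_deploys (h.deploy t ht), visited_eq_of_deploys (h.deploy (t - 1) (by omega)),
      h1]

/-- Every run of the bandit algorithm comes from a run of ELEANOR-LowSwitching. -/
theorem exists_isEleanorRun [Nonempty A] (hM : M.Standing) {K : ℕ} {δ : ℝ}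
    {X : ℕ → Fin (M.d 0) → ℝ} {Y : ℕ → ℝ}
    (h : IsRarelySwitchingOFUL (Set.range (M.φ 0 M.s₁)) 1 1 (M.paramSet 0)
      (confRadius (M.d 0) K δ) K X Y) :
    ∃ (ep : ℕ → Episode S A 1) (π : ℕ → Policy S A 1), M.IsEleanorRun K δ 0 ep π ∧
      ∀ k < K, X k = M.visited (ep k) 0 ∧ Y k = (ep k).reward 0 := by
  classical
  have hex : ∀ t, ∃ p : Policy S A 1, t < K → M.φ 0 M.s₁ (p 0 M.s₁) = X t ∧
      ((t = 0 ∨ (1 + 1) * (design 1 X (lastChange 1 1 X t)).det ≤ (design 1 X t).det) →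
        (confSet 1 (M.paramSet 0) (confRadius (M.d 0) K δ) X Y t).Nonempty →
        ∃ θ ∈ confSet 1 (M.paramSet 0) (confRadius (M.d 0) K δ) X Y t,
          (∀ x ∈ Set.range (M.φ 0 M.s₁),
            ∀ θ' ∈ confSet 1 (M.paramSet 0) (confRadius (M.d 0) K δ) X Y t,
              x ⬝ᵥ θ' ≤ X t ⬝ᵥ θ) ∧
          ∀ s a, M.φ 0 s a ⬝ᵥ θ ≤ M.φ 0 s (p 0 s) ⬝ᵥ θ) := by
    intro t
    by_cases ht : t < K
    swap
    · exact ⟨fun _ _ => Classical.arbitrary A, fun h => absurd h ht⟩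
    obtain ⟨a, ha⟩ := h.mem t ht
    by_cases hc : (t = 0 ∨ (1 + 1) * (design 1 X (lastChange 1 1 X t)).det ≤
      (design 1 X t).det) ∧ (confSet 1 (M.paramSet 0) (confRadius (M.d 0) K δ) X Y t).Nonempty
    · obtain ⟨θ, hθ, hopt⟩ := h.update t ht hc.1 hc.2
      choose g hg using fun s => hM.max_attained 0 s θ hθ.1
      refine ⟨fun _ s => if s = M.s₁ then a else g s, fun _ => ⟨by simpa using ha, fun _ _ =>
        ⟨θ, hθ, hopt, fun s b => ?_⟩⟩⟩
      by_cases hs : s = M.s₁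
      · subst hs
        simp only [if_true, ha]
        exact hopt _ ⟨b, rfl⟩ θ hθ
      · simpa [hs] using hg s b
    · exact ⟨fun _ _ => a, fun _ => ⟨ha, fun h1 h2 => absurd ⟨h1, h2⟩ hc⟩⟩
  choose p hp using hex
  let π : ℕ → Policy S A 1 := fun t => Nat.rec (p 0) (fun n q =>
    if (n + 1 = 0 ∨ (1 + 1) * (design 1 X (lastChange 1 1 X (n + 1))).det ≤
      (design 1 X (n + 1)).det) then p (n + 1) else q) t
  have hπup : ∀ t, (t = 0 ∨ (1 + 1) * (design 1 X (lastChange 1 1 X t)).det ≤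
      (design 1 X t).det) → π t = p t := by
    intro t ht
    cases t with
    | zero => rfl
    | succ n => exact if_pos ht
  have hπkeep : ∀ t, ¬ (t = 0 ∨ (1 + 1) * (design 1 X (lastChange 1 1 X t)).det ≤
      (design 1 X t).det) → π t = π (t - 1) := by
    intro t ht
    cases t with
    | zero => simp at ht
    | succ n => exact if_neg ht
  have hX : ∀ t < K, M.φ 0 M.s₁ (π t 0 M.s₁) = X t := by
    intro t
    induction t with
    | zero => intro ht; exact (hp 0 ht).1
    | succ n ih =>
      intro ht
      by_cases hc : (n + 1 = 0 ∨ (1 + 1) * (design 1 X (lastChange 1 1 X (n + 1))).det ≤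
        (design 1 X (n + 1)).det)
      · rw [hπup _ hc]; exact (hp _ ht).1
      · rw [hπkeep _ hc, h.keep _ ht hc]; exact ih (by omega)
  let ep : ℕ → Episode S A 1 := fun t => ⟨fun _ => M.s₁, fun _ => π t 0 M.s₁, fun _ => Y t⟩
  have hv : ∀ t < K, M.visited (ep t) 0 = X t := fun t ht => hX t ht
  refine ⟨ep, π, ⟨fun k _ => ⟨rfl, fun i => ?_⟩, fun t ht hup _ => ?_, fun t ht hup => ?_⟩,
    fun k hk => ⟨(hv k hk).symm, rfl⟩⟩
  · obtain rfl := Subsingleton.elim 0 i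
    rfl
  all_goals
    have e1 : ∀ s ≤ t, design 1 (fun τ => M.visited (ep τ) 0) s = design 1 X s := fun s hs =>
      design_congr fun τ hτ => hv τ (by omega)
    have e2 : lastChange 1 1 (fun τ => M.visited (ep τ) 0) t = lastChange 1 1 X t :=
      lastChange_congr fun τ hτ => hv τ (by omega)
    have e3 := confSet_congr (Y := Y) (Y' := Y) (t := t) (M.paramSet 0) (confRadius (M.d 0) K δ)
      (fun τ hτ => hv τ (by omega)) fun _ _ => rfl
    rw [updates_iff, e2, e1 _ (lastChange_le _ _ _ _), e1 t le_rfl] at hup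
  · rename_i hfeas
    obtain ⟨ξ, θhat, θbar, hf⟩ := hfeas
    obtain ⟨θ, hθ, hopt, hgr⟩ := (hp t ht).2 hup ⟨_, by rw [← e3]; exact hf.mem_confSet⟩
    let θ' : M.Params := fun i => Fin.cases (motive := fun i => Fin (M.d i) → ℝ)
        θ (fun j => j.elim0) i
    have hθ' : θ' 0 = θ := rfl
    refine ⟨_, _, θ', ⟨M.planFeasible_of_mem_confSet ep (by rw [hθ']; exact e3 ▸ hθ), ?_⟩, ?_⟩
    · intro ξ₂ θhat₂ θbar₂ hf₂
      rw [layerValue_zero, layerValue_zero]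
      refine ciSup_le fun a => ?_
      refine (hopt _ ⟨a, rfl⟩ _ (by rw [← e3]; exact hf₂.mem_confSet)).trans ?_
      rw [← (hp t ht).1]
      exact le_ciSup (f := fun a => M.φ 0 M.s₁ a ⬝ᵥ θ) (bddAbove_range_dotProduct hθ.1 _) _
    · intro i s a
      obtain rfl := Subsingleton.elim 0 i
      rw [hπup t hup]
      exact hgr s a
  · exact hπkeep t hup

theorem IsEleanorRun.switchingCost_le (hM : M.Standing) {K : ℕ} (hK : 1 ≤ K) {δ : ℝ}
    {π : ℕ → Policy S A 1} (h : M.IsEleanorRun K δ 0 ep π) :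
    (switchingCost K π : ℝ) ≤ (Real.log 2)⁻¹ * (M.d 0 * Real.log K) := by
  classical
  obtain ⟨n, rfl⟩ : ∃ n, K = n + 1 := ⟨K - 1, by omega⟩
  set X : ℕ → Fin (M.d 0) → ℝ := fun τ => M.visited (ep τ) 0 with hXd
  have hX : ∀ τ, X τ ⬝ᵥ X τ ≤ 1 := fun τ => M.feature_dotProduct_self_le hM _ _
  set F := (Finset.range (n + 1)).filter fun t =>
        (1 + 1) * (design 1 X (lastChange 1 1 X t)).det ≤ (design 1 X t).det with hF
  have h1 : switchingCost (n + 1) π ≤ F.card := by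
    unfold switchingCost
    rw [Finset.sum_ite, Finset.sum_const_zero, add_zero, ← Finset.card_eq_sum_ones]
    refine Finset.card_le_card_of_injOn (· + 1) (fun k hk => ?_) fun a _ b _ hab => by
      simpa using hab
    simp only [Finset.coe_filter, Finset.mem_range, Set.mem_ofPred_eq, Nat.add_sub_cancel] at hk
    simp only [hF, Finset.coe_filter, Finset.mem_range, Set.mem_ofPred_eq]
    refine ⟨by omega, ?_⟩
    by_contra hc
    refine hk.2 (h.keep (k + 1) (by omega) fun hu => ?_).symm
    rcases (M.updates_iff ep (k + 1)).1 hu with h0 | h0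
    · omega
    · exact hc h0
  have h2 : (2 : ℝ) ^ F.card ≤ (n + 1 : ℝ) ^ (M.d 0) := by
    refine (two_pow_updates_le_det X n).trans ?_
    have hle : lastChange 1 1 X (n + 1) ≤ n := by
      unfold lastChange; split_ifs
      · exact le_rfl
      · exact lastChange_le _ _ _ _
    refine (design_det_mono X hle).trans ((design_det_le X fun τ _ => hX τ).trans ?_)
    rcases Nat.eq_zero_or_pos (M.d 0) with h0 | h0
    · simp [h0]
    · refine pow_le_pow_left₀ (by positivity) ?_ _
      have : (n : ℝ) / M.d 0 ≤ n := div_le_self (by positivity) (by exact_mod_cast h0)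
      linarith
  have h3 : (F.card : ℝ) * Real.log 2 ≤ M.d 0 * Real.log (n + 1) := by
    rw [← Real.log_pow, ← Real.log_pow]
    exact Real.log_le_log (by positivity) h2
  have h4 : (switchingCost (n + 1) π : ℝ) ≤ F.card := by exact_mod_cast h1
  have hl : 0 < Real.log 2 := Real.log_pos (by norm_num)
  rw [inv_mul_eq_div, le_div_iff₀ hl]
  push_cast
  nlinarith

end Run

end FeatureMDP

namespace FeatureMDP

variable {S : Type u} {A : Type v} [MeasurableSpace S] [MeasurableSpace A]
  {M : FeatureMDP S A 1} {θstar : Fin (M.d 0) → ℝ}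

theorem integral_id_mem_Icc {μ : Measure ℝ} [IsProbabilityMeasure μ]
    (h : ∀ᵐ r ∂μ, r ∈ Set.Icc (0 : ℝ) 1) : ∫ r, r ∂μ ∈ Set.Icc (0 : ℝ) 1 := by
  have hint : Integrable (fun r : ℝ => r) μ := Integrable.of_mem_Icc 0 1 aemeasurable_id h
  refine ⟨integral_nonneg_of_ae (h.mono fun r hr => hr.1), ?_⟩
  calc ∫ r, r ∂μ ≤ ∫ _, (1 : ℝ) ∂μ :=
        integral_mono_ae hint (integrable_const _) (h.mono fun r hr => hr.2)
    _ = 1 := by simp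

theorem feature_dotProduct_mem_Icc (hM : M.Standing)
    (hr : ∀ s a, M.meanReward 0 s a = M.φ 0 s a ⬝ᵥ θstar) (s : S) (a : A) :
    M.φ 0 s a ⬝ᵥ θstar ∈ Set.Icc (0 : ℝ) 1 := by
  have := M.rew_markov 0
  rw [← hr]
  exact integral_id_mem_Icc (hM.reward_mem 0 s a)

/-- A one-step MDP with linear rewards is a linear bandit. -/
theorem IsInteraction.linearBandit (hM : M.Standing)
    (hr : ∀ s a, M.meanReward 0 s a = M.φ 0 s a ⬝ᵥ θstar)
    {Ω : Type w} {mΩ : MeasurableSpace Ω} {P : Measure Ω} [IsProbabilityMeasure P]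
    {ℱ : Filtration ℕ mΩ} {K : ℕ} {ep : ℕ → Ω → Episode S A 1} {π : ℕ → Ω → Policy S A 1}
    (h : M.IsInteraction P ℱ K ep π) :
    LinearBandit.IsInteraction P ℱ (Set.range (M.φ 0 M.s₁)) θstar K
      (fun k ω => M.visited (ep k ω) 0) (fun k ω => (ep k ω).reward 0) := by
  have hrm := M.rew_markov 0
  have htm := M.trans_markov 0
  have he : ∀ k : ℕ, k * 1 + ((0 : Fin 1) : ℕ) = k := fun k => by simp
  have hz : ∀ k < K, Measurable[ℱ k] fun ω => ((ep k ω).state (Fin.castSucc (0 : Fin 1)),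
      (ep k ω).action 0) := fun k hk => by
    have h1 := h.state_measurable k hk 0
    have h2 := h.action_measurable k hk 0
    rw [he] at h1 h2
    exact h1.prodMk h2
  have hY : ∀ k < K, Measurable[ℱ (k + 1)] fun ω => (ep k ω).reward 0 := fun k hk => by
    have h1 := h.reward_measurable k hk 0
    rw [he] at h1
    exact h1
  have hXm : ∀ k < K, Measurable[ℱ k] fun ω => M.visited (ep k ω) 0 := fun k hk =>
    (M.φ_measurable 0).comp (hz k hk)
  have hmap : ∀ (k : ℕ) (hk : k < K), ∀ s, MeasurableSet[ℱ k] s →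
      (P.restrict s).map (fun ω => (ep k ω).reward 0) =
        (P.restrict s).bind ((M.rew 0).comap _ ((hz k hk).mono (ℱ.le k) le_rfl)) := by
    intro k hk s hs
    have hYm := (hY k hk).mono (ℱ.le _) le_rfl
    ext B hB
    rw [Measure.map_apply hYm hB, Measure.bind_apply hB (Kernel.aemeasurable _),
      Measure.restrict_apply (hYm hB)]
    have hlaw := h.law k hk 0 (B ×ˢ Set.univ) (hB.prod MeasurableSet.univ)
    rw [he] at hlaw
    simp only [Set.mem_prod, Set.mem_univ, and_true] at hlaw
    have hlaw' : P⟦(fun ω => (ep k ω).reward 0) ⁻¹' B | ℱ k⟧ =ᵐ[P] fun ω =>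
        (M.rew 0 ((ep k ω).state (Fin.castSucc (0 : Fin 1)), (ep k ω).action 0)).real B := by
      refine hlaw.trans (Filter.Eventually.of_forall fun ω => ?_)
      simp only [Measure.real, Measure.prod_prod, measure_univ, mul_one]
    have hi : Integrable (Set.indicator ((fun ω => (ep k ω).reward 0) ⁻¹' B)
        fun _ => (1 : ℝ)) P := (integrable_const 1).indicator (hYm hB)
    have e1 := setIntegral_condExp (ℱ.le k) hi hs
    have e2 : ∫ ω in s, Set.indicator ((fun ω => (ep k ω).reward 0) ⁻¹' B) (fun _ => (1 : ℝ)) ω ∂P =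
        (P.restrict s).real ((fun ω => (ep k ω).reward 0) ⁻¹' B) := integral_indicator_one (hYm hB)
    rw [e2] at e1
    rw [setIntegral_congr_ae (ℱ.le k _ hs) (hlaw'.mono fun ω hω _ => hω)] at e1
    have hne : (P.restrict s) ((fun ω => (ep k ω).reward 0) ⁻¹' B) ≠ ⊤ := measure_ne_top _ _
    rw [← Measure.restrict_apply (hYm hB), ← ofReal_measureReal hne, ← e1,
      ofReal_integral_eq_lintegral_ofReal]
    · refine lintegral_congr fun ω => ?_
      rw [Kernel.comap_apply, ofReal_measureReal]
    · refine Integrable.of_bound (C := 1) ?_ (Filter.Eventually.of_forall fun ω => ?_)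
      · have : Measurable fun ω => ((M.rew 0)
            ((ep k ω).state (Fin.castSucc (0 : Fin 1)), (ep k ω).action 0)).real B :=
          ((Kernel.measurable_coe _ hB).comp ((hz k hk).mono (ℱ.le k) le_rfl)).ennreal_toReal
        exact this.aestronglyMeasurable
      · rw [Real.norm_of_nonneg measureReal_nonneg]
        exact measureReal_le_one
    · exact Filter.Eventually.of_forall fun ω => measureReal_nonneg
  have hIcc : ∀ k < K, ∀ᵐ ω ∂P, (ep k ω).reward 0 ∈ Set.Icc (0 : ℝ) 1 := by
    intro k hk
    have h1 := hmap k hk Set.univ MeasurableSet.univ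
    rw [Measure.restrict_univ] at h1
    have hYm := (hY k hk).mono (ℱ.le _) le_rfl
    have h2 : ∀ᵐ r ∂(P.map fun ω => (ep k ω).reward 0), r ∈ Set.Icc (0 : ℝ) 1 := by
      have hc : MeasurableSet {a : ℝ | a ∉ Set.Icc (0 : ℝ) 1} := measurableSet_Icc.compl
      rw [h1, ae_iff, Measure.bind_apply hc (Kernel.aemeasurable _),
        lintegral_eq_zero_iff (Kernel.measurable_coe _ hc)]
      refine Filter.Eventually.of_forall fun ω => ?_
      exact hM.reward_mem 0 _ _
    exact ae_of_ae_map hYm.aemeasurable h2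
  refine ⟨fun k hk ω => ⟨_, (visited_eq_of_deploys (h.deploy k hk ω)).symm⟩, hXm, hY, hIcc,
    fun k hk => ?_⟩
  have hYm := (hY k hk).mono (ℱ.le _) le_rfl
  have hYi : Integrable (fun ω => (ep k ω).reward 0) P :=
    Integrable.of_mem_Icc 0 1 hYm.aemeasurable (hIcc k hk)
  have hpm : Measurable[ℱ k] fun ω => M.visited (ep k ω) 0 ⬝ᵥ θstar :=
    (Continuous.dotProduct continuous_id continuous_const).measurable.comp (hXm k hk)
  have hpi : Integrable (fun ω => M.visited (ep k ω) 0 ⬝ᵥ θstar) P :=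
    Integrable.of_mem_Icc 0 1 (hpm.mono (ℱ.le _) le_rfl).aemeasurable
      (Filter.Eventually.of_forall fun ω => feature_dotProduct_mem_Icc hM hr _ _)
  refine (ae_eq_condExp_of_forall_setIntegral_eq (ℱ.le k) hYi (fun s _ _ => hpi.integrableOn)
    (fun s hs _ => ?_) hpm.stronglyMeasurable.aestronglyMeasurable).symm
  have e1 : ∫ ω in s, (ep k ω).reward 0 ∂P =
      ∫ r, r ∂((P.restrict s).map fun ω => (ep k ω).reward 0) :=
    (integral_map hYm.aemeasurable aestronglyMeasurable_id).symm
  rw [e1, hmap k hk s hs, Measure.comp_eq_comp_const_apply, Kernel.integral_comp]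
  · refine integral_congr_ae (Filter.Eventually.of_forall fun ω => ?_)
    exact (hr _ _).symm
  · rw [← Measure.comp_eq_comp_const_apply, ← hmap k hk s hs]
    exact (integrable_map_measure aestronglyMeasurable_id hYm.aemeasurable).2 hYi.integrableOn

end FeatureMDP

/-- Hoeffding's lemma for a Bernoulli variable. -/
theorem bernoulli_mgf_le {p : ℝ} (hp : p ∈ Set.Icc (0 : ℝ) 1) (s : ℝ) :
    (1 - p) * Real.exp (s * (0 - p)) + p * Real.exp (s * (1 - p)) ≤ Real.exp (s ^ 2 / 8) := by
  set μ : Measure ℝ := ENNReal.ofReal (1 - p) • Measure.dirac 0 + ENNReal.ofReal p • Measure.dirac 1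
    with hμ
  have hprob : IsProbabilityMeasure μ := ⟨by
    simp only [hμ, Measure.coe_add, Pi.add_apply, Measure.coe_smul, Pi.smul_apply, measure_univ,
      smul_eq_mul, mul_one]
    rw [← ENNReal.ofReal_add (by linarith [hp.2]) hp.1]; simp⟩
  have hint : ∀ f : ℝ → ℝ, ∫ x, f x ∂μ = (1 - p) * f 0 + p * f 1 := by
    intro f
    rw [hμ, integral_add_measure, integral_smul_measure, integral_smul_measure, integral_dirac,
      integral_dirac, ENNReal.toReal_ofReal (by linarith [hp.2]), ENNReal.toReal_ofReal hp.1]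
    · rfl
    · exact (integrable_dirac (by simp)).smul_measure ENNReal.ofReal_ne_top
    · exact (integrable_dirac (by simp)).smul_measure ENNReal.ofReal_ne_top
  have hb : ∀ᵐ x ∂μ, id x ∈ Set.Icc (0 : ℝ) 1 := by
    rw [ae_iff, hμ]
    simp
  have h := (hasSubgaussianMGF_of_mem_Icc (X := id) (μ := μ) aemeasurable_id hb).mgf_le s
  rw [mgf, hint, hint] at h
  refine (le_of_eq ?_).trans (h.trans (le_of_eq ?_))
  · simp
  · congr 1
    push_cast
    simp
    ring

/-- Averaging a function that is measurable with respect to `m` against a nonnegative random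
variable or against its conditional expectation given `m` is the same. -/
theorem lintegral_mul_ofReal_of_condExp_eq {Ω : Type w} {m mΩ : MeasurableSpace Ω} (hm : m ≤ mΩ)
    {P : Measure Ω} [IsProbabilityMeasure P] {Y p : Ω → ℝ} (hY : Integrable Y P)
    (hYm : Measurable Y) (hpm : Measurable p)
    (hY0 : 0 ≤ᵐ[P] Y) (hp : P[Y | m] =ᵐ[P] p) {f : Ω → ENNReal} (hf : Measurable[m] f) :
    ∫⁻ ω, f ω * ENNReal.ofReal (Y ω) ∂P = ∫⁻ ω, f ω * ENNReal.ofReal (p ω) ∂P := by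
  have hpi : Integrable p P := integrable_condExp.congr hp
  have hp0 : 0 ≤ᵐ[P] p := (condExp_nonneg hY0).trans_eq hp
  have hf' : Measurable f := hf.mono hm le_rfl
  have e : ∀ Z : Ω → ℝ, Measurable Z → ∫⁻ ω, f ω * ENNReal.ofReal (Z ω) ∂P =
      ∫⁻ ω, f ω ∂((P.withDensity fun ω => ENNReal.ofReal (Z ω)).trim hm) := fun Z hZ => by
    rw [lintegral_trim hm hf, lintegral_withDensity_eq_lintegral_mul _ hZ.ennreal_ofReal hf']
    exact lintegral_congr fun ω => mul_comm _ _
  rw [e Y hYm, e p hpm]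
  congr 1
  refine @Measure.ext _ m _ _ fun s hs => ?_
  rw [trim_measurableSet_eq hm hs, trim_measurableSet_eq hm hs, withDensity_apply _ (hm s hs),
    withDensity_apply _ (hm s hs), ← ofReal_integral_eq_lintegral_ofReal hY.integrableOn
      (ae_restrict_of_ae hY0), ← ofReal_integral_eq_lintegral_ofReal hpi.integrableOn
      (ae_restrict_of_ae hp0), ← setIntegral_condExp hm hY hs]
  congr 1
  exact setIntegral_congr_ae (hm s hs) (hp.mono fun ω hω _ => hω)

/-- How the self-normalized square changes with a rank-one update. -/
theorem inv_quad_rank_one_update {d : ℕ} {V : Matrix (Fin d) (Fin d) ℝ} (hV : V.PosDef)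
    (s x : Fin d → ℝ) (η : ℝ) :
    (s + η • x) ⬝ᵥ ((V + vecMulVec x x)⁻¹ *ᵥ (s + η • x)) = s ⬝ᵥ (V⁻¹ *ᵥ s) +
      (2 * (x ⬝ᵥ (V⁻¹ *ᵥ s)) * η + (x ⬝ᵥ (V⁻¹ *ᵥ x)) * η ^ 2 - (x ⬝ᵥ (V⁻¹ *ᵥ s)) ^ 2) /
        (1 + x ⬝ᵥ (V⁻¹ *ᵥ x)) := by
  have hw : 0 ≤ x ⬝ᵥ (V⁻¹ *ᵥ x) := posDef_quad_nonneg hV.inv x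
  have hsym : s ⬝ᵥ (V⁻¹ *ᵥ x) = x ⬝ᵥ (V⁻¹ *ᵥ s) :=
    Matrix.PosDef.mulVec_dotProduct_comm hV.inv.isHermitian s x
  rw [inv_add_vecMulVec_self hV, sub_mulVec, smul_mulVec, vecMulVec_mulVec_eq]
  simp only [mulVec_add, mulVec_smul, dotProduct_add, add_dotProduct, dotProduct_sub,
    dotProduct_smul, smul_dotProduct, smul_eq_mul, hsym, dotProduct_comm (V⁻¹ *ᵥ x) s,
    dotProduct_comm (V⁻¹ *ᵥ x) x]
  have : 1 + x ⬝ᵥ (V⁻¹ *ᵥ x) ≠ 0 := by positivity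
  field_simp
  ring

namespace LinearBandit

variable {d : ℕ}

/-- The accumulated noise of the first `t` rounds. -/
noncomputable def noiseSum (θstar : Fin d → ℝ) (X : ℕ → Fin d → ℝ) (Y : ℕ → ℝ) (t : ℕ) :
    Fin d → ℝ :=
  ∑ τ ∈ Finset.range t, (Y τ - X τ ⬝ᵥ θstar) • X τ

/-- The self-normalized exponential supermartingale. -/
noncomputable def selfNormalized (θstar : Fin d → ℝ) (X : ℕ → Fin d → ℝ) (Y : ℕ → ℝ) (t : ℕ) : ℝ :=
  Real.exp (noiseSum θstar X Y t ⬝ᵥ ((design 1 X t)⁻¹ *ᵥ noiseSum θstar X Y t)) /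
    (design 1 X t).det

variable {θstar : Fin d → ℝ}

theorem selfNormalized_pos (X : ℕ → Fin d → ℝ) (Y : ℕ → ℝ) (t : ℕ) :
    0 < selfNormalized θstar X Y t :=
  div_pos (Real.exp_pos _) (design_det_pos X t)

theorem selfNormalized_step {X : ℕ → Fin d → ℝ} {Y : ℕ → ℝ} {t : ℕ} :
    ∃ w u : ℝ, w = X t ⬝ᵥ ((design 1 X t)⁻¹ *ᵥ X t) ∧
      u = X t ⬝ᵥ ((design 1 X t)⁻¹ *ᵥ noiseSum θstar X Y t) ∧ 0 ≤ w ∧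
      selfNormalized θstar X Y (t + 1) = selfNormalized θstar X Y t / (1 + w) *
        Real.exp ((2 * u * (Y t - X t ⬝ᵥ θstar) + w * (Y t - X t ⬝ᵥ θstar) ^ 2 - u ^ 2) /
          (1 + w)) := by
  refine ⟨_, _, rfl, rfl, posDef_quad_nonneg (design_posDef X t).inv _, ?_⟩
  have hs : noiseSum θstar X Y (t + 1) = noiseSum θstar X Y t + (Y t - X t ⬝ᵥ θstar) • X t := by
    simp [noiseSum, Finset.sum_range_succ]
  rw [selfNormalized, design_det_succ, design_succ, hs,
    inv_quad_rank_one_update (design_posDef X t), Real.exp_add, selfNormalized,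
        div_div, div_mul_eq_mul_div]

/-- The weights of the two extreme rewards in a chord bound for `selfNormalized` after one more
round. -/
noncomputable def chordWeight (θstar : Fin d → ℝ) (X : ℕ → Fin d → ℝ) (Y : ℕ → ℝ) (t : ℕ)
    (y : ℝ) : ℝ :=
  selfNormalized θstar X Y t / (1 + X t ⬝ᵥ ((design 1 X t)⁻¹ *ᵥ X t)) *
    Real.exp ((2 * (X t ⬝ᵥ ((design 1 X t)⁻¹ *ᵥ noiseSum θstar X Y t)) * (y - X t ⬝ᵥ θstar) +
      X t ⬝ᵥ ((design 1 X t)⁻¹ *ᵥ X t) -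
      (X t ⬝ᵥ ((design 1 X t)⁻¹ *ᵥ noiseSum θstar X Y t)) ^ 2) /
          (1 + X t ⬝ᵥ ((design 1 X t)⁻¹ *ᵥ X t)))

theorem chordWeight_nonneg (X : ℕ → Fin d → ℝ) (Y : ℕ → ℝ) (t : ℕ) (y : ℝ) :
    0 ≤ chordWeight θstar X Y t y := by
  have hw := posDef_quad_nonneg (design_posDef X t).inv (X t)
  exact mul_nonneg (div_nonneg (selfNormalized_pos _ _ _).le (by positivity)) (Real.exp_pos _).le

theorem selfNormalized_succ_le {X : ℕ → Fin d → ℝ} {Y : ℕ → ℝ} {t : ℕ}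
    (hp : X t ⬝ᵥ θstar ∈ Set.Icc (0 : ℝ) 1) (hY : Y t ∈ Set.Icc (0 : ℝ) 1) :
    selfNormalized θstar X Y (t + 1) ≤
      chordWeight θstar X Y t 0 * (1 - Y t) + chordWeight θstar X Y t 1 * Y t := by
  obtain ⟨w, u, hw, hu, hw0, hstep⟩ := selfNormalized_step (θstar := θstar) (X := X) (Y := Y)
      (t := t)
  rw [hstep, chordWeight, chordWeight, ← hw, ← hu]
  set p := X t ⬝ᵥ θstar
  set y := Y t
  have hw1 : 0 < 1 + w := by linarith
  have hΦ : 0 ≤ selfNormalized θstar X Y t / (1 + w) :=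
    div_nonneg (selfNormalized_pos _ _ _).le hw1.le
  have h1 : Real.exp ((2 * u * (y - p) + w * (y - p) ^ 2 - u ^ 2) / (1 + w)) ≤
      Real.exp ((1 - y) * ((2 * u * (0 - p) + w - u ^ 2) / (1 + w)) +
        y * ((2 * u * (1 - p) + w - u ^ 2) / (1 + w))) := by
    rw [Real.exp_le_exp, ← mul_div_assoc, ← mul_div_assoc, ← add_div]
    refine div_le_div_of_nonneg_right ?_ hw1.le
    have : (y - p) ^ 2 ≤ 1 := by
      rw [sq_le_one_iff_abs_le_one, abs_le]
      exact ⟨by linarith [hp.2, hY.1], by linarith [hp.1, hY.2]⟩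
    nlinarith
  have h2 := convexOn_exp.2 (Set.mem_univ ((2 * u * (0 - p) + w - u ^ 2) / (1 + w)))
    (Set.mem_univ ((2 * u * (1 - p) + w - u ^ 2) / (1 + w)))
    (sub_nonneg.2 hY.2) hY.1 (by ring)
  simp only [smul_eq_mul] at h2
  have h3 := mul_le_mul_of_nonneg_left (h1.trans h2) hΦ
  linarith

theorem chordWeight_mean_le {X : ℕ → Fin d → ℝ} {Y : ℕ → ℝ} {t : ℕ}
    (hp : X t ⬝ᵥ θstar ∈ Set.Icc (0 : ℝ) 1) :
    chordWeight θstar X Y t 0 * (1 - X t ⬝ᵥ θstar) + chordWeight θstar X Y t 1 * (X t ⬝ᵥ θstar) ≤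
      selfNormalized θstar X Y t := by
  have hw := posDef_quad_nonneg (design_posDef X t).inv (X t)
  unfold chordWeight
  set w := X t ⬝ᵥ ((design 1 X t)⁻¹ *ᵥ X t)
  set u := X t ⬝ᵥ ((design 1 X t)⁻¹ *ᵥ noiseSum θstar X Y t)
  set p := X t ⬝ᵥ θstar
  have hw1 : 0 < 1 + w := by linarith
  have hΦ := (selfNormalized_pos (θstar := θstar) X Y t).le
  have hsplit : ∀ y : ℝ, Real.exp ((2 * u * (y - p) + w - u ^ 2) / (1 + w)) =
      Real.exp (w / (1 + w)) * Real.exp (-(u ^ 2) / (1 + w)) *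
        Real.exp (2 * u / (1 + w) * (y - p)) := fun y => by
    rw [← Real.exp_add, ← Real.exp_add]
    congr 1
    ring
  rw [hsplit, hsplit]
  have h1 := bernoulli_mgf_le hp (2 * u / (1 + w))
  have h2 : Real.exp (w / (1 + w)) ≤ 1 + w := by
    rw [← Real.le_log_iff_exp_le hw1]
    refine le_trans (le_of_eq ?_) (Real.one_sub_inv_le_log_of_pos hw1)
    field_simp
    ring
  have h3 : Real.exp (-(u ^ 2) / (1 + w)) * Real.exp ((2 * u / (1 + w)) ^ 2 / 8) ≤ 1 := by
    rw [← Real.exp_add, Real.exp_le_one_iff]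
    have e : -u ^ 2 / (1 + w) + (2 * u / (1 + w)) ^ 2 / 8 =
        -(u ^ 2 * (1 + 2 * w)) / (2 * (1 + w) ^ 2) := by field_simp; ring
    rw [e]
    apply div_nonpos_of_nonpos_of_nonneg
    · have : 0 ≤ u ^ 2 * (1 + 2 * w) := by positivity
      linarith
    · positivity
  set Φ := selfNormalized θstar X Y t
  set a := Real.exp (w / (1 + w))
  set b := Real.exp (-(u ^ 2) / (1 + w))
  have ha : 0 ≤ a := (Real.exp_pos _).le
  have hb : 0 ≤ b := (Real.exp_pos _).le
  calc _ = Φ / (1 + w) * a * (b * ((1 - p) * Real.exp (2 * u / (1 + w) * (0 - p)) +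
            p * Real.exp (2 * u / (1 + w) * (1 - p)))) := by ring
    _ ≤ Φ / (1 + w) * a * 1 := by
        refine mul_le_mul_of_nonneg_left ?_ (by positivity)
        exact (mul_le_mul_of_nonneg_left h1 hb).trans h3
    _ ≤ Φ / (1 + w) * (1 + w) := by
        rw [mul_one]
        exact mul_le_mul_of_nonneg_left h2 (by positivity)
    _ = Φ := div_mul_cancel₀ _ hw1.ne'

section Probability

variable {Ω : Type w} {mΩ : MeasurableSpace Ω} {P : Measure Ω} {ℱ : Filtration ℕ mΩ}
  {D : Set (Fin d → ℝ)} {K : ℕ} {X : ℕ → Ω → Fin d → ℝ} {Y : ℕ → Ω → ℝ}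

theorem measurable_matrix_inv_apply (i j : Fin d) :
    Measurable fun A : Fin d → Fin d → ℝ => (Matrix.of A)⁻¹ i j := by
  have h1 : Continuous fun A : Fin d → Fin d → ℝ => (Matrix.of A).det :=
    Continuous.matrix_det continuous_id
  have h2 : Continuous fun A : Fin d → Fin d → ℝ => (Matrix.of A).adjugate i j :=
    (Continuous.matrix_adjugate continuous_id).matrix_elem i j
  simp only [Matrix.inv_def, Ring.inverse_eq_inv', Matrix.smul_apply, smul_eq_mul]
  exact h1.measurable.inv.mul h2.measurable

theorem measurable_inv_quad {m : MeasurableSpace Ω} {V : Ω → Matrix (Fin d) (Fin d) ℝ}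
    {x y : Ω → Fin d → ℝ} (hV : ∀ i j, Measurable[m] fun ω => V ω i j)
    (hx : Measurable[m] x) (hy : Measurable[m] y) :
    Measurable[m] fun ω => x ω ⬝ᵥ ((V ω)⁻¹ *ᵥ y ω) := by
  have hV' : Measurable[m] fun ω => (fun i j => V ω i j : Fin d → Fin d → ℝ) :=
    measurable_pi_lambda _ fun i => measurable_pi_lambda _ fun j => hV i j
  simp only [dotProduct, mulVec]
  refine Finset.measurable_sum _ fun i _ => Measurable.mul ((measurable_pi_apply i).comp hx)
    (Finset.measurable_sum _ fun j _ => Measurable.mul ?_ ((measurable_pi_apply j).comp hy))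
  exact (measurable_matrix_inv_apply i j).comp hV'

theorem measurable_matrix_det {m : MeasurableSpace Ω} {V : Ω → Matrix (Fin d) (Fin d) ℝ}
    (hV : ∀ i j, Measurable[m] fun ω => V ω i j) : Measurable[m] fun ω => (V ω).det := by
  have hV' : Measurable[m] fun ω => (fun i j => V ω i j : Fin d → Fin d → ℝ) :=
    measurable_pi_lambda _ fun i => measurable_pi_lambda _ fun j => hV i j
  have h1 : Continuous fun A : Fin d → Fin d → ℝ => (Matrix.of A).det :=
    Continuous.matrix_det continuous_id
  exact h1.measurable.comp hV'

theorem IsInteraction.measurable_X (h : IsInteraction P ℱ D θstar K X Y) {t τ : ℕ} (hτ : τ ≤ t)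
    (hK : τ < K) :
    Measurable[ℱ t] (X τ) := (h.predictable τ hK).mono (ℱ.mono hτ) le_rfl

theorem IsInteraction.measurable_Y (h : IsInteraction P ℱ D θstar K X Y) {t τ : ℕ} (hτ : τ < t)
    (hK : τ < K) :
    Measurable[ℱ t] (Y τ) := (h.reward_measurable τ hK).mono (ℱ.mono hτ) le_rfl

theorem IsInteraction.measurable_design (h : IsInteraction P ℱ D θstar K X Y)
    {t : ℕ} (ht : t ≤ K) (i j : Fin d) :
    Measurable[ℱ t] fun ω => design 1 (fun τ => X τ ω) t i j := by
  simp only [design, Matrix.add_apply, Matrix.sum_apply, vecMulVec_apply]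
  refine Measurable.add measurable_const (Finset.measurable_sum _ fun τ hτ => ?_)
  have := h.measurable_X (Finset.mem_range.1 hτ).le ((Finset.mem_range.1 hτ).trans_le ht)
  exact ((measurable_pi_apply i).comp this).mul ((measurable_pi_apply j).comp this)

theorem IsInteraction.measurable_mean (h : IsInteraction P ℱ D θstar K X Y) {t τ : ℕ} (hτ : τ ≤ t)
    (hK : τ < K) :
    Measurable[ℱ t] fun ω => X τ ω ⬝ᵥ θstar :=
  (Continuous.dotProduct continuous_id continuous_const).measurable.comp (h.measurable_X hτ hK)

theorem IsInteraction.measurable_noiseSum (h : IsInteraction P ℱ D θstar K X Y)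
    {t : ℕ} (ht : t ≤ K) :
    Measurable[ℱ t] fun ω => noiseSum θstar (fun τ => X τ ω) (fun τ => Y τ ω) t := by
  simp only [noiseSum]
  refine Finset.measurable_sum _ fun τ hτ => ?_
  have hτ := Finset.mem_range.1 hτ
  have h1 := h.measurable_X hτ.le (hτ.trans_le ht)
  have h2 := h.measurable_Y hτ (hτ.trans_le ht)
  have h3 := h.measurable_mean hτ.le (hτ.trans_le ht)
  exact (h2.sub h3).smul h1

theorem IsInteraction.measurable_selfNormalized (h : IsInteraction P ℱ D θstar K X Y)
    {t : ℕ} (ht : t ≤ K) :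
    Measurable[ℱ t] fun ω => selfNormalized θstar (fun τ => X τ ω) (fun τ => Y τ ω) t := by
  unfold selfNormalized
  have hS := h.measurable_noiseSum ht
  refine Measurable.div (Real.measurable_exp.comp
    (measurable_inv_quad (h.measurable_design ht) hS hS)) ?_
  exact measurable_matrix_det (h.measurable_design ht)

theorem IsInteraction.measurable_chordWeight (h : IsInteraction P ℱ D θstar K X Y)
    {t : ℕ} (ht : t < K) (y : ℝ) :
    Measurable[ℱ t] fun ω => chordWeight θstar (fun τ => X τ ω) (fun τ => Y τ ω) t y := by
  unfold chordWeight
  have h0 := h.measurable_selfNormalized ht.le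
  have hS := h.measurable_noiseSum ht.le
  have hX := h.measurable_X le_rfl ht
  have hp := h.measurable_mean le_rfl ht
  have h1 := measurable_inv_quad (h.measurable_design ht.le) hX hX
  have h2 := measurable_inv_quad (h.measurable_design ht.le) hX hS
  exact (h0.div (measurable_const.add h1)).mul (Real.measurable_exp.comp
    (((((h2.const_mul 2).mul (measurable_const.sub hp)).add h1).sub (h2.pow_const 2)).div
      (measurable_const.add h1)))

theorem IsInteraction.lintegral_selfNormalized_le [IsProbabilityMeasure P]
    (h : IsInteraction P ℱ D θstar K X Y)
    (hD : ∀ x ∈ D, x ⬝ᵥ θstar ∈ Set.Icc (0 : ℝ) 1) {t : ℕ} (ht : t ≤ K) :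
    ∫⁻ ω, ENNReal.ofReal (selfNormalized θstar (fun τ => X τ ω) (fun τ => Y τ ω) t) ∂P ≤ 1 := by
  induction t with
  | zero => simp [selfNormalized, noiseSum, design_zero]
  | succ t ih =>
    refine le_trans ?_ (ih (by omega))
    have ht' : t < K := ht
    have hYm : Measurable (Y t) := (h.reward_measurable t ht').mono (ℱ.le _) le_rfl
    have hpm := (h.measurable_mean le_rfl ht').mono (ℱ.le t) le_rfl
    have hYi : Integrable (Y t) P := Integrable.of_mem_Icc 0 1 hYm.aemeasurable (h.reward_mem t ht')
    have hW := fun y => (h.measurable_chordWeight ht' y).ennreal_ofReal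
    have hW' := fun y => (hW y).mono (ℱ.le t) le_rfl
    have e1 := lintegral_mul_ofReal_of_condExp_eq (ℱ.le t) hYi hYm hpm
      ((h.reward_mem t ht').mono fun ω hω => hω.1) (h.mean t ht') (hW 1)
    have hc : P[fun ω => 1 - Y t ω | ℱ t] =ᵐ[P] fun ω => 1 - X t ω ⬝ᵥ θstar := by
      have h1 := condExp_sub (m := ℱ t) (integrable_const (1 : ℝ)) hYi
      have h2 : P[fun _ : Ω => (1 : ℝ) | ℱ t] = fun _ => 1 := condExp_const (ℱ.le t) 1
      rw [h2] at h1
      refine h1.trans ((h.mean t ht').mono fun ω hω => ?_)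
      simp [hω]
    have e2 := lintegral_mul_ofReal_of_condExp_eq (ℱ.le t) ((integrable_const 1).sub hYi)
      (measurable_const.sub hYm) (measurable_const.sub hpm)
      ((h.reward_mem t ht').mono fun ω hω => sub_nonneg.2 hω.2) hc (hW 0)
    calc _ ≤ ∫⁻ ω, (ENNReal.ofReal (chordWeight θstar (fun τ => X τ ω) (fun τ => Y τ ω) t 0) *
            ENNReal.ofReal (1 - Y t ω) +
          ENNReal.ofReal (chordWeight θstar (fun τ => X τ ω) (fun τ => Y τ ω) t 1) *
            ENNReal.ofReal (Y t ω)) ∂P := by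
          refine lintegral_mono_ae ((h.reward_mem t ht').mono fun ω hω => ?_)
          rw [← ENNReal.ofReal_mul (chordWeight_nonneg _ _ _ _),
            ← ENNReal.ofReal_mul (chordWeight_nonneg _ _ _ _), ← ENNReal.ofReal_add
            (mul_nonneg (chordWeight_nonneg _ _ _ _) (sub_nonneg.2 hω.2))
            (mul_nonneg (chordWeight_nonneg _ _ _ _) hω.1)]
          exact ENNReal.ofReal_le_ofReal
            (selfNormalized_succ_le (hD _ (h.mem t ht' ω)) hω)
      _ = ∫⁻ ω, (ENNReal.ofReal (chordWeight θstar (fun τ => X τ ω) (fun τ => Y τ ω) t 0) *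
            ENNReal.ofReal (1 - X t ω ⬝ᵥ θstar) +
          ENNReal.ofReal (chordWeight θstar (fun τ => X τ ω) (fun τ => Y τ ω) t 1) *
            ENNReal.ofReal (X t ω ⬝ᵥ θstar)) ∂P := by
          rw [lintegral_add_left, lintegral_add_left, e1]
          · congr 1
          · exact (hW' 0).mul (measurable_const.sub hpm).ennreal_ofReal
          · exact (hW' 0).mul (measurable_const.sub hYm).ennreal_ofReal
      _ ≤ _ := by
          refine lintegral_mono fun ω => ?_
          have hp := hD _ (h.mem t ht' ω)
          rw [← ENNReal.ofReal_mul (chordWeight_nonneg _ _ _ _),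
            ← ENNReal.ofReal_mul (chordWeight_nonneg _ _ _ _), ← ENNReal.ofReal_add
            (mul_nonneg (chordWeight_nonneg _ _ _ _) (sub_nonneg.2 hp.2))
            (mul_nonneg (chordWeight_nonneg _ _ _ _) hp.1)]
          exact ENNReal.ofReal_le_ofReal (chordWeight_mean_le hp)

/-- The self-normalized tail bound, uniformly over the rounds. -/
theorem IsInteraction.measure_exists_le_selfNormalized [IsProbabilityMeasure P]
    (h : IsInteraction P ℱ D θstar K X Y)
    (hD : ∀ x ∈ D, x ⬝ᵥ θstar ∈ Set.Icc (0 : ℝ) 1) {δ : ℝ} (hδ : 0 < δ) (hK : 1 ≤ K) :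
    P {ω | ∃ t < K, K / δ ≤ selfNormalized θstar (fun τ => X τ ω) (fun τ => Y τ ω) t} ≤
      ENNReal.ofReal δ := by
  have hK' : (0 : ℝ) < K := by exact_mod_cast hK
  have hone : ∀ t ∈ Finset.range K,
      P {ω | K / δ ≤ selfNormalized θstar (fun τ => X τ ω) (fun τ => Y τ ω) t} ≤
        ENNReal.ofReal (δ / K) := by
    intro t ht
    have htK := (Finset.mem_range.1 ht).le
    have hm := ((h.measurable_selfNormalized htK).mono (ℱ.le t) le_rfl).ennreal_ofReal
    have h1 := mul_meas_ge_le_lintegral hm (ENNReal.ofReal (K / δ)) (μ := P)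
    have h2 := h1.trans (h.lintegral_selfNormalized_le hD htK)
    have hpos : (0 : ℝ) < K / δ := by positivity
    have h3 : P {ω | ENNReal.ofReal (K / δ) ≤ ENNReal.ofReal
        (selfNormalized θstar (fun τ => X τ ω) (fun τ => Y τ ω) t)} ≤
            (ENNReal.ofReal (K / δ))⁻¹ := by
      rw [ENNReal.le_inv_iff_mul_le, mul_comm]
      exact h2
    rw [← ENNReal.ofReal_inv_of_pos hpos, inv_div] at h3
    refine (measure_mono fun ω hω => ?_).trans h3
    exact ENNReal.ofReal_le_ofReal hω
  calc _ ≤ P (⋃ t ∈ Finset.range K,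
        {ω | K / δ ≤ selfNormalized θstar (fun τ => X τ ω) (fun τ => Y τ ω) t}) := by
        refine measure_mono fun ω hω => ?_
        obtain ⟨t, ht, hle⟩ := hω
        exact Set.mem_biUnion (Finset.mem_coe.2 (Finset.mem_range.2 ht)) hle
    _ ≤ ∑ t ∈ Finset.range K, ENNReal.ofReal (δ / K) :=
        (measure_biUnion_finset_le _ _).trans (Finset.sum_le_sum hone)
    _ = ENNReal.ofReal δ := by
        rw [Finset.sum_const, Finset.card_range, nsmul_eq_mul, ← ENNReal.ofReal_natCast,
          ← ENNReal.ofReal_mul (Nat.cast_nonneg K), mul_div_cancel₀ _ hK'.ne']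

end Probability

end LinearBandit

namespace LinearBandit

variable {d : ℕ}

theorem inv_quad_design_le (X : ℕ → Fin d → ℝ) (t : ℕ) (x : Fin d → ℝ) :
    x ⬝ᵥ ((design 1 X t)⁻¹ *ᵥ x) ≤ x ⬝ᵥ x := by
  set y := (design 1 X t)⁻¹ *ᵥ x with hy
  have hVy : design 1 X t *ᵥ y = x := by
    rw [hy, mulVec_mulVec, mul_nonsing_inv _ (posDef_isUnit_det (design_posDef X t)), one_mulVec]
  have h1 : y ⬝ᵥ y ≤ x ⬝ᵥ y := by
    have := design_quad X t y
    rw [hVy, dotProduct_comm] at this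
    rw [this]
    exact le_add_of_nonneg_right (Finset.sum_nonneg fun _ _ => sq_nonneg _)
  have h2 : (x ⬝ᵥ y) ^ 2 ≤ (x ⬝ᵥ x) * (y ⬝ᵥ y) := by
    simpa using dotProduct_sq_le_inv_mul (PosDef.one (R := ℝ) (n := Fin d)) x y
  have hxx : 0 ≤ x ⬝ᵥ x := by simpa using posDef_quad_nonneg (PosDef.one (R := ℝ) (n := Fin d)) x
  have hxy : 0 ≤ x ⬝ᵥ y := posDef_quad_nonneg (design_posDef X t).inv x
  rcases hxy.eq_or_lt with h0 | h0
  · rw [← h0]; exact hxx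
  · have : (x ⬝ᵥ y) * (x ⬝ᵥ y) ≤ (x ⬝ᵥ x) * (x ⬝ᵥ y) := by nlinarith
    exact le_of_mul_le_mul_right this h0

theorem sub_ridge_eq (θstar : Fin d → ℝ) (X : ℕ → Fin d → ℝ) (Y : ℕ → ℝ) (t : ℕ) :
    θstar - ridge 1 X Y t = (design 1 X t)⁻¹ *ᵥ (θstar - noiseSum θstar X Y t) := by
  have hU := posDef_isUnit_det (design_posDef X t)
  have h1 : ∑ τ ∈ Finset.range t, Y τ • X τ =
      design 1 X t *ᵥ θstar - (θstar - noiseSum θstar X Y t) := by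
    rw [design_mulVec, noiseSum]
    have : ∑ τ ∈ Finset.range t, (Y τ - X τ ⬝ᵥ θstar) • X τ = ∑ τ ∈ Finset.range t, Y τ • X τ -
        ∑ τ ∈ Finset.range t, (X τ ⬝ᵥ θstar) • X τ := by
      rw [← Finset.sum_sub_distrib]
      exact Finset.sum_congr rfl fun τ _ => sub_smul _ _ _
    rw [this]
    abel
  rw [ridge, h1, mulVec_sub, mulVec_mulVec, nonsing_inv_mul _ hU, one_mulVec, sub_sub_cancel]

/-- The unknown parameter lies in the confidence set as long as the noise is under control. -/
theorem mem_confSet_of_selfNormalized_lt {Θ : Set (Fin d → ℝ)} {θstar : Fin d → ℝ}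
    (hΘ : θstar ∈ Θ) (hn : θstar ⬝ᵥ θstar ≤ d) {X : ℕ → Fin d → ℝ} {Y : ℕ → ℝ} {K : ℕ} {δ : ℝ}
    (hK : 1 ≤ K) (hδ : 0 < δ) {t : ℕ} (hX : ∀ τ < t, X τ ⬝ᵥ X τ ≤ 1)
    (h : selfNormalized θstar X Y t < K / δ) :
    θstar ∈ confSet 1 Θ (confRadius d K δ) X Y t := by
  refine ⟨hΘ, ?_⟩
  have hV := design_posDef X t
  have hU := posDef_isUnit_det hV
  have hK' : (0 : ℝ) < K := by exact_mod_cast hK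
  set S := noiseSum θstar X Y t with hS
  set V := design 1 X t with hVd
  have hSS := posDef_quad_nonneg hV.inv S
  have hθθ := posDef_quad_nonneg hV.inv θstar
  have hlog : S ⬝ᵥ (V⁻¹ *ᵥ S) ≤ d * Real.log (1 + (t + 1) / d) + Real.log (2 * K / δ) := by
    have hdet := design_det_pos X t
    rw [selfNormalized, div_lt_iff₀ hdet] at h
    have h1 := Real.log_lt_log (Real.exp_pos _) h
    rw [Real.log_exp, Real.log_mul (by positivity) hdet.ne'] at h1
    have h2 := log_design_det_le X hX
    have h3 : Real.log (K / δ) ≤ Real.log (2 * K / δ) := by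
      refine Real.log_le_log (by positivity) ?_
      rw [mul_div_assoc]
      have : 0 < K / δ := by positivity
      linarith
    have h4 : (d : ℝ) * Real.log (1 + t / d) ≤ d * Real.log (1 + (t + 1) / d) := by
      refine mul_le_mul_of_nonneg_left (Real.log_le_log (by positivity) ?_) (Nat.cast_nonneg d)
      gcongr
      linarith
    linarith
  have hθd : θstar ⬝ᵥ (V⁻¹ *ᵥ θstar) ≤ d := (inv_quad_design_le X t θstar).trans hn
  rw [sub_ridge_eq]
  unfold weightedNorm
  rw [mulVec_mulVec, mul_nonsing_inv V hU, one_mulVec, dotProduct_comm]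
  have hcs : (θstar ⬝ᵥ (V⁻¹ *ᵥ S)) ^ 2 ≤ (θstar ⬝ᵥ (V⁻¹ *ᵥ θstar)) * (S ⬝ᵥ (V⁻¹ *ᵥ S)) := by
    have := dotProduct_sq_le_inv_mul hV θstar (V⁻¹ *ᵥ S)
    rwa [mulVec_mulVec, mul_nonsing_inv V hU, one_mulVec, dotProduct_comm (V⁻¹ *ᵥ S) S] at this
  have habs : |θstar ⬝ᵥ (V⁻¹ *ᵥ S)| ≤
      Real.sqrt (θstar ⬝ᵥ (V⁻¹ *ᵥ θstar)) * Real.sqrt (S ⬝ᵥ (V⁻¹ *ᵥ S)) := by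
    rw [← Real.sqrt_mul hθθ]
    exact Real.abs_le_sqrt hcs
  have htri : Real.sqrt ((θstar - S) ⬝ᵥ (V⁻¹ *ᵥ (θstar - S))) ≤
      Real.sqrt (θstar ⬝ᵥ (V⁻¹ *ᵥ θstar)) + Real.sqrt (S ⬝ᵥ (V⁻¹ *ᵥ S)) := by
    rw [Real.sqrt_le_left (by positivity), add_sq, Real.sq_sqrt hθθ, Real.sq_sqrt hSS]
    simp only [mulVec_sub, dotProduct_sub, sub_dotProduct]
    rw [Matrix.PosDef.mulVec_dotProduct_comm hV.inv.isHermitian S θstar]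
    have := neg_abs_le (θstar ⬝ᵥ (V⁻¹ *ᵥ S))
    linarith
  have h1 := Real.sqrt_le_sqrt hlog
  have h2 := Real.sqrt_le_sqrt hθd
  unfold confRadius
  linarith

/-- Within an epoch, in which the same vector is played over and over, its squared dual norm times
the determinant of the design matrix does not change. -/
theorem inv_quad_mul_det_of_eq {X : ℕ → Fin d → ℝ} {τ : ℕ} {x : Fin d → ℝ} (n : ℕ)
    (h : ∀ s, τ ≤ s → s < τ + n → X s = x) :
    (x ⬝ᵥ ((design 1 X (τ + n))⁻¹ *ᵥ x)) * (design 1 X (τ + n)).det =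
      (x ⬝ᵥ ((design 1 X τ)⁻¹ *ᵥ x)) * (design 1 X τ).det := by
  induction n with
  | zero => rfl
  | succ n ih =>
    rw [← ih fun s h1 h2 => h s h1 (by omega), ← add_assoc, design_det_succ, design_succ,
      h (τ + n) (by omega) (by omega)]
    have hV := design_posDef X (τ + n)
    have hw := posDef_quad_nonneg hV.inv x
    have h1 := inv_quad_rank_one_update hV 0 x 1
    simp only [zero_add, one_smul, mulVec_zero, dotProduct_zero, mul_zero, one_pow,
      mul_one] at h1
    rw [h1]
    field_simp
    ring

/-- The structure of the epochs of the algorithm. -/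
theorem IsRarelySwitchingOFUL.epoch {D : Set (Fin d → ℝ)} {Θ : Set (Fin d → ℝ)} {ρ : ℕ → ℝ}
    {K : ℕ} {X : ℕ → Fin d → ℝ} {Y : ℕ → ℝ} (H : IsRarelySwitchingOFUL D 1 1 Θ ρ K X Y) {t : ℕ}
    (ht : t < K) : ∃ τ ≤ t, τ = lastChange 1 1 X (t + 1) ∧
      (τ = 0 ∨ (1 + 1) * (design 1 X (lastChange 1 1 X τ)).det ≤ (design 1 X τ).det) ∧
      (∀ s, τ ≤ s → s ≤ t → X s = X τ) ∧ (design 1 X t).det ≤ 2 * (design 1 X τ).det := by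
  induction t with
  | zero =>
    refine ⟨0, le_rfl, ?_, Or.inl rfl, fun s _ hs => by rw [Nat.le_zero.1 hs], ?_⟩
    · have := lastChange_le 1 1 X 0
      unfold lastChange; split_ifs <;> omega
    · linarith [design_det_pos X 0]
  | succ t ih =>
    by_cases hc : (1 + 1) * (design 1 X (lastChange 1 1 X (t + 1))).det ≤ (design 1 X (t + 1)).det
    · refine ⟨t + 1, le_rfl, ?_, Or.inr hc, fun s h1 h2 => by rw [le_antisymm h2 h1], ?_⟩
      · conv_rhs => rw [lastChange, if_pos hc]
      · linarith [design_det_pos X (t + 1)]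
    · obtain ⟨τ, hτ, hlast, hup, hX, -⟩ := ih (by omega)
      refine ⟨τ, by omega, ?_, hup, fun s h1 h2 => ?_, ?_⟩
      · conv_rhs => rw [lastChange, if_neg hc]
        exact hlast
      · rcases Nat.lt_or_ge t s with h3 | h3
        · obtain rfl : s = t + 1 := by omega
          rw [H.keep (t + 1) ht (by simp [hc])]
          exact hX t hτ le_rfl
        · exact hX s h1 h3
      · rw [← hlast] at hc
        linarith

theorem dotProduct_le_of_weightedNorm_le {V : Matrix (Fin d) (Fin d) ℝ} (hV : V.PosDef)
    {x y : Fin d → ℝ} {r : ℝ} (h : weightedNorm V y ≤ r) :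
    |x ⬝ᵥ y| ≤ Real.sqrt (x ⬝ᵥ (V⁻¹ *ᵥ x)) * r := by
  refine (Real.abs_le_sqrt (dotProduct_sq_le_inv_mul hV x y)).trans ?_
  rw [Real.sqrt_mul (posDef_quad_nonneg hV.inv x)]
  exact mul_le_mul_of_nonneg_left h (Real.sqrt_nonneg _)

theorem confRadius_nonneg (d K : ℕ) (δ : ℝ) (t : ℕ) : 0 ≤ confRadius d K δ t := by
  unfold confRadius; positivity

/-- The regret of one round is controlled by the width of the confidence set. -/
theorem IsRarelySwitchingOFUL.round_regret_le {D : Set (Fin d → ℝ)} {Θ : Set (Fin d → ℝ)}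
    {ρ : ℕ → ℝ} {K : ℕ} {X : ℕ → Fin d → ℝ} {Y : ℕ → ℝ}
    (H : IsRarelySwitchingOFUL D 1 1 Θ ρ K X Y) {θstar : Fin d → ℝ}
    (hθ : ∀ t < K, θstar ∈ confSet 1 Θ ρ X Y t) {R : ℝ} (hρ : ∀ t < K, ρ t ≤ R) (hR : 0 ≤ R)
    {t : ℕ} (ht : t < K) :
    sSup ((fun x => x ⬝ᵥ θstar) '' D) - X t ⬝ᵥ θstar ≤
      2 * R * Real.sqrt (2 * (X t ⬝ᵥ ((design 1 X t)⁻¹ *ᵥ X t))) := by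
  obtain ⟨τ, hτ, -, hup, hX, hdet⟩ := H.epoch ht
  have hτK : τ < K := by omega
  obtain ⟨θ, hθc, hopt⟩ := H.update τ hτK hup ⟨_, hθ τ hτK⟩
  have h1 : sSup ((fun x => x ⬝ᵥ θstar) '' D) ≤ X τ ⬝ᵥ θ := by
    refine csSup_le (Set.Nonempty.image _ ⟨_, H.mem t ht⟩) ?_
    rintro _ ⟨x, hx, rfl⟩
    exact hopt x hx θstar (hθ τ hτK)
  rw [hX t hτ le_rfl]
  have hV := design_posDef X τ
  have h2 := dotProduct_le_of_weightedNorm_le hV (x := X τ) (hθc.2.trans (hρ τ hτK))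
  have h3 := dotProduct_le_of_weightedNorm_le hV (x := X τ) ((hθ τ hτK).2.trans (hρ τ hτK))
  rw [dotProduct_sub] at h2 h3
  have hw : X τ ⬝ᵥ ((design 1 X τ)⁻¹ *ᵥ X τ) ≤ 2 * (X τ ⬝ᵥ ((design 1 X t)⁻¹ *ᵥ X τ)) := by
    have he := inv_quad_mul_det_of_eq (X := X) (τ := τ) (x := X τ) (t - τ)
      fun s h1 h2 => hX s h1 (by omega)
    rw [Nat.add_sub_cancel' hτ] at he
    have hwt := posDef_quad_nonneg (design_posDef X t).inv (X τ)
    have hdp := design_det_pos X τ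
    refine le_of_mul_le_mul_right ?_ hdp
    rw [← he]
    nlinarith
  have h4 := mul_le_mul_of_nonneg_right (Real.sqrt_le_sqrt hw) hR
  have h5 := (abs_le.1 h2).2
  have h6 := (abs_le.1 h3).1
  linarith

/-- The elliptical potential lemma. -/
theorem sum_inv_quad_le (X : ℕ → Fin d → ℝ) (K : ℕ) (hX : ∀ t < K, X t ⬝ᵥ X t ≤ 1) :
    ∑ t ∈ Finset.range K, X t ⬝ᵥ ((design 1 X t)⁻¹ *ᵥ X t) ≤
      2 * Real.log (design 1 X K).det := by
  induction K with
  | zero => simp [design_zero]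
  | succ K ih =>
    rw [Finset.sum_range_succ, design_det_succ]
    have hw0 := posDef_quad_nonneg (design_posDef X K).inv (X K)
    have hw1 := (inv_quad_design_le X K (X K)).trans (hX K (by omega))
    set w := X K ⬝ᵥ ((design 1 X K)⁻¹ *ᵥ X K)
    rw [Real.log_mul (design_det_pos X K).ne' (by positivity)]
    have := ih fun t ht => hX t (by omega)
    have h1 := Real.one_sub_inv_le_log_of_pos (x := 1 + w) (by positivity)
    have h2 : w / 2 ≤ 1 - (1 + w)⁻¹ := by
      have e : 1 - (1 + w)⁻¹ = w / (1 + w) := by field_simp; ring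
      rw [e]
      exact div_le_div_of_nonneg_left hw0 (by positivity) (by linarith)
    linarith

/-- The regret bound on the event that all confidence sets contain the unknown parameter. -/
theorem IsRarelySwitchingOFUL.regret_le {D : Set (Fin d → ℝ)} {Θ : Set (Fin d → ℝ)} {K : ℕ}
    {δ : ℝ} {X : ℕ → Fin d → ℝ} {Y : ℕ → ℝ}
    (H : IsRarelySwitchingOFUL D 1 1 Θ (confRadius d K δ) K X Y) {θstar : Fin d → ℝ}
    (hθ : ∀ t < K, θstar ∈ confSet 1 Θ (confRadius d K δ) X Y t)
    (hX : ∀ t < K, X t ⬝ᵥ X t ≤ 1) (hK : 1 ≤ K) (hδ : 0 < δ) (hδ1 : δ < 1) :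
    regret D θstar K X ≤ 24 * (d * Real.sqrt K * Real.log (2 * K / δ)) := by
  have hK' : (1 : ℝ) ≤ K := by exact_mod_cast hK
  rcases Nat.eq_zero_or_pos d with rfl | hd
  · unfold regret
    simp only [dotProduct, Finset.univ_eq_empty, Finset.sum_empty, sub_zero, Finset.sum_const,
      Finset.card_range, nsmul_eq_mul, CharP.cast_eq_zero, zero_mul, mul_zero]
    rw [Set.Nonempty.image_const ⟨_, H.mem 0 hK⟩]
    simp
  have hd1 : (1 : ℝ) ≤ d := by exact_mod_cast hd
  set L := Real.log (2 * K / δ) with hL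
  have hL2 : 1 / 2 ≤ L := by
    have h1 : (2 : ℝ) ≤ 2 * K / δ := by rw [le_div_iff₀ hδ]; nlinarith
    have h2 := Real.log_le_log (by norm_num) h1
    linarith [Real.log_two_gt_d9]
  have hlog : Real.log (1 + K / d) ≤ L := by
    refine Real.log_le_log (by positivity) ?_
    rw [le_div_iff₀ hδ]
    have : (K : ℝ) / d ≤ K := div_le_self (by positivity) hd1
    nlinarith [div_nonneg (by positivity : (0 : ℝ) ≤ K) (by positivity : (0 : ℝ) ≤ d)]
  have hdL : (d : ℝ) ≤ 2 * d * L := by nlinarith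
  set R := 3 * Real.sqrt (2 * d * L) with hRd
  have hR : 0 ≤ R := by positivity
  have hρ : ∀ t < K, confRadius d K δ t ≤ R := by
    intro t ht
    have ht' : (t : ℝ) + 1 ≤ K := by exact_mod_cast ht
    have h1 : Real.log (1 + ((t : ℝ) + 1) / d) ≤ L := by
      refine (Real.log_le_log (by positivity) ?_).trans hlog
      gcongr
    have h2 : (d : ℝ) * Real.log (1 + ((t : ℝ) + 1) / d) + L ≤ 2 * d * L := by nlinarith
    have h3 := Real.sqrt_le_sqrt h2
    have h4 := Real.sqrt_le_sqrt hdL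
    have h5 : 1 ≤ Real.sqrt (2 * d * L) := Real.one_le_sqrt.2 (by linarith)
    unfold confRadius
    linarith
  have hlogdet : Real.log (design 1 X K).det ≤ d * L :=
    (log_design_det_le X hX).trans (by gcongr)
  have hsum := sum_inv_quad_le X K hX
  have hcs : ∑ t ∈ Finset.range K, Real.sqrt (2 * (X t ⬝ᵥ ((design 1 X t)⁻¹ *ᵥ X t))) ≤
      Real.sqrt (K * (4 * (d * L))) := by
    refine Real.le_sqrt_of_sq_le ?_
    refine (sq_sum_le_card_mul_sum_sq).trans ?_
    rw [Finset.card_range]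
    refine mul_le_mul_of_nonneg_left ?_ (by positivity)
    have : ∀ t ∈ Finset.range K, Real.sqrt (2 * (X t ⬝ᵥ ((design 1 X t)⁻¹ *ᵥ X t))) ^ 2 =
        2 * (X t ⬝ᵥ ((design 1 X t)⁻¹ *ᵥ X t)) := fun t _ =>
      Real.sq_sqrt (mul_nonneg zero_le_two (posDef_quad_nonneg (design_posDef X t).inv _))
    rw [Finset.sum_congr rfl this, ← Finset.mul_sum]
    linarith
  have e : 2 * R * Real.sqrt (K * (4 * (d * L))) ≤ 24 * (d * Real.sqrt K * L) := by
    have h1 : Real.sqrt (K * (4 * (d * L))) = Real.sqrt K * Real.sqrt (4 * (d * L)) :=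
      Real.sqrt_mul (by positivity) _
    have h2 : Real.sqrt (2 * d * L) * Real.sqrt (4 * (d * L)) ≤ 4 * (d * L) := by
      rw [← Real.sqrt_mul (by positivity)]
      refine Real.sqrt_le_iff.2 ⟨by positivity, ?_⟩
      nlinarith [sq_nonneg ((d : ℝ) * L)]
    rw [hRd, h1]
    calc 2 * (3 * Real.sqrt (2 * d * L)) * (Real.sqrt K * Real.sqrt (4 * (d * L)))
        = 6 * Real.sqrt K * (Real.sqrt (2 * d * L) * Real.sqrt (4 * (d * L))) := by ring
      _ ≤ 6 * Real.sqrt K * (4 * (d * L)) := mul_le_mul_of_nonneg_left h2 (by positivity)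
      _ = _ := by ring
  calc regret D θstar K X
      ≤ ∑ t ∈ Finset.range K, 2 * R * Real.sqrt (2 * (X t ⬝ᵥ ((design 1 X t)⁻¹ *ᵥ X t))) :=
        Finset.sum_le_sum fun t ht => H.round_regret_le hθ hρ hR (Finset.mem_range.1 ht)
    _ = 2 * R * ∑ t ∈ Finset.range K, Real.sqrt (2 * (X t ⬝ᵥ ((design 1 X t)⁻¹ *ᵥ X t))) :=
        (Finset.mul_sum _ _ _).symm
    _ ≤ 2 * R * Real.sqrt (K * (4 * (d * L))) :=
        mul_le_mul_of_nonneg_left hcs (by positivity)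
    _ ≤ _ := e

end LinearBandit

namespace FeatureMDP

open LinearBandit

variable {S : Type u} {A : Type v} [MeasurableSpace S] [MeasurableSpace A]
  {M : FeatureMDP S A 1} {θstar : Fin (M.d 0) → ℝ}

/-- The high-probability regret bound for ELEANOR-LowSwitching in one-step problems. -/
theorem regret_bound [Nonempty A] (hM : M.Standing) (hθ : θstar ∈ M.paramSet 0)
    (hr : ∀ s a, M.meanReward 0 s a = M.φ 0 s a ⬝ᵥ θstar)
    {Ω : Type w} {mΩ : MeasurableSpace Ω} {P : Measure Ω} [IsProbabilityMeasure P]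
    {ℱ : Filtration ℕ mΩ} {K : ℕ} {δ : ℝ} (hK : 1 ≤ K) (hδ : 0 < δ) (hδ1 : δ < 1)
    {ep : ℕ → Ω → Episode S A 1} {π : ℕ → Ω → Policy S A 1} (h : M.IsInteraction P ℱ K ep π)
    (hrun : ∀ ω, M.IsEleanorRun K δ 0 (fun k => ep k ω) (fun k => π k ω)) :
    ENNReal.ofReal (1 - δ) ≤ P {ω | M.regret K (fun k => π k ω) ≤
      24 * (M.d 0 * Real.sqrt K * Real.log (2 * K / δ))} := by
  have hb := h.linearBandit hM hr
  set X := fun k ω => M.visited (ep k ω) 0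
  set Y := fun k ω => (ep k ω).reward 0
  set bad := {ω | ∃ t < K, K / δ ≤ selfNormalized θstar (fun τ => X τ ω) (fun τ => Y τ ω) t}
  have hbad : P bad ≤ ENNReal.ofReal δ := by
    refine hb.measure_exists_le_selfNormalized ?_ hδ hK
    rintro _ ⟨a, rfl⟩
    exact feature_dotProduct_mem_Icc hM hr _ _
  have hsub : badᶜ ⊆ {ω | M.regret K (fun k => π k ω) ≤
      24 * (M.d 0 * Real.sqrt K * Real.log (2 * K / δ))} := by
    intro ω hω
    have hgood : ∀ t < K, selfNormalized θstar (fun τ => X τ ω) (fun τ => Y τ ω) t < K / δ :=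
      fun t ht => not_le.1 fun hle => hω ⟨t, ht, hle⟩
    have hX : ∀ t, X t ω ⬝ᵥ X t ω ≤ 1 := fun t => M.feature_dotProduct_self_le hM _ _
    rw [Set.mem_ofPred_eq, regret_eq hM hθ hr fun k hk => (hrun ω).deploy k hk]
    exact (hrun ω).isRarelySwitchingOFUL.regret_le (fun t ht => mem_confSet_of_selfNormalized_lt hθ
      (M.param_dotProduct_self_le hM hθ) hK hδ (fun τ _ => hX τ) (hgood t ht))
      (fun t _ => hX t) hK hδ hδ1
  have h1 : 1 ≤ P bad + P badᶜ := by
    rw [← measure_univ (μ := P), ← Set.union_compl_self bad]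
    exact measure_union_le _ _
  refine le_trans ?_ (measure_mono hsub)
  rw [ENNReal.ofReal_sub _ hδ.le, ENNReal.ofReal_one, tsub_le_iff_left]
  exact h1.trans (add_le_add_left hbad _)

end FeatureMDP

namespace RealProgram

/-- The memory after `n` passes through the body `p` of a loop with loop variable `i`. -/
noncomputable def loopMemory (p : Prog) (i : ℕ) (m : Memory) : ℕ → Memory
  | 0 => m
  | n + 1 => (p.run ((loopMemory p i m n).setNat i n)).1

theorem run_loop_fst (i : ℕ) (e : NExp) (p : Prog) (m : Memory) :
    ((Prog.loop i e p).run m).1 = loopMemory p i m (e.eval m) := by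
  rw [Prog.run]
  generalize e.eval m = n
  induction n with
  | zero => rfl
  | succ n ih => simp only [loopMemory]; rw [← ih]

theorem run_loop_snd (i : ℕ) (e : NExp) (p : Prog) (m : Memory) :
    ((Prog.loop i e p).run m).2 = e.cost + 1 +
      ∑ n ∈ Finset.range (e.eval m), (1 + (p.run ((loopMemory p i m n).setNat i n)).2) := by
  have h : ∀ n, (Nat.rec (m, e.cost + 1) (fun n acc => ((p.run (acc.1.setNat i n)).1,
      acc.2 + 1 + (p.run (acc.1.setNat i n)).2)) n : Memory × ℕ).1 = loopMemory p i m n := by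
    intro n
    induction n with
    | zero => rfl
    | succ n ih => simp only [loopMemory]; rw [← ih]
  rw [Prog.run]
  generalize e.eval m = n
  induction n with
  | zero => rfl
  | succ n ih =>
    rw [Finset.sum_range_succ, ← add_assoc, ← ih, ← h n]
    simp only [add_assoc]

theorem run_seq_fst (p q : Prog) (m : Memory) :
    ((Prog.seq p q).run m).1 = (q.run (p.run m).1).1 := rfl

theorem run_setReal_fst (a : ℕ) (i j : NExp) (e : RExp) (m : Memory) :
    ((Prog.setReal a i j e).run m).1 = m.setReal a (i.eval m) (j.eval m) (e.eval m) := rfl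

@[simp] theorem setNat_nat_self (m : Memory) (i n : ℕ) : (m.setNat i n).nat i = n := by
  simp [Memory.setNat]

theorem setNat_nat_of_ne (m : Memory) {i r : ℕ} (n : ℕ) (h : r ≠ i) :
    (m.setNat i n).nat r = m.nat r := by
  simp [Memory.setNat, h]

@[simp] theorem setNat_real (m : Memory) (i n : ℕ) : (m.setNat i n).real = m.real := rfl

@[simp] theorem setReal_nat (m : Memory) (a i j : ℕ) (x : ℝ) :
    (m.setReal a i j x).nat = m.nat := rfl

theorem setReal_real_of_ne (m : Memory) {a b : ℕ} (i j : ℕ) (x : ℝ) (h : b ≠ a) :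
    (m.setReal a i j x).real b = m.real b := by
  funext r s
  simp [Memory.setReal, h]

theorem setReal_real_self (m : Memory) (a i j : ℕ) (x : ℝ) (r s : ℕ) :
    (m.setReal a i j x).real a r s = if r = i ∧ s = j then x else m.real a r s := by
  simp [Memory.setReal]

/-! ### Running times -/

/-- All registers read by the expression are below `B`. -/
def NExp.ReadsBelow (B : ℕ) : NExp → Prop
  | .lit _ => True
  | .reg i => i < B
  | .add a b => a.ReadsBelow B ∧ b.ReadsBelow B
  | .mul a b => a.ReadsBelow B ∧ b.ReadsBelow B

theorem NExp.ReadsBelow.mono {B B' : ℕ} (h : B ≤ B') {e : NExp} (he : e.ReadsBelow B) :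
    e.ReadsBelow B' := by
  induction e with
  | lit => trivial
  | reg i => exact lt_of_lt_of_le he h
  | add a b iha ihb => exact ⟨iha he.1, ihb he.2⟩
  | mul a b iha ihb => exact ⟨iha he.1, ihb he.2⟩

theorem NExp.eval_congr {B : ℕ} {e : NExp} (he : e.ReadsBelow B) {m m' : Memory}
    (h : ∀ r < B, m.nat r = m'.nat r) : e.eval m = e.eval m' := by
  induction e with
  | lit => rfl
  | reg i => exact h i he
  | add a b iha ihb => simp only [NExp.eval, iha he.1, ihb he.2]
  | mul a b iha ihb => simp only [NExp.eval, iha he.1, ihb he.2]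

/-- The first seven registers, which hold the input sizes, are never overwritten, and the bounds of
all loops depend on them only. -/
def Prog.Guarded : Prog → Prop
  | .skip => True
  | .setNat i _ => 7 ≤ i
  | .setReal _ _ _ _ => True
  | .seq p q => p.Guarded ∧ q.Guarded
  | .ifLe _ _ p q => p.Guarded ∧ q.Guarded
  | .loop i e p => 7 ≤ i ∧ e.ReadsBelow 7 ∧ p.Guarded

theorem Prog.Guarded.run_nat {p : Prog} (hp : p.Guarded) (m : Memory) {r : ℕ} (hr : r < 7) :
    (p.run m).1.nat r = m.nat r := by
  induction p generalizing m with
  | skip => rfl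
  | setNat i e =>
    have : 7 ≤ i := hp
    exact setNat_nat_of_ne _ _ (by omega)
  | setReal => rfl
  | seq p q ihp ihq => rw [run_seq_fst, ihq hp.2, ihp hp.1]
  | ifLe x y p q ihp ihq =>
    rw [Prog.run]
    split_ifs
    · exact ihp hp.1 m
    · exact ihq hp.2 m
  | loop i e p ih =>
    rw [run_loop_fst]
    generalize e.eval m = n
    have : 7 ≤ i := hp.1
    induction n with
    | zero => rfl
    | succ n ihn => rw [loopMemory, ih hp.2.2, setNat_nat_of_ne _ _ (by omega), ihn]

theorem Prog.Guarded.loopMemory_nat {p : Prog} (hp : p.Guarded) {i : ℕ} (hi : 7 ≤ i) (m : Memory)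
    (n : ℕ) {r : ℕ} (hr : r < 7) : ((loopMemory p i m n).setNat i n).nat r = m.nat r := by
  rw [setNat_nat_of_ne _ _ (by omega)]
  induction n with
  | zero => rfl
  | succ n ihn => rw [loopMemory, hp.run_nat _ hr, setNat_nat_of_ne _ _ (by omega), ihn]

theorem NExp.exists_eval_le {e : NExp} (he : e.ReadsBelow 7) :
    ∃ c : ℕ, ∀ (m : Memory) (B : ℕ), (∀ r < 7, m.nat r ≤ B) → 1 ≤ B → e.eval m ≤ c * B ^ c := by
  induction e with
  | lit n => exact ⟨n, fun m B _ hB => Nat.le_mul_of_pos_right _ (Nat.pow_pos hB)⟩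
  | reg i => exact ⟨1, fun m B h _ => by simpa [NExp.eval] using h i he⟩
  | add a b iha ihb =>
    obtain ⟨c, hc⟩ := iha he.1
    obtain ⟨c', hc'⟩ := ihb he.2
    refine ⟨c + c', fun m B h hB => ?_⟩
    have h1 := (hc m B h hB).trans (Nat.mul_le_mul_left c
        (Nat.pow_le_pow_right hB (Nat.le_add_right c c')))
    have h2 := (hc' m B h hB).trans (Nat.mul_le_mul_left c'
        (Nat.pow_le_pow_right hB (Nat.le_add_left c' c)))
    simp only [NExp.eval, add_mul]
    omega
  | mul a b iha ihb =>
    obtain ⟨c, hc⟩ := iha he.1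
    obtain ⟨c', hc'⟩ := ihb he.2
    refine ⟨c * c' + c + c', fun m B h hB => ?_⟩
    calc a.eval m * b.eval m ≤ (c * B ^ c) * (c' * B ^ c') :=
          Nat.mul_le_mul (hc m B h hB) (hc' m B h hB)
      _ = (c * c') * B ^ (c + c') := by rw [pow_add]; ring
      _ ≤ _ := Nat.mul_le_mul (by omega) (Nat.pow_le_pow_right hB (by omega))

/-- Guarded programs run in polynomial time. -/
theorem Prog.Guarded.exists_cost_le {p : Prog} (hp : p.Guarded) :
    ∃ c : ℕ, ∀ (m : Memory) (B : ℕ), (∀ r < 7, m.nat r ≤ B) → 1 ≤ B →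
      (p.run m).2 ≤ c * B ^ c := by
  have hconst : ∀ n c B : ℕ, n ≤ c → 1 ≤ B → n ≤ c * B ^ c := fun n c B h hB =>
    h.trans (Nat.le_mul_of_pos_right _ (Nat.pow_pos hB))
  induction p with
  | skip => exact ⟨1, fun m B _ hB => hconst _ _ _ le_rfl hB⟩
  | setNat i e => exact ⟨e.cost + 1, fun m B _ hB => hconst _ _ _ le_rfl hB⟩
  | setReal a i j e =>
    exact ⟨i.cost + j.cost + e.cost + 1, fun m B _ hB => hconst _ _ _ le_rfl hB⟩
  | seq p q ihp ihq =>
    obtain ⟨c, hc⟩ := ihp hp.1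
    obtain ⟨c', hc'⟩ := ihq hp.2
    refine ⟨c + c', fun m B h hB => ?_⟩
    have h1 := (hc m B h hB).trans (Nat.mul_le_mul_left c
        (Nat.pow_le_pow_right hB (Nat.le_add_right c c')))
    have h2 := (hc' (p.run m).1 B (fun r hr => by rw [hp.1.run_nat m hr]; exact h r hr) hB).trans
      (Nat.mul_le_mul_left c' (Nat.pow_le_pow_right hB (Nat.le_add_left c' c)))
    simp only [Prog.run, add_mul]
    omega
  | ifLe x y p q ihp ihq =>
    obtain ⟨c, hc⟩ := ihp hp.1
    obtain ⟨c', hc'⟩ := ihq hp.2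
    refine ⟨x.cost + y.cost + 1 + c + c', fun m B h hB => ?_⟩
    set C := x.cost + y.cost + 1 + c + c' with hC
    have h0 : x.cost + y.cost + 1 ≤ (x.cost + y.cost + 1) * B ^ C :=
      Nat.le_mul_of_pos_right _ (Nat.pow_pos hB)
    have h1 := (hc m B h hB).trans
      (Nat.mul_le_mul_left c (Nat.pow_le_pow_right hB (show c ≤ C by omega)))
    have h2 := (hc' m B h hB).trans
      (Nat.mul_le_mul_left c' (Nat.pow_le_pow_right hB (show c' ≤ C by omega)))
    have h3 : C * B ^ C = (x.cost + y.cost + 1) * B ^ C + c * B ^ C + c' * B ^ C := by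
      rw [hC]; ring
    rw [Prog.run, h3]
    split_ifs <;> simp only <;> omega
  | loop i e p ih =>
    obtain ⟨c, hc⟩ := ih hp.2.2
    obtain ⟨c', hc'⟩ := e.exists_eval_le hp.2.1
    refine ⟨e.cost + 1 + (c + 1) * c' + c + c', fun m B h hB => ?_⟩
    set C := e.cost + 1 + (c + 1) * c' + c + c' with hC
    have hpos : 1 ≤ B ^ c := Nat.pow_pos hB
    have h1 : ∀ n ∈ Finset.range (e.eval m),
        1 + (p.run ((loopMemory p i m n).setNat i n)).2 ≤ (c + 1) * B ^ c := by
      intro n _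
      have := hc ((loopMemory p i m n).setNat i n) B
        (fun r hr => by rw [hp.2.2.loopMemory_nat hp.1 m n hr]; exact h r hr) hB
      rw [add_mul]
      omega
    have h2 := Finset.sum_le_card_nsmul _ _ _ h1
    rw [Finset.card_range, smul_eq_mul] at h2
    have h3 : e.eval m * ((c + 1) * B ^ c) ≤ ((c + 1) * c') * B ^ C := by
      calc e.eval m * ((c + 1) * B ^ c) ≤ (c' * B ^ c') * ((c + 1) * B ^ c) :=
            Nat.mul_le_mul_right _ (hc' m B h hB)
        _ = ((c + 1) * c') * B ^ (c' + c) := by rw [pow_add]; ring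
        _ ≤ _ := Nat.mul_le_mul_left _ (Nat.pow_le_pow_right hB (by omega))
    have h4 : e.cost + 1 ≤ (e.cost + 1) * B ^ C := Nat.le_mul_of_pos_right _ (Nat.pow_pos hB)
    have h5 : (e.cost + 1) * B ^ C + ((c + 1) * c') * B ^ C ≤ C * B ^ C := by
      rw [← add_mul]; exact Nat.mul_le_mul_right _ (by omega)
    rw [run_loop_snd]
    omega

/-! ### A language with sums and parallel assignments -/

/-- The four arithmetic operations. -/
inductive ArithOp where
  | add : ArithOp
  | sub : ArithOp
  | mul : ArithOp
  | div : ArithOp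

def ArithOp.toRExp : ArithOp → RExp → RExp → RExp
  | .add => .add
  | .sub => .sub
  | .mul => .mul
  | .div => .div

noncomputable def ArithOp.apply : ArithOp → ℝ → ℝ → ℝ
  | .add, x, y => x + y
  | .sub, x, y => x - y
  | .mul, x, y => x * y
  | .div, x, y => x / y

theorem ArithOp.eval_toRExp (o : ArithOp) (x y : RExp) (m : Memory) :
    (o.toRExp x y).eval m = o.apply (x.eval m) (y.eval m) := by
  cases o <;> rfl

/-- Real expressions with finite sums and with case distinctions by comparison. -/
inductive SumExp where
  | base : RExp → SumExp
  | bin : ArithOp → SumExp → SumExp → SumExp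
  | sum : ℕ → NExp → SumExp → SumExp
  | ite : SumExp → SumExp → SumExp → SumExp → SumExp

open Classical in
noncomputable def SumExp.eval : SumExp → Memory → ℝ
  | .base r, m => r.eval m
  | .bin o a b, m => o.apply (a.eval m) (b.eval m)
  | .sum i n e, m => ∑ t ∈ Finset.range (n.eval m), e.eval (m.setNat i t)
  | .ite a b c e, m => if a.eval m ≤ b.eval m then c.eval m else e.eval m

def RExp.ReadsBelow (B : ℕ) : RExp → Prop
  | .ofNat e => e.ReadsBelow B
  | .entry a i j => a < 50 ∧ i.ReadsBelow B ∧ j.ReadsBelow B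
  | .add x y => x.ReadsBelow B ∧ y.ReadsBelow B
  | .sub x y => x.ReadsBelow B ∧ y.ReadsBelow B
  | .mul x y => x.ReadsBelow B ∧ y.ReadsBelow B
  | .div x y => x.ReadsBelow B ∧ y.ReadsBelow B

/-- The expression reads registers below `B` and arrays below `50` only; sums use the registers
from `B` on, in the order of nesting, and their ranges depend on the input sizes only. -/
def SumExp.WellFormed : SumExp → ℕ → Prop
  | .base r, B => r.ReadsBelow B
  | .bin _ a b, B => a.WellFormed B ∧ b.WellFormed B
  | .sum i n e, B => i = B ∧ n.ReadsBelow 7 ∧ e.WellFormed (B + 1)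
  | .ite a b c e, B => a.WellFormed B ∧ b.WellFormed B ∧ c.WellFormed B ∧ e.WellFormed B

/-- The memories agree on the registers below `B` and on the arrays below `50`. -/
def Agree (B : ℕ) (m m' : Memory) : Prop :=
  (∀ r < B, m.nat r = m'.nat r) ∧ ∀ a < 50, m.real a = m'.real a

theorem Agree.symm {B : ℕ} {m m' : Memory} (h : Agree B m m') : Agree B m' m :=
  ⟨fun r hr => (h.1 r hr).symm, fun a ha => (h.2 a ha).symm⟩

theorem Agree.trans {B : ℕ} {m m' m'' : Memory} (h : Agree B m m') (h' : Agree B m' m'') :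
    Agree B m m'' :=
  ⟨fun r hr => (h.1 r hr).trans (h'.1 r hr), fun a ha => (h.2 a ha).trans (h'.2 a ha)⟩

theorem Agree.setNat_succ {B : ℕ} {m m' : Memory} (h : Agree B m m') (t : ℕ) :
    Agree (B + 1) (m.setNat B t) (m'.setNat B t) := by
  refine ⟨fun r hr => ?_, h.2⟩
  rcases eq_or_ne r B with rfl | hne
  · simp
  · rw [setNat_nat_of_ne _ _ hne, setNat_nat_of_ne _ _ hne]
    exact h.1 r (by omega)

theorem Agree.setNat {B : ℕ} {m m' : Memory} (h : Agree B m m') (i t : ℕ) :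
    Agree B (m.setNat i t) (m'.setNat i t) := by
  refine ⟨fun r hr => ?_, h.2⟩
  rcases eq_or_ne r i with rfl | hne
  · simp
  · rw [setNat_nat_of_ne _ _ hne, setNat_nat_of_ne _ _ hne]
    exact h.1 r hr

theorem RExp.eval_congr {B : ℕ} {e : RExp} (he : e.ReadsBelow B) {m m' : Memory}
    (h : Agree B m m') : e.eval m = e.eval m' := by
  induction e with
  | ofNat e => simp only [RExp.eval, NExp.eval_congr he h.1]
  | entry a i j =>
    simp only [RExp.eval, NExp.eval_congr he.2.1 h.1, NExp.eval_congr he.2.2 h.1, h.2 a he.1]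
  | add x y ihx ihy => simp only [RExp.eval, ihx he.1, ihy he.2]
  | sub x y ihx ihy => simp only [RExp.eval, ihx he.1, ihy he.2]
  | mul x y ihx ihy => simp only [RExp.eval, ihx he.1, ihy he.2]
  | div x y ihx ihy => simp only [RExp.eval, ihx he.1, ihy he.2]

theorem SumExp.eval_congr {e : SumExp} {B : ℕ} (he : e.WellFormed B) (hB : 7 ≤ B) {m m' : Memory}
    (h : Agree B m m') : e.eval m = e.eval m' := by
  induction e generalizing B m m' with
  | base r => exact RExp.eval_congr he h
  | bin o a b iha ihb => simp only [SumExp.eval, iha he.1 hB h, ihb he.2 hB h]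
  | sum i n e ih =>
    obtain ⟨rfl, hn, he⟩ := he
    simp only [SumExp.eval, NExp.eval_congr (hn.mono hB) h.1]
    exact Finset.sum_congr rfl fun t _ => ih he (by omega) (h.setNat_succ t)
  | ite a b c e iha ihb ihc ihe =>
    simp only [SumExp.eval, iha he.1 hB h, ihb he.2.1 hB h, ihc he.2.2.1 hB h, ihe he.2.2.2 hB h]

/-- A program that stores the value of the expression in row `k` of the array `50`, with the rows
below `k` left unchanged. -/
def SumExp.compile : SumExp → ℕ → Prog
  | .base r, k => .setReal 50 (.lit k) (.lit 0) r
  | .bin o a b, k => .seq (a.compile k) (.seq (b.compile (k + 1))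
      (.setReal 50 (.lit k) (.lit 0)
        (o.toRExp (.entry 50 (.lit k) (.lit 0)) (.entry 50 (.lit (k + 1)) (.lit 0)))))
  | .sum i n e, k => .seq (.setReal 50 (.lit k) (.lit 0) (.ofNat (.lit 0)))
      (.loop i n (.seq (e.compile (k + 1)) (.setReal 50 (.lit k) (.lit 0)
        (.add (.entry 50 (.lit k) (.lit 0)) (.entry 50 (.lit (k + 1)) (.lit 0))))))
  | .ite a b c e, k => .seq (a.compile k) (.seq (b.compile (k + 1))
      (.ifLe (.entry 50 (.lit k) (.lit 0)) (.entry 50 (.lit (k + 1)) (.lit 0))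
        (c.compile k) (e.compile k)))

/-- `m'` arises from `m` by changes in registers from `B` on and in rows from `k` on of the
array `50`. -/
structure ScratchStep (B k : ℕ) (m m' : Memory) : Prop where
  nat : ∀ r < B, m'.nat r = m.nat r
  real : ∀ a ≠ 50, m'.real a = m.real a
  scratch : ∀ l < k, m'.real 50 l 0 = m.real 50 l 0

theorem ScratchStep.trans {B k B' k' : ℕ} {m m' m'' : Memory} (h : ScratchStep B k m m')
    (h' : ScratchStep B' k' m' m'') (hB : B ≤ B') (hk : k ≤ k') : ScratchStep B k m m'' :=
  ⟨fun r hr => (h'.nat r (lt_of_lt_of_le hr hB)).trans (h.nat r hr),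
    fun a ha => (h'.real a ha).trans (h.real a ha),
    fun l hl => (h'.scratch l (lt_of_lt_of_le hl hk)).trans (h.scratch l hl)⟩

theorem ScratchStep.agree {B k : ℕ} {m m' : Memory} (h : ScratchStep B k m m') : Agree B m m' :=
  ⟨fun r hr => (h.nat r hr).symm, fun a ha => (h.real a (by omega)).symm⟩

theorem scratchStep_setReal (B k : ℕ) (m : Memory) (x : ℝ) :
    ScratchStep B k m (m.setReal 50 k 0 x) :=
  ⟨fun _ _ => rfl, fun a ha => setReal_real_of_ne _ _ _ _ ha, fun l hl => by
    rw [setReal_real_self, if_neg (by omega)]⟩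

theorem scratchStep_setNat {B i : ℕ} (hi : B ≤ i) (k : ℕ) (m : Memory) (t : ℕ) :
    ScratchStep B k m (m.setNat i t) :=
  ⟨fun _ _ => setNat_nat_of_ne _ _ (by omega), fun _ _ => rfl, fun _ _ => rfl⟩

theorem SumExp.compile_run {e : SumExp} {B : ℕ} (he : e.WellFormed B) (hB : 7 ≤ B) (k : ℕ)
    (m : Memory) : ScratchStep B k m ((e.compile k).run m).1 ∧
      ((e.compile k).run m).1.real 50 k 0 = e.eval m := by
  induction e generalizing B k m with
  | base r =>
    refine ⟨scratchStep_setReal B k m _, ?_⟩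
    rw [compile, run_setReal_fst, setReal_real_self]
    simp [NExp.eval, SumExp.eval]
  | bin o a b iha ihb =>
    obtain ⟨h1, e1⟩ := iha he.1 hB k m
    obtain ⟨h2, e2⟩ := ihb he.2 hB (k + 1) ((a.compile k).run m).1
    rw [compile, run_seq_fst, run_seq_fst, run_setReal_fst]
    refine ⟨(h1.trans h2 le_rfl (by omega)).trans (scratchStep_setReal B k _ _) le_rfl le_rfl, ?_⟩
    rw [setReal_real_self, if_pos ⟨rfl, rfl⟩, ArithOp.eval_toRExp]
    simp only [RExp.eval, NExp.eval, e2, h2.scratch k (by omega), e1, SumExp.eval]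
    rw [b.eval_congr he.2 hB h1.agree]
  | sum i n e ih =>
    obtain ⟨rfl, hn, he⟩ := he
    rw [compile, run_seq_fst, run_loop_fst, run_setReal_fst]
    set m₀ := m.setReal 50 k 0 (RExp.eval m (.ofNat (.lit 0))) with hm₀
    have h0 : ScratchStep i k m m₀ := scratchStep_setReal i k m _
    have h00 : m₀.real 50 k 0 = 0 := by
      rw [hm₀, setReal_real_self, if_pos ⟨rfl, rfl⟩]; simp [RExp.eval, NExp.eval]
    have hn' : n.eval m₀ = n.eval m := NExp.eval_congr (hn.mono hB) h0.nat
    simp only [NExp.eval]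
    rw [show m.setReal 50 k 0 (RExp.eval m (.ofNat (.lit 0))) = m₀ from rfl, hn']
    simp only [SumExp.eval]
    generalize n.eval m = N
    induction N with
    | zero => exact ⟨h0, by simpa [loopMemory] using h00⟩
    | succ N ihN =>
      obtain ⟨h1, e1⟩ := ihN
      rw [loopMemory, run_seq_fst, run_setReal_fst]
      simp only [NExp.eval]
      set m₁ := loopMemory (.seq (e.compile (k + 1)) (.setReal 50 (.lit k) (.lit 0)
        (.add (.entry 50 (.lit k) (.lit 0)) (.entry 50 (.lit (k + 1)) (.lit 0))))) i m₀ N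
      obtain ⟨h2, e2⟩ := ih he (by omega) (k + 1) (m₁.setNat i N)
      have h3 : ScratchStep i k m₁ (m₁.setNat i N) := scratchStep_setNat le_rfl k m₁ N
      refine ⟨((h1.trans h3 le_rfl le_rfl).trans h2 (by omega) (by omega)).trans
        (scratchStep_setReal i k _ _) le_rfl le_rfl, ?_⟩
      rw [setReal_real_self, if_pos ⟨rfl, rfl⟩]
      simp only [RExp.eval, NExp.eval]
      rw [h2.scratch k (by omega), e2, Finset.sum_range_succ, setNat_real, e1,
        e.eval_congr he (by omega) (h1.agree.symm.setNat_succ N)]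
  | ite a b c e iha ihb ihc ihe =>
    obtain ⟨h1, e1⟩ := iha he.1 hB k m
    obtain ⟨h2, e2⟩ := ihb he.2.1 hB (k + 1) ((a.compile k).run m).1
    have h12 := h1.trans h2 le_rfl (by omega)
    have hc := ihc he.2.2.1 hB k ((b.compile (k + 1)).run ((a.compile k).run m).1).1
    have hd := ihe he.2.2.2 hB k ((b.compile (k + 1)).run ((a.compile k).run m).1).1
    rw [compile, run_seq_fst, run_seq_fst, Prog.run]
    simp only [RExp.eval, NExp.eval, e2, h2.scratch k (by omega), e1, SumExp.eval]
    rw [← b.eval_congr he.2.1 hB h1.agree]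
    split_ifs
    · exact ⟨h12.trans hc.1 le_rfl le_rfl,
        hc.2.trans (c.eval_congr he.2.2.1 hB h12.agree).symm⟩
    · exact ⟨h12.trans hd.1 le_rfl le_rfl,
        hd.2.trans (e.eval_congr he.2.2.2 hB h12.agree).symm⟩

theorem SumExp.compile_guarded {e : SumExp} {B : ℕ} (he : e.WellFormed B) (hB : 7 ≤ B) (k : ℕ) :
    (e.compile k).Guarded := by
  induction e generalizing B k with
  | base r => trivial
  | bin o a b iha ihb => exact ⟨iha he.1 hB k, ihb he.2 hB (k + 1), trivial⟩
  | sum i n e ih =>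
    exact ⟨trivial, he.1 ▸ hB, he.2.1, ih he.2.2 (by omega) (k + 1), trivial⟩
  | ite a b c e iha ihb ihc ihe =>
    exact ⟨iha he.1 hB k, ihb he.2.1 hB (k + 1), ihc he.2.2.1 hB k, ihe he.2.2.2 hB k⟩

/-- Programs built from parallel assignments to the entries of an array, sequencing and loops.
In `assign a n c e` the registers `20` and `21` hold the row and the column of the entry. -/
inductive ArrayProg where
  | assign : ℕ → NExp → NExp → SumExp → ArrayProg
  | seq : ArrayProg → ArrayProg → ArrayProg
  | loop : ℕ → NExp → ArrayProg → ArrayProg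

/-- The effect of a parallel assignment. -/
noncomputable def assignMemory (a n c : ℕ) (e : SumExp) (m : Memory) : Memory :=
  { m with real := fun a' r s => if a' = a ∧ r < n ∧ s < c then
      e.eval ((m.setNat 20 r).setNat 21 s) else m.real a' r s }

noncomputable def ArrayProg.exec : ArrayProg → Memory → Memory
  | .assign a n c e, m => assignMemory a (n.eval m) (c.eval m) e m
  | .seq p q, m => q.exec (p.exec m)
  | .loop i e p, m => Nat.rec m (fun n acc => p.exec (acc.setNat i n)) (e.eval m)

def ArrayProg.WellFormed : ArrayProg → Prop
  | .assign a n c e => a < 50 ∧ n.ReadsBelow 7 ∧ c.ReadsBelow 7 ∧ e.WellFormed 22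
  | .seq p q => p.WellFormed ∧ q.WellFormed
  | .loop i e p => 7 ≤ i ∧ i < 20 ∧ e.ReadsBelow 7 ∧ p.WellFormed

def ArrayProg.compile : ArrayProg → Prog
  | .assign a n c e => .seq
      (.loop 20 n (.loop 21 c (.seq (e.compile 0)
        (.setReal 51 (.reg 20) (.reg 21) (.entry 50 (.lit 0) (.lit 0))))))
      (.loop 20 n (.loop 21 c
        (.setReal a (.reg 20) (.reg 21) (.entry 51 (.reg 20) (.reg 21)))))
  | .seq p q => .seq p.compile q.compile
  | .loop i e p => .loop i e p.compile

theorem ArrayProg.compile_guarded {p : ArrayProg} (hp : p.WellFormed) : p.compile.Guarded := by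
  induction p with
  | assign a n c e =>
    exact ⟨⟨by norm_num, hp.2.1, by norm_num, hp.2.2.1,
      SumExp.compile_guarded hp.2.2.2 (by norm_num) 0, trivial⟩,
      by norm_num, hp.2.1, by norm_num, hp.2.2.1, trivial⟩
  | seq p q ihp ihq => exact ⟨ihp hp.1, ihq hp.2⟩
  | loop i e p ih => exact ⟨hp.1, hp.2.2.1, ih hp.2.2.2⟩

/-- A nested loop that fills the array `a`, entry by entry, with the values `f r s`. -/
theorem run_fill {a : ℕ} {n c : NExp} (hc : c.ReadsBelow 7) {q : Prog}
    {m : Memory} {f : ℕ → ℕ → ℝ} (Inv : Memory → Prop)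
    (hset : ∀ m', Inv m' → ∀ t, Inv (m'.setNat 20 t) ∧ Inv (m'.setNat 21 t))
    (hnat : ∀ m', Inv m' → ∀ r < 7, m'.nat r = m.nat r)
    (hq : ∀ m', Inv m' → Inv (q.run m').1 ∧ (q.run m').1.nat 20 = m'.nat 20 ∧
      ∀ r s, (q.run m').1.real a r s =
        if r = m'.nat 20 ∧ s = m'.nat 21 then f r s else m'.real a r s) (h0 : Inv m) :
    Inv ((Prog.loop 20 n (.loop 21 c q)).run m).1 ∧
      ∀ r s, ((Prog.loop 20 n (.loop 21 c q)).run m).1.real a r s =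
        if r < n.eval m ∧ s < c.eval m then f r s else m.real a r s := by
  have inner : ∀ m', Inv m' → ∀ N, Inv (loopMemory q 21 m' N) ∧
      (loopMemory q 21 m' N).nat 20 = m'.nat 20 ∧
      ∀ r s, (loopMemory q 21 m' N).real a r s =
        if r = m'.nat 20 ∧ s < N then f r s else m'.real a r s := by
    intro m' hm' N
    induction N with
    | zero => exact ⟨hm', rfl, fun r s => by simp [loopMemory]⟩
    | succ N ih =>
      obtain ⟨h1, h2, h3⟩ := ih
      obtain ⟨g1, g2, g3⟩ := hq _ (hset _ h1 N).2
      have e20 : ((loopMemory q 21 m' N).setNat 21 N).nat 20 = m'.nat 20 := by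
        rw [setNat_nat_of_ne _ _ (by norm_num), h2]
      refine ⟨g1, by rw [loopMemory, g2, e20], fun r s => ?_⟩
      rw [loopMemory, g3, setNat_nat_self, e20, setNat_real, h3]
      by_cases hr : r = m'.nat 20
      · rcases lt_trichotomy s N with hs | hs | hs
        · rw [if_neg (by omega), if_pos ⟨hr, hs⟩, if_pos ⟨hr, by omega⟩]
        · rw [if_pos ⟨hr, hs⟩, if_pos ⟨hr, by omega⟩]
        · rw [if_neg (by omega), if_neg (by omega), if_neg (by omega)]
      · rw [if_neg (by tauto), if_neg (by tauto), if_neg (by tauto)]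
  rw [run_loop_fst]
  generalize n.eval m = N
  induction N with
  | zero => exact ⟨h0, fun r s => by simp [loopMemory]⟩
  | succ N ih =>
    obtain ⟨h1, h3⟩ := ih
    have h1' := (hset _ h1 N).1
    rw [loopMemory, run_loop_fst]
    have hcN : c.eval ((loopMemory (.loop 21 c q) 20 m N).setNat 20 N) = c.eval m :=
      NExp.eval_congr hc (hnat _ h1')
    rw [hcN]
    obtain ⟨g1, -, g3⟩ := inner _ h1' (c.eval m)
    refine ⟨g1, fun r s => ?_⟩
    rw [g3, setNat_nat_self, setNat_real, h3]
    by_cases hs : s < c.eval m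
    · rcases lt_trichotomy r N with hr | hr | hr
      · rw [if_neg (by omega), if_pos ⟨hr, hs⟩, if_pos ⟨by omega, hs⟩]
      · rw [if_pos ⟨hr, hs⟩, if_pos ⟨by omega, hs⟩]
      · rw [if_neg (by omega), if_neg (by omega), if_neg (by omega)]
    · rw [if_neg (by tauto), if_neg (by tauto), if_neg (by tauto)]

theorem ArrayProg.compile_assign {a : ℕ} {n c : NExp} {e : SumExp}
    (hp : (ArrayProg.assign a n c e).WellFormed) (m : Memory) :
    Agree 20 ((ArrayProg.assign a n c e).compile.run m).1 ((ArrayProg.assign a n c e).exec m) := by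
  obtain ⟨ha, hn, hc, he⟩ := hp
  rw [compile, run_seq_fst, exec]
  have hfirst := run_fill (a := 51) (n := n) hc (m := m)
    (q := .seq (e.compile 0) (.setReal 51 (.reg 20) (.reg 21) (.entry 50 (.lit 0) (.lit 0))))
    (f := fun r s => e.eval ((m.setNat 20 r).setNat 21 s))
    (fun m' => Agree 20 m m')
    (fun m' h t => ⟨⟨fun r hr => by rw [setNat_nat_of_ne _ _ (by omega)]; exact h.1 r hr, h.2⟩,
      ⟨fun r hr => by rw [setNat_nat_of_ne _ _ (by omega)]; exact h.1 r hr, h.2⟩⟩)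
    (fun m' h r hr => (h.1 r (by omega)).symm) ?_ ⟨fun _ _ => rfl, fun _ _ => rfl⟩
  swap
  · intro m' h
    obtain ⟨h1, h2⟩ := SumExp.compile_run he (by norm_num) 0 m'
    have hag : Agree 22 m' ((m.setNat 20 (m'.nat 20)).setNat 21 (m'.nat 21)) := by
      refine ⟨fun r hr => ?_, fun b hb => (h.2 b hb).symm⟩
      rcases eq_or_ne r 21 with rfl | h21
      · rw [setNat_nat_self]
      · rw [setNat_nat_of_ne _ _ h21]
        rcases eq_or_ne r 20 with rfl | h20
        · rw [setNat_nat_self]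
        · rw [setNat_nat_of_ne _ _ h20]
          exact (h.1 r (by omega)).symm
    rw [run_seq_fst, run_setReal_fst]
    refine ⟨⟨fun r hr => ?_, fun b hb => ?_⟩, h1.nat 20 (by norm_num), fun r s => ?_⟩
    · rw [setReal_nat, h1.nat r (by omega)]; exact h.1 r hr
    · rw [setReal_real_of_ne _ _ _ _ (by omega), h1.real b (by omega)]; exact h.2 b hb
    · rw [setReal_real_self]
      simp only [NExp.eval, RExp.eval, h1.nat 20 (by norm_num), h1.nat 21 (by norm_num), h2]
      rw [e.eval_congr he (by norm_num) hag, h1.real 51 (by norm_num)]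
      by_cases hrs : r = m'.nat 20 ∧ s = m'.nat 21
      · rw [if_pos hrs, if_pos hrs, hrs.1, hrs.2]
      · rw [if_neg hrs, if_neg hrs]
  obtain ⟨hI, hT⟩ := hfirst
  set m₁ := ((Prog.loop 20 n (.loop 21 c (.seq (e.compile 0)
    (.setReal 51 (.reg 20) (.reg 21) (.entry 50 (.lit 0) (.lit 0)))))).run m).1
  obtain ⟨hJ, hA⟩ := run_fill (a := a) (n := n) hc (m := m₁)
    (q := .setReal a (.reg 20) (.reg 21) (.entry 51 (.reg 20) (.reg 21)))
    (f := fun r s => m₁.real 51 r s)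
    (fun m' => (∀ r < 20, m'.nat r = m₁.nat r) ∧ ∀ b ≠ a, m'.real b = m₁.real b)
    (fun m' h t => ⟨⟨fun r hr => by rw [setNat_nat_of_ne _ _ (by omega)]; exact h.1 r hr, h.2⟩,
      ⟨fun r hr => by rw [setNat_nat_of_ne _ _ (by omega)]; exact h.1 r hr, h.2⟩⟩)
    (fun m' h r hr => h.1 r (by omega))
    (fun m' h => by
      rw [run_setReal_fst]
      refine ⟨⟨h.1, fun b hb => ?_⟩, rfl, fun r s => ?_⟩
      · rw [setReal_real_of_ne _ _ _ _ hb]; exact h.2 b hb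
      · rw [setReal_real_self]
        simp only [NExp.eval, RExp.eval, h.2 51 (by omega)]
        by_cases hrs : r = m'.nat 20 ∧ s = m'.nat 21
        · rw [if_pos hrs, if_pos hrs, hrs.1, hrs.2]
        · rw [if_neg hrs, if_neg hrs]) ⟨fun _ _ => rfl, fun _ _ => rfl⟩
  have hn1 : n.eval m₁ = n.eval m := NExp.eval_congr hn fun r hr => (hI.1 r (by omega)).symm
  have hc1 : c.eval m₁ = c.eval m := NExp.eval_congr hc fun r hr => (hI.1 r (by omega)).symm
  refine ⟨fun r hr => (hJ.1 r hr).trans (hI.1 r hr).symm, fun b hb => ?_⟩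
  funext r s
  rcases eq_or_ne b a with rfl | hne
  · rw [hA, hT, hn1, hc1, ← hI.2 b hb]
    simp only [assignMemory, true_and]
    by_cases hrs : r < n.eval m ∧ s < c.eval m
    · rw [if_pos hrs, if_pos hrs, if_pos hrs]
    · rw [if_neg hrs, if_neg hrs]
  · rw [hJ.2 b hne, ← hI.2 b hb]
    simp [assignMemory, hne]

theorem ArrayProg.exec_congr {p : ArrayProg} (hp : p.WellFormed) {m m' : Memory}
    (h : Agree 20 m m') : Agree 20 (p.exec m) (p.exec m') := by
  induction p generalizing m m' with
  | assign a n c e =>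
    obtain ⟨ha, hn, hc, he⟩ := hp
    have hn1 : n.eval m = n.eval m' := NExp.eval_congr (hn.mono (by norm_num)) h.1
    have hc1 : c.eval m = c.eval m' := NExp.eval_congr (hc.mono (by norm_num)) h.1
    refine ⟨h.1, fun b hb => ?_⟩
    funext r s
    simp only [exec, assignMemory, hn1, hc1, h.2 b hb,
      e.eval_congr he (by norm_num) ((h.setNat_succ r).setNat_succ s)]
  | seq p q ihp ihq => exact ihq hp.2 (ihp hp.1 h)
  | loop i e p ih =>
    simp only [exec, NExp.eval_congr (hp.2.2.1.mono (by norm_num)) h.1]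
    generalize e.eval m' = N
    induction N with
    | zero => exact h
    | succ N ihN => exact ih hp.2.2.2 (ihN.setNat i N)

/-- The compiled program does what it should, apart from its scratch memory. -/
theorem ArrayProg.compile_run {p : ArrayProg} (hp : p.WellFormed) (m : Memory) :
    Agree 20 (p.compile.run m).1 (p.exec m) := by
  induction p generalizing m with
  | assign a n c e => exact compile_assign hp m
  | seq p q ihp ihq =>
    exact (ihq hp.2 _).trans (exec_congr hp.2 (ihp hp.1 m))
  | loop i e p ih =>
    rw [compile, run_loop_fst, exec]
    generalize e.eval m = N
    induction N with
    | zero => exact ⟨fun _ _ => rfl, fun _ _ => rfl⟩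
    | succ N ihN =>
      exact (ih hp.2.2.2 _).trans (exec_congr hp.2.2.2 (ihN.setNat i N))

end RealProgram

/-! ### Relaxation steps for convex feasibility -/

section Relaxation

variable {d : ℕ}

/-- A relaxation step `f` for a constraint `Sat`: feasible points are kept, and all others come
closer, by at least `η` in squared distance, to the reference point `z`. -/
structure IsRelaxation (z : Fin d → ℝ) (η : ℝ) (f : (Fin d → ℝ) → Fin d → ℝ)
    (Sat : (Fin d → ℝ) → Prop) : Prop where
  fixed : ∀ θ, Sat θ → f θ = θ
  closer : ∀ θ, ¬ Sat θ → (f θ - z) ⬝ᵥ (f θ - z) + η ≤ (θ - z) ⬝ᵥ (θ - z)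

variable {z : Fin d → ℝ} {η : ℝ}

theorem IsRelaxation.le {f : (Fin d → ℝ) → Fin d → ℝ} {Sat : (Fin d → ℝ) → Prop}
    (h : IsRelaxation z η f Sat) (hη : 0 ≤ η) (θ : Fin d → ℝ) :
    (f θ - z) ⬝ᵥ (f θ - z) ≤ (θ - z) ⬝ᵥ (θ - z) := by
  by_cases hs : Sat θ
  · rw [h.fixed θ hs]
  · linarith [h.closer θ hs]

theorem IsRelaxation.comp {f g : (Fin d → ℝ) → Fin d → ℝ} {Sf Sg : (Fin d → ℝ) → Prop}
    (hf : IsRelaxation z η f Sf) (hg : IsRelaxation z η g Sg) (hη : 0 ≤ η) :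
    IsRelaxation z η (fun θ => g (f θ)) (fun θ => Sf θ ∧ Sg θ) := by
  refine ⟨fun θ h => by rw [hf.fixed θ h.1, hg.fixed θ h.2], fun θ h => ?_⟩
  by_cases hs : Sf θ
  · rw [hf.fixed θ hs]
    exact hg.closer θ fun hg' => h ⟨hs, hg'⟩
  · linarith [hg.le hη (f θ), hf.closer θ hs]

/-- Sweeping through the first `n` of a sequence of relaxation steps. -/
def relaxSweep (f : ℕ → (Fin d → ℝ) → Fin d → ℝ) : ℕ → (Fin d → ℝ) → Fin d → ℝ
  | 0, θ => θ
  | n + 1, θ => f n (relaxSweep f n θ)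

theorem isRelaxation_sweep {f : ℕ → (Fin d → ℝ) → Fin d → ℝ} {Sat : ℕ → (Fin d → ℝ) → Prop}
    (hη : 0 ≤ η) {n : ℕ} (h : ∀ i < n, IsRelaxation z η (f i) (Sat i)) :
    IsRelaxation z η (relaxSweep f n) (fun θ => ∀ i < n, Sat i θ) := by
  induction n with
  | zero => exact ⟨fun _ _ => rfl, fun _ h => absurd (fun i hi => absurd hi (Nat.not_lt_zero i)) h⟩
  | succ n ih =>
    have h1 := (ih fun i hi => h i (by omega)).comp (h n (by omega)) hη
    refine ⟨fun θ hs => h1.fixed θ ⟨fun i hi => hs i (by omega), hs n (by omega)⟩,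
      fun θ hs => h1.closer θ fun hs' => hs fun i hi => ?_⟩
    rcases Nat.lt_succ_iff_lt_or_eq.1 hi with hi | rfl
    · exact hs'.1 i hi
    · exact hs'.2

theorem IsRelaxation.sat_iterate {f : (Fin d → ℝ) → Fin d → ℝ} {Sat : (Fin d → ℝ) → Prop}
    (h : IsRelaxation z η f Sat) {T : ℕ} (hT : z ⬝ᵥ z < T * η) : Sat (f^[T] 0) := by
  have key : ∀ n : ℕ, Sat (f^[n] 0) ∨
      (f^[n] 0 - z) ⬝ᵥ (f^[n] 0 - z) + n * η ≤ z ⬝ᵥ z := by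
    intro n
    induction n with
    | zero => right; simp
    | succ n ih =>
      rw [Function.iterate_succ_apply']
      by_cases hs : Sat (f^[n] 0)
      · left; rw [h.fixed _ hs]; exact hs
      · right
        have := h.closer _ hs
        have := ih.resolve_left hs
        push_cast
        linarith
  rcases key T with h1 | h1
  · exact h1
  · have : 0 ≤ (f^[T] 0 - z) ⬝ᵥ (f^[T] 0 - z) := by
      simpa using posDef_quad_nonneg (PosDef.one (R := ℝ) (n := Fin d)) (f^[T] 0 - z)
    linarith

/-- The Polyak step: moving along `-a` with a step size adapted to a lower bound `p` for the depth
of the cut. -/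
theorem polyak_step {θ a : Fin d → ℝ} {p : ℝ} (ha : 0 < a ⬝ᵥ a) (hp : 0 ≤ p)
    (hcut : p ≤ a ⬝ᵥ (θ - z)) (hη : η * (a ⬝ᵥ a) ≤ p ^ 2) :
    (θ - (p / (a ⬝ᵥ a)) • a - z) ⬝ᵥ (θ - (p / (a ⬝ᵥ a)) • a - z) + η ≤
      (θ - z) ⬝ᵥ (θ - z) := by
  have e : (θ - (p / (a ⬝ᵥ a)) • a - z) ⬝ᵥ (θ - (p / (a ⬝ᵥ a)) • a - z) =
      (θ - z) ⬝ᵥ (θ - z) - 2 * (p / (a ⬝ᵥ a)) * (a ⬝ᵥ (θ - z)) + (p / (a ⬝ᵥ a)) ^ 2 * (a ⬝ᵥ a) := by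
    rw [sub_right_comm]
    simp only [sub_dotProduct, dotProduct_sub, smul_dotProduct, dotProduct_smul, smul_eq_mul,
      dotProduct_comm θ a, dotProduct_comm z a]
    ring
  rw [e]
  have h1 : (p / (a ⬝ᵥ a)) ^ 2 * (a ⬝ᵥ a) = p / (a ⬝ᵥ a) * p := by field_simp
  have h2 : p / (a ⬝ᵥ a) * p ≤ p / (a ⬝ᵥ a) * (a ⬝ᵥ (θ - z)) :=
    mul_le_mul_of_nonneg_left hcut (by positivity)
  have h3 : η ≤ p / (a ⬝ᵥ a) * p := by
    rw [div_mul_eq_mul_div, le_div_iff₀ ha, ← sq]; exact hη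
  rw [h1]
  linarith

/-- The constraint `l ≤ aᵀθ ≤ 1`, up to an error `ε`. -/
def LinSat (a : Fin d → ℝ) (l ε : ℝ) (θ : Fin d → ℝ) : Prop := l - ε ≤ a ⬝ᵥ θ ∧ a ⬝ᵥ θ ≤ 1 + ε

open Classical in
/-- The step size of the relaxation of the constraint `l ≤ aᵀθ ≤ 1`. -/
noncomputable def linStep (a : Fin d → ℝ) (l ε : ℝ) (θ : Fin d → ℝ) : ℝ :=
  if l - ε ≤ a ⬝ᵥ θ then if a ⬝ᵥ θ ≤ 1 + ε then 0 else (a ⬝ᵥ θ - 1) / (a ⬝ᵥ a)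
  else (a ⬝ᵥ θ - l) / (a ⬝ᵥ a)

noncomputable def linRelax (a : Fin d → ℝ) (l ε : ℝ) (θ : Fin d → ℝ) : Fin d → ℝ :=
  θ - linStep a l ε θ • a

theorem dotProduct_self_nonneg' (a : Fin d → ℝ) : 0 ≤ a ⬝ᵥ a := by
  simpa using posDef_quad_nonneg (PosDef.one (R := ℝ) (n := Fin d)) a

theorem isRelaxation_linRelax {a : Fin d → ℝ} {l ε : ℝ} (ha : a ⬝ᵥ a ≤ 1) (hε : 0 < ε)
    (hz : l ≤ a ⬝ᵥ z) (hz1 : a ⬝ᵥ z ≤ 1) (hη : 0 ≤ η) (hηε : η ≤ ε ^ 2) :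
    IsRelaxation z η (linRelax a l ε) (LinSat a l ε) := by
  have hpos : ∀ θ : Fin d → ℝ, a ⬝ᵥ θ ≠ a ⬝ᵥ z → 0 < a ⬝ᵥ a := by
    intro θ hne
    refine (dotProduct_self_nonneg' a).lt_of_ne fun h0 => hne ?_
    have : a = 0 := dotProduct_self_eq_zero.1 h0.symm
    simp [this]
  have hsq : ∀ p : ℝ, ε ≤ p → η * (a ⬝ᵥ a) ≤ p ^ 2 := by
    intro p hp
    have h1 : η * (a ⬝ᵥ a) ≤ η * 1 := mul_le_mul_of_nonneg_left ha hη
    nlinarith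
  refine ⟨fun θ h => ?_, fun θ h => ?_⟩
  · rw [linRelax, linStep, if_pos h.1, if_pos h.2, zero_smul, sub_zero]
  · unfold linRelax linStep
    by_cases h1 : l - ε ≤ a ⬝ᵥ θ
    · have h2 : ¬ a ⬝ᵥ θ ≤ 1 + ε := fun h2 => h ⟨h1, h2⟩
      rw [if_pos h1, if_neg h2]
      rw [not_le] at h2
      exact polyak_step (hpos θ (by linarith)) (by linarith)
        (by rw [dotProduct_sub]; linarith) (hsq _ (by linarith))
    · rw [if_neg h1]
      rw [not_le] at h1
      have h2 := polyak_step (z := z) (η := η) (θ := θ) (a := -a) (p := l - a ⬝ᵥ θ)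
        (by simpa using hpos θ (by linarith)) (by linarith)
        (by rw [neg_dotProduct, dotProduct_sub]; linarith)
        (by rw [neg_dotProduct_neg]; exact hsq _ (by linarith))
      have e : ((l - a ⬝ᵥ θ) / ((-a) ⬝ᵥ (-a))) • (-a) = ((a ⬝ᵥ θ - l) / (a ⬝ᵥ a)) • a := by
        rw [neg_dotProduct_neg, smul_neg, ← neg_smul, ← neg_div, neg_sub]
      rwa [e] at h2

/-- The constraint that `θ` lies in an ellipsoid around `c`, up to an error `ε` in the radius. -/
def EllSat (G : Matrix (Fin d) (Fin d) ℝ) (c : Fin d → ℝ) (R ε : ℝ) (θ : Fin d → ℝ) : Prop :=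
  (θ - c) ⬝ᵥ (G *ᵥ (θ - c)) ≤ (R + ε) ^ 2

open Classical in
noncomputable def ellStep (G : Matrix (Fin d) (Fin d) ℝ) (c : Fin d → ℝ) (R ε : ℝ)
    (θ : Fin d → ℝ) : ℝ :=
  if (θ - c) ⬝ᵥ (G *ᵥ (θ - c)) ≤ (R + ε) ^ 2 then 0
  else ((θ - c) ⬝ᵥ (G *ᵥ (θ - c)) - R ^ 2) / 2 / ((G *ᵥ (θ - c)) ⬝ᵥ (G *ᵥ (θ - c)))

noncomputable def ellRelax (G : Matrix (Fin d) (Fin d) ℝ) (c : Fin d → ℝ) (R ε : ℝ)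
    (θ : Fin d → ℝ) : Fin d → ℝ :=
  θ - ellStep G c R ε θ • (G *ᵥ (θ - c))

theorem isRelaxation_ellRelax {G : Matrix (Fin d) (Fin d) ℝ} (hG : G.PosDef) {c : Fin d → ℝ}
    {R ε κ : ℝ} (hR : 0 ≤ R) (hε : 0 < ε)
    (hGκ : ∀ y, (G *ᵥ y) ⬝ᵥ (G *ᵥ y) ≤ κ * (y ⬝ᵥ (G *ᵥ y)))
    (hz : (z - c) ⬝ᵥ (G *ᵥ (z - c)) ≤ R ^ 2) (hη : 0 ≤ η) (hηε : η * (4 * κ) ≤ ε ^ 2) :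
    IsRelaxation z η (ellRelax G c R ε) (EllSat G c R ε) := by
  refine ⟨fun θ h => ?_, fun θ h => ?_⟩
  · have h' : (θ - c) ⬝ᵥ (G *ᵥ (θ - c)) ≤ (R + ε) ^ 2 := h
    rw [ellRelax, ellStep, if_pos h', zero_smul, sub_zero]
  · have h' : ¬ (θ - c) ⬝ᵥ (G *ᵥ (θ - c)) ≤ (R + ε) ^ 2 := h
    rw [ellRelax, ellStep, if_neg h']
    rw [not_le] at h'
    set y := θ - c with hy
    set g := G *ᵥ y with hg
    set n := y ⬝ᵥ g with hn
    have hgg : 0 < g ⬝ᵥ g := by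
      refine (dotProduct_self_nonneg' g).lt_of_ne fun h0 => ?_
      have h1 : g = 0 := dotProduct_self_eq_zero.1 h0.symm
      rw [hn, h1, dotProduct_zero] at h'
      nlinarith [sq_nonneg (R + ε)]
    have hconv : 0 ≤ (z - θ) ⬝ᵥ (G *ᵥ (z - θ)) := posDef_quad_nonneg hG _
    have e1 : (z - c) ⬝ᵥ (G *ᵥ (z - c)) = n + 2 * (g ⬝ᵥ (z - θ)) + (z - θ) ⬝ᵥ (G *ᵥ (z - θ)) := by
      have : z - c = y + (z - θ) := by rw [hy]; abel
      rw [this, mulVec_add, dotProduct_add, add_dotProduct, add_dotProduct,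
        Matrix.PosDef.mulVec_dotProduct_comm hG.isHermitian y (z - θ), ← hg,
        dotProduct_comm (z - θ) g]
      ring
    have e2 : g ⬝ᵥ (θ - z) = -(g ⬝ᵥ (z - θ)) := by rw [← dotProduct_neg, neg_sub]
    refine polyak_step hgg (by nlinarith) (by rw [e2]; linarith) ?_
    have hnpos : 0 < n := by nlinarith
    have h1 : η * (g ⬝ᵥ g) ≤ η * (κ * n) := mul_le_mul_of_nonneg_left (hGκ y) hη
    have h2 : ε ^ 2 * n ≤ (n - R ^ 2) ^ 2 := by
      set s := Real.sqrt n with hs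
      have hs2 : s ^ 2 = n := Real.sq_sqrt hnpos.le
      have hs0 : 0 < s := Real.sqrt_pos.2 hnpos
      have hsR : R + ε ≤ s := Real.le_sqrt_of_sq_le h'.le
      have h3 : ε * s ≤ n - R ^ 2 := by rw [← hs2]; nlinarith
      calc ε ^ 2 * n = (ε * s) ^ 2 := by rw [mul_pow, hs2]
        _ ≤ _ := pow_le_pow_left₀ (by positivity) h3 2
    have h4 : η * (4 * κ) * n ≤ ε ^ 2 * n := mul_le_mul_of_nonneg_right hηε hnpos.le
    nlinarith

/-- One pass through all constraints of the planning problem of one action at one level. -/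
noncomputable def relaxPass (F : ℕ → Fin d → ℝ) (n : ℕ) (a : Fin d → ℝ) (l : ℝ)
    (G : Matrix (Fin d) (Fin d) ℝ) (c : Fin d → ℝ) (R ε : ℝ) (θ : Fin d → ℝ) : Fin d → ℝ :=
  ellRelax G c R ε (linRelax a l ε (relaxSweep (fun i => linRelax (F i) (-1) ε) n θ))

/-- All constraints of the planning problem of one action at one level, up to an error `ε`. -/
def PassSat (F : ℕ → Fin d → ℝ) (n : ℕ) (a : Fin d → ℝ) (l : ℝ)
    (G : Matrix (Fin d) (Fin d) ℝ) (c : Fin d → ℝ) (R ε : ℝ) (θ : Fin d → ℝ) : Prop :=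
  ((∀ i < n, LinSat (F i) (-1) ε θ) ∧ LinSat a l ε θ) ∧ EllSat G c R ε θ

theorem isRelaxation_relaxPass {F : ℕ → Fin d → ℝ} {n : ℕ} {a : Fin d → ℝ} {l : ℝ}
    {G : Matrix (Fin d) (Fin d) ℝ} (hG : G.PosDef) {c : Fin d → ℝ}
    {R ε κ : ℝ} (hR : 0 ≤ R) (hε : 0 < ε) (hκ : 1 ≤ κ)
    (hGκ : ∀ y, (G *ᵥ y) ⬝ᵥ (G *ᵥ y) ≤ κ * (y ⬝ᵥ (G *ᵥ y)))
    (hF : ∀ i < n, F i ⬝ᵥ F i ≤ 1) (hFz : ∀ i < n, |F i ⬝ᵥ z| ≤ 1)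
    (ha : a ⬝ᵥ a ≤ 1) (hlz : l ≤ a ⬝ᵥ z) (haz : a ⬝ᵥ z ≤ 1)
    (hz : (z - c) ⬝ᵥ (G *ᵥ (z - c)) ≤ R ^ 2) :
    IsRelaxation z (ε ^ 2 / (4 * κ)) (relaxPass F n a l G c R ε) (PassSat F n a l G c R ε) := by
  have hη : 0 ≤ ε ^ 2 / (4 * κ) := by positivity
  have hηε : ε ^ 2 / (4 * κ) ≤ ε ^ 2 := div_le_self (by positivity) (by linarith)
  refine ((isRelaxation_sweep hη fun i hi => ?_).comp
    (isRelaxation_linRelax ha hε hlz haz hη hηε) hη).comp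
    (isRelaxation_ellRelax hG hR hε hGκ hz hη ?_) hη
  · exact isRelaxation_linRelax (hF i hi) hε (abs_le.1 (hFz i hi)).1 (abs_le.1 (hFz i hi)).2 hη hηε
  · rw [div_mul_cancel₀ _ (by positivity)]

end Relaxation

namespace RealProgram

namespace SumExp

instance : Add SumExp := ⟨.bin .add⟩
instance : Sub SumExp := ⟨.bin .sub⟩
instance : Mul SumExp := ⟨.bin .mul⟩
instance : Div SumExp := ⟨.bin .div⟩

theorem eval_add (a b : SumExp) (m : Memory) : (a + b).eval m = a.eval m + b.eval m := rfl
theorem eval_sub (a b : SumExp) (m : Memory) : (a - b).eval m = a.eval m - b.eval m := rfl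
theorem eval_mul (a b : SumExp) (m : Memory) : (a * b).eval m = a.eval m * b.eval m := rfl
theorem eval_div (a b : SumExp) (m : Memory) : (a / b).eval m = a.eval m / b.eval m := rfl

theorem wellFormed_sub (a b : SumExp) (B : ℕ) :
    (a - b).WellFormed B ↔ a.WellFormed B ∧ b.WellFormed B := Iff.rfl
theorem wellFormed_div (a b : SumExp) (B : ℕ) :
    (a / b).WellFormed B ↔ a.WellFormed B ∧ b.WellFormed B := Iff.rfl

/-- A natural number as a real expression. -/
def num (n : NExp) : SumExp := .base (.ofNat n)

/-- An entry of an array. -/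
def cell (a : ℕ) (i j : NExp) : SumExp := .base (.entry a i j)

theorem eval_num (n : NExp) (m : Memory) : (num n).eval m = n.eval m := rfl
theorem eval_cell (a : ℕ) (i j : NExp) (m : Memory) :
    (cell a i j).eval m = m.real a (i.eval m) (j.eval m) := rfl

open Classical in
theorem eval_ite (a b c e : SumExp) (m : Memory) :
    (SumExp.ite a b c e).eval m = if a.eval m ≤ b.eval m then c.eval m else e.eval m := rfl

theorem eval_sum (i : ℕ) (n : NExp) (e : SumExp) (m : Memory) :
    (SumExp.sum i n e).eval m = ∑ t ∈ Finset.range (n.eval m), e.eval (m.setNat i t) := rfl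

theorem wellFormed_num (n : NExp) (B : ℕ) : (num n).WellFormed B ↔ n.ReadsBelow B := Iff.rfl
theorem wellFormed_cell (a : ℕ) (i j : NExp) (B : ℕ) :
    (cell a i j).WellFormed B ↔ a < 50 ∧ i.ReadsBelow B ∧ j.ReadsBelow B := Iff.rfl

end SumExp

open SumExp NExp

namespace ArrayProg

/-- The arrays to which a program assigns. -/
def arrays : ArrayProg → List ℕ
  | .assign a _ _ _ => [a]
  | .seq p q => p.arrays ++ q.arrays
  | .loop _ _ p => p.arrays

/-- The loop variables of a program. -/
def counters : ArrayProg → List ℕ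
  | .assign _ _ _ _ => []
  | .seq p q => p.counters ++ q.counters
  | .loop i _ p => i :: p.counters

theorem exec_seq (p q : ArrayProg) (m : Memory) : (seq p q).exec m = q.exec (p.exec m) := rfl

theorem exec_loop_induction {i : ℕ} {e : NExp} {p : ArrayProg} {m : Memory}
    (I : ℕ → Memory → Prop) (h0 : I 0 m)
    (hs : ∀ n < e.eval m, ∀ m', I n m' → I (n + 1) (p.exec (m'.setNat i n))) :
    I (e.eval m) ((loop i e p).exec m) := by
  rw [exec]
  suffices h : ∀ n ≤ e.eval m, I n (Nat.rec m (fun n acc => p.exec (acc.setNat i n)) n) from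
    h _ le_rfl
  intro n
  induction n with
  | zero => exact fun _ => h0
  | succ n ih => exact fun hn => hs n hn _ (ih (by omega))

theorem exec_real (p : ArrayProg) (m : Memory) {a : ℕ} (ha : a ∉ p.arrays) :
    (p.exec m).real a = m.real a := by
  induction p generalizing m with
  | assign b n c e =>
    have : a ≠ b := by simpa [arrays] using ha
    funext r s
    simp [exec, assignMemory, this]
  | seq p q ihp ihq =>
    simp only [arrays, List.mem_append, not_or] at ha
    rw [exec_seq, ihq _ ha.2, ihp _ ha.1]
  | loop i e p ih =>
    exact exec_loop_induction (fun _ m' => m'.real a = m.real a) rfl fun n _ m' h => by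
      rw [ih _ ha]; exact h

theorem exec_nat (p : ArrayProg) (m : Memory) {r : ℕ} (hr : r ∉ p.counters) :
    (p.exec m).nat r = m.nat r := by
  induction p generalizing m with
  | assign b n c e => rfl
  | seq p q ihp ihq =>
    simp only [counters, List.mem_append, not_or] at hr
    rw [exec_seq, ihq _ hr.2, ihp _ hr.1]
  | loop i e p ih =>
    simp only [counters, List.mem_cons, not_or] at hr
    exact exec_loop_induction (fun _ m' => m'.nat r = m.nat r) rfl fun n _ m' h => by
      rw [ih _ hr.2, setNat_nat_of_ne _ _ hr.1]; exact h

theorem exec_assign_self (a : ℕ) (n c : NExp) (e : SumExp) (m : Memory) {r s : ℕ}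
    (hr : r < n.eval m) (hs : s < c.eval m) :
    ((assign a n c e).exec m).real a r s = e.eval ((m.setNat 20 r).setNat 21 s) := by
  simp [exec, assignMemory, hr, hs]

end ArrayProg

open ArrayProg

/-- The row `r` of an array as a vector. -/
def rowVec (d : ℕ) (m : Memory) (a r : ℕ) : Fin d → ℝ := fun j => m.real a r j

/-- An array as a square matrix. -/
def toMatrix (d : ℕ) (m : Memory) (a : ℕ) : Matrix (Fin d) (Fin d) ℝ := fun i j => m.real a i j

theorem rowVec_congr {d : ℕ} {m m' : Memory} {a r : ℕ} (h : m.real a = m'.real a) :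
    rowVec d m a r = rowVec d m' a r := by unfold rowVec; rw [h]

theorem toMatrix_congr {d : ℕ} {m m' : Memory} {a : ℕ} (h : m.real a = m'.real a) :
    toMatrix d m a = toMatrix d m' a := by unfold toMatrix; rw [h]

/-! ### The least squares problem -/

/-- The unit matrix in array `a`. -/
def setOne (a : ℕ) : ArrayProg :=
  assign a (reg 0) (reg 0) (.ite (num (reg 20)) (num (reg 21))
    (.ite (num (reg 21)) (num (reg 20)) (num (lit 1)) (num (lit 0))) (num (lit 0)))

/-- The data of episode `reg 7` are taken into account. -/
def rankOneUpdate : ArrayProg :=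
  .seq (assign 17 (lit 1) (lit 1) (.ite (num (reg 7)) (num (reg 5))
    (cell 16 (lit 0) (lit 0)) (cell 17 (lit 0) (lit 0)))) <|
  .seq (assign 11 (lit 1) (reg 0) (.sum 22 (reg 0)
    (cell 10 (reg 21) (reg 22) * cell 1 (reg 7) (reg 22)))) <|
  .seq (assign 18 (lit 1) (lit 1) (num (lit 1) + .sum 22 (reg 0)
    (cell 1 (reg 7) (reg 22) * cell 11 (lit 0) (reg 22)))) <|
  .seq (assign 16 (lit 1) (lit 1) (cell 16 (lit 0) (lit 0) * cell 18 (lit 0) (lit 0))) <|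
  .seq (assign 10 (reg 0) (reg 0) (cell 10 (reg 20) (reg 21) -
    cell 11 (lit 0) (reg 20) * cell 11 (lit 0) (reg 21) / cell 18 (lit 0) (lit 0))) <|
  .seq (assign 13 (reg 0) (reg 0) (cell 13 (reg 20) (reg 21) +
    cell 1 (reg 7) (reg 20) * cell 1 (reg 7) (reg 21)))
  (assign 14 (lit 1) (reg 0) (cell 14 (lit 0) (reg 21) +
    cell 2 (reg 7) (lit 0) * cell 1 (reg 7) (reg 21)))

/-- The design matrix (array `13`), its inverse (array `10`), its determinant (array `16`), the
reference determinant (array `17`) and the ridge estimate (array `15`). -/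
def ridgeProg : ArrayProg :=
  .seq (setOne 10) <| .seq (setOne 13) <|
  .seq (assign 14 (lit 1) (reg 0) (num (lit 0))) <|
  .seq (assign 16 (lit 1) (lit 1) (num (lit 1))) <|
  .seq (assign 17 (lit 1) (lit 1) (num (lit 1))) <|
  .seq (loop 7 (reg 4) rankOneUpdate)
  (assign 15 (lit 1) (reg 0) (.sum 22 (reg 0)
    (cell 10 (reg 21) (reg 22) * cell 14 (lit 0) (reg 22))))

/-! ### The relaxations -/

/-- The tolerance `1 / (2 N)`. -/
def tol : SumExp := num (lit 1) / num (mul (lit 2) (reg 6))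

/-- The relaxation for the direction in array `29` and the lower bound in array `28`. -/
def linProg : ArrayProg :=
  .seq (assign 21 (lit 1) (lit 1) (.sum 22 (reg 0)
    (cell 29 (lit 0) (reg 22) * cell 20 (lit 0) (reg 22)))) <|
  .seq (assign 22 (lit 1) (lit 1)
    (.ite (cell 28 (lit 0) (lit 0) - tol) (cell 21 (lit 0) (lit 0))
      (.ite (cell 21 (lit 0) (lit 0)) (num (lit 1) + tol) (num (lit 0))
        ((cell 21 (lit 0) (lit 0) - num (lit 1)) /
          .sum 22 (reg 0) (cell 29 (lit 0) (reg 22) * cell 29 (lit 0) (reg 22))))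
      ((cell 21 (lit 0) (lit 0) - cell 28 (lit 0) (lit 0)) /
          .sum 22 (reg 0) (cell 29 (lit 0) (reg 22) * cell 29 (lit 0) (reg 22)))))
  (assign 20 (lit 1) (reg 0) (cell 20 (lit 0) (reg 21) -
    cell 22 (lit 0) (lit 0) * cell 29 (lit 0) (reg 21)))

/-- The gradient (array `23`) and the value (array `24`) of the quadratic form of the ellipsoid. -/
def ellValueProg : ArrayProg :=
  .seq (assign 23 (lit 1) (reg 0) (.sum 22 (reg 0) (cell 13 (reg 21) (reg 22) *
    (cell 20 (lit 0) (reg 22) - cell 15 (lit 0) (reg 22)))))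
  (assign 24 (lit 1) (lit 1) (.sum 22 (reg 0)
    ((cell 20 (lit 0) (reg 22) - cell 15 (lit 0) (reg 22)) * cell 23 (lit 0) (reg 22))))

/-- The square of the enlarged radius. -/
def radiusSq : SumExp :=
  (cell 3 (lit 0) (lit 0) + tol) * (cell 3 (lit 0) (lit 0) + tol)

/-- The relaxation for the ellipsoid. -/
def ellProg : ArrayProg :=
  .seq ellValueProg <|
  .seq (assign 22 (lit 1) (lit 1) (.ite (cell 24 (lit 0) (lit 0)) radiusSq (num (lit 0))
    ((cell 24 (lit 0) (lit 0) - cell 3 (lit 0) (lit 0) * cell 3 (lit 0) (lit 0)) / num (lit 2) /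
      .sum 22 (reg 0) (cell 23 (lit 0) (reg 22) * cell 23 (lit 0) (reg 22)))))
  (assign 20 (lit 1) (reg 0) (cell 20 (lit 0) (reg 21) -
    cell 22 (lit 0) (lit 0) * cell 23 (lit 0) (reg 21)))

/-- The level `v` of the objective in the round `reg 8` of the outer loop. -/
def level : SumExp := num (reg 8) / num (mul (lit 2) (reg 6)) - num (lit 1)

/-- The index of the initial state and the action `reg 9`. -/
def pairIndex : NExp := add (mul (reg 3) (reg 2)) (reg 9)

def passProg : ArrayProg :=
  .seq (assign 28 (lit 1) (lit 1) (num (lit 0) - num (lit 1))) <|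
  .seq (loop 11 (mul (reg 1) (reg 2))
    (.seq (assign 29 (lit 1) (reg 0) (cell 0 (reg 11) (reg 21))) linProg)) <|
  .seq (assign 28 (lit 1) (lit 1) level) <|
  .seq (assign 29 (lit 1) (reg 0) (cell 0 pairIndex (reg 21))) <|
  .seq linProg ellProg

/-- The value `0` in array `26` if all constraints are satisfied up to the tolerance, otherwise a
positive value. -/
def checkProg : ArrayProg :=
  .seq ellValueProg <|
  .seq (assign 25 (lit 1) (mul (reg 1) (reg 2)) (.sum 22 (reg 0)
    (cell 0 (reg 21) (reg 22) * cell 20 (lit 0) (reg 22)))) <|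
  .seq (assign 21 (lit 1) (lit 1) (.sum 22 (reg 0)
    (cell 0 pairIndex (reg 22) * cell 20 (lit 0) (reg 22))))
  (assign 26 (lit 1) (lit 1)
    (.sum 22 (mul (reg 1) (reg 2))
      (.ite (num (lit 0) - num (lit 1) - tol) (cell 25 (lit 0) (reg 22))
        (.ite (cell 25 (lit 0) (reg 22)) (num (lit 1) + tol) (num (lit 0)) (num (lit 1)))
        (num (lit 1))) +
    .ite (level - tol) (cell 21 (lit 0) (lit 0))
      (.ite (cell 21 (lit 0) (lit 0)) (num (lit 1) + tol) (num (lit 0)) (num (lit 1)))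
      (num (lit 1)) +
    .ite (cell 24 (lit 0) (lit 0)) radiusSq (num (lit 0)) (num (lit 1))))

/-- The solution found is recorded, with its action in array `27` and its parameter in array `4`. -/
def recordProg : ArrayProg :=
  .seq (assign 4 (lit 1) (reg 0) (.ite (cell 26 (lit 0) (lit 0)) (num (lit 0))
    (cell 20 (lit 0) (reg 21)) (cell 4 (lit 0) (reg 21))))
  (assign 27 (lit 1) (lit 1) (.ite (cell 26 (lit 0) (lit 0)) (num (lit 0))
    (num (reg 9)) (cell 27 (lit 0) (lit 0))))

/-- The number `16 N² (k + 1) d + 1` of passes. -/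
def passes : NExp :=
  add (mul (lit 16) (mul (mul (reg 6) (reg 6)) (mul (add (reg 4) (lit 1)) (reg 0)))) (lit 1)

/-- The search for a solution at the level `reg 8` with the action `reg 9`. -/
def searchProg : ArrayProg :=
  .seq (assign 20 (lit 1) (reg 0) (num (lit 0))) <|
  .seq (loop 10 passes passProg) <| .seq checkProg recordProg

def planProg : ArrayProg :=
  .seq (assign 27 (lit 1) (lit 1) (num (lit 0)))
  (loop 8 (add (mul (lit 4) (reg 6)) (lit 1)) (loop 9 (reg 2) searchProg))

def mainProg : ArrayProg := .seq ridgeProg planProg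

theorem mainProg_wellFormed : mainProg.WellFormed := by
  simp [mainProg, planProg, searchProg, passes, recordProg, checkProg, passProg, pairIndex, level,
    ellProg, radiusSq, ellValueProg, linProg, tol, ridgeProg, rankOneUpdate, setOne,
    ArrayProg.WellFormed, SumExp.WellFormed, wellFormed_sub,
    wellFormed_div, wellFormed_num, wellFormed_cell, NExp.ReadsBelow]

/-- The results are moved to the registers `0` and `1`. -/
def episodeProg : Prog :=
  .seq
    (.seq mainProg.compile <|
      .seq (.loop 7 (reg 2) (.ifLe (.entry 27 (lit 0) (lit 0)) (.ofNat (reg 7))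
        (.ifLe (.ofNat (reg 7)) (.entry 27 (lit 0) (lit 0)) (.setNat 8 (reg 7)) .skip) .skip))
      (.ifLe (.ofNat (reg 4)) (.ofNat (lit 0)) (.setNat 9 (lit 1))
        (.ifLe (.mul (.ofNat (lit 2)) (.entry 17 (lit 0) (lit 0))) (.entry 16 (lit 0) (lit 0))
          (.setNat 9 (lit 1)) (.setNat 9 (lit 0)))))
    (.seq (.setNat 0 (reg 9)) (.setNat 1 (reg 8)))

theorem episodeProg_cost : ∃ c : ℕ, ∀ (m : Memory) (B : ℕ), (∀ r < 7, m.nat r ≤ B) → 1 ≤ B →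
    (episodeProg.run m).2 ≤ c * B ^ c := by
  have hG : Prog.Guarded (.seq mainProg.compile <|
      .seq (.loop 7 (reg 2) (.ifLe (.entry 27 (lit 0) (lit 0)) (.ofNat (reg 7))
        (.ifLe (.ofNat (reg 7)) (.entry 27 (lit 0) (lit 0)) (.setNat 8 (reg 7)) .skip) .skip))
      (.ifLe (.ofNat (reg 4)) (.ofNat (lit 0)) (.setNat 9 (lit 1))
        (.ifLe (.mul (.ofNat (lit 2)) (.entry 17 (lit 0) (lit 0))) (.entry 16 (lit 0) (lit 0))
          (.setNat 9 (lit 1)) (.setNat 9 (lit 0))))) := by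
    simp [Prog.Guarded, compile_guarded mainProg_wellFormed, NExp.ReadsBelow]
  obtain ⟨c, hc⟩ := hG.exists_cost_le
  refine ⟨c + 4, fun m B h hB => ?_⟩
  have h1 := hc m B h hB
  have h2 : c * B ^ c ≤ c * B ^ (c + 4) := Nat.mul_le_mul_left _
      (Nat.pow_le_pow_right hB (by omega))
  have h3 : 1 ≤ B ^ (c + 4) := Nat.pow_pos hB
  rw [episodeProg, Prog.run]
  simp only [Prog.run, NExp.cost] at h1 ⊢
  rw [add_mul]
  omega

end RealProgram

namespace RealProgram

open SumExp NExp ArrayProg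

attribute [local simp] SumExp.eval_add SumExp.eval_sub SumExp.eval_mul SumExp.eval_div
  SumExp.eval_num SumExp.eval_cell SumExp.eval_sum SumExp.eval_ite NExp.eval

@[simp] theorem setNat_nat (m : Memory) (i n r : ℕ) :
    (m.setNat i n).nat r = if r = i then n else m.nat r := by
  simp [Memory.setNat, Function.update_apply]

theorem exec_assign (a : ℕ) (n c : NExp) (e : SumExp) (m : Memory) :
    ∃ m', (assign a n c e).exec m = m' ∧ m'.nat = m.nat ∧ (∀ b ≠ a, m'.real b = m.real b) ∧
      ∀ r s, r < n.eval m → s < c.eval m →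
        m'.real a r s = e.eval ((m.setNat 20 r).setNat 21 s) :=
  ⟨_, rfl, rfl, fun b hb => exec_real _ _ (by simpa [arrays] using hb),
    fun r s hr hs => exec_assign_self a n c e m hr hs⟩

theorem rowVec_dotProduct (d : ℕ) (m m' : Memory) (a b r s : ℕ) :
    rowVec d m a r ⬝ᵥ rowVec d m' b s = ∑ t ∈ Finset.range d, m.real a r t * m'.real b s t := by
  rw [Finset.sum_range]; rfl

theorem linProg_exec {d : ℕ} {m : Memory} (hd : m.nat 0 = d) :
    rowVec d (linProg.exec m) 20 0 = linRelax (rowVec d m 29 0) (m.real 28 0 0)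
      (1 / (2 * m.nat 6)) (rowVec d m 20 0) := by
  subst hd
  rw [linProg, exec_seq, exec_seq]
  obtain ⟨m₁, e₁, n₁, r₁, v₁⟩ := exec_assign 21 (lit 1) (lit 1) (.sum 22 (reg 0)
    (cell 29 (lit 0) (reg 22) * cell 20 (lit 0) (reg 22))) m
  rw [e₁]
  have h₁ : m₁.real 21 0 0 = rowVec (m.nat 0) m 29 0 ⬝ᵥ rowVec (m.nat 0) m 20 0 := by
    rw [v₁ 0 0 (by simp) (by simp), rowVec_dotProduct]; simp
  obtain ⟨m₂, e₂, n₂, r₂, v₂⟩ := exec_assign 22 (lit 1) (lit 1)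
    (.ite (cell 28 (lit 0) (lit 0) - tol) (cell 21 (lit 0) (lit 0))
      (.ite (cell 21 (lit 0) (lit 0)) (num (lit 1) + tol) (num (lit 0))
        ((cell 21 (lit 0) (lit 0) - num (lit 1)) /
          .sum 22 (reg 0) (cell 29 (lit 0) (reg 22) * cell 29 (lit 0) (reg 22))))
      ((cell 21 (lit 0) (lit 0) - cell 28 (lit 0) (lit 0)) /
          .sum 22 (reg 0) (cell 29 (lit 0) (reg 22) * cell 29 (lit 0) (reg 22)))) m₁
  rw [e₂]
  have h₂ : m₂.real 22 0 0 = linStep (rowVec (m.nat 0) m 29 0) (m.real 28 0 0)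
      (1 / (2 * m.nat 6)) (rowVec (m.nat 0) m 20 0) := by
    rw [v₂ 0 0 (by simp) (by simp), linStep, rowVec_dotProduct (m.nat 0) m m 29 29]
    simp [tol, h₁, r₁ 28, r₁ 29, n₁]
  funext j
  have hj : (j : ℕ) < (reg 0).eval m₂ := by simp [n₂, n₁]
  rw [rowVec, exec_assign_self _ _ _ _ _ (by simp) hj]
  simp [h₂, r₂ 20, r₁ 20, r₂ 29, r₁ 29, linRelax, rowVec]

theorem ellValueProg_exec {d : ℕ} {m : Memory} (hd : m.nat 0 = d) :
    rowVec d (ellValueProg.exec m) 23 0 =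
      toMatrix d m 13 *ᵥ (rowVec d m 20 0 - rowVec d m 15 0) ∧
    (ellValueProg.exec m).real 24 0 0 = (rowVec d m 20 0 - rowVec d m 15 0) ⬝ᵥ
      (toMatrix d m 13 *ᵥ (rowVec d m 20 0 - rowVec d m 15 0)) := by
  subst hd
  rw [ellValueProg, exec_seq]
  obtain ⟨m₁, e₁, n₁, r₁, v₁⟩ := exec_assign 23 (lit 1) (reg 0) (.sum 22 (reg 0)
    (cell 13 (reg 21) (reg 22) * (cell 20 (lit 0) (reg 22) - cell 15 (lit 0) (reg 22)))) m
  rw [e₁]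
  have h₁ : rowVec (m.nat 0) m₁ 23 0 = toMatrix (m.nat 0) m 13 *ᵥ
      (rowVec (m.nat 0) m 20 0 - rowVec (m.nat 0) m 15 0) := by
    funext j
    rw [rowVec, v₁ 0 j (by simp) (by simp), mulVec, dotProduct]
    simp [toMatrix, rowVec, Finset.sum_range]
  refine ⟨?_, ?_⟩
  · rw [← h₁]
    exact rowVec_congr (exec_real _ _ (by simp [arrays]))
  · rw [exec_assign_self _ _ _ _ _ (by simp) (by simp), ← h₁]
    simp [rowVec, Finset.sum_range, dotProduct, n₁, r₁ 20, r₁ 15]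

theorem ellProg_exec {d : ℕ} {m : Memory} (hd : m.nat 0 = d) :
    rowVec d (ellProg.exec m) 20 0 = ellRelax (toMatrix d m 13) (rowVec d m 15 0) (m.real 3 0 0)
      (1 / (2 * m.nat 6)) (rowVec d m 20 0) := by
  subst hd
  rw [ellProg, exec_seq, exec_seq]
  obtain ⟨hg, hq⟩ := ellValueProg_exec (m := m) rfl
  have hn : (ellValueProg.exec m).nat = m.nat := rfl
  have hr : ∀ b, b ≠ 23 → b ≠ 24 → (ellValueProg.exec m).real b = m.real b := fun b h1 h2 =>
    exec_real _ _ (by simp [ellValueProg, arrays, h1, h2])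
  set m₁ := ellValueProg.exec m
  obtain ⟨m₂, e₂, n₂, r₂, v₂⟩ := exec_assign 22 (lit 1) (lit 1)
    (.ite (cell 24 (lit 0) (lit 0)) radiusSq (num (lit 0))
    ((cell 24 (lit 0) (lit 0) - cell 3 (lit 0) (lit 0) * cell 3 (lit 0) (lit 0)) / num (lit 2) /
      .sum 22 (reg 0) (cell 23 (lit 0) (reg 22) * cell 23 (lit 0) (reg 22)))) m₁
  rw [e₂]
  have h₂ : m₂.real 22 0 0 = ellStep (toMatrix (m.nat 0) m 13) (rowVec (m.nat 0) m 15 0)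
      (m.real 3 0 0) (1 / (2 * m.nat 6)) (rowVec (m.nat 0) m 20 0) := by
    rw [v₂ 0 0 (by simp) (by simp), ellStep, ← hq, ← hg, rowVec_dotProduct (m.nat 0) m₁ m₁ 23 23]
    simp [radiusSq, tol, hr 3, hn, sq]
  funext j
  have hj : (j : ℕ) < (reg 0).eval m₂ := by simp [n₂, hn]
  rw [rowVec, exec_assign_self _ _ _ _ _ (by simp) hj]
  simp only [ellRelax, ← hg, ← h₂]
  simp [r₂ 20, hr 20, r₂ 23, rowVec]

/-- The memory holds the data of a planning problem. -/
structure PlanData (d nS nA s k N : ℕ) (F : ℕ → Fin d → ℝ) (G : Matrix (Fin d) (Fin d) ℝ)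
    (c : Fin d → ℝ) (R : ℝ) (m : Memory) : Prop where
  dim : m.nat 0 = d
  states : m.nat 1 = nS
  actions : m.nat 2 = nA
  initial : m.nat 3 = s
  past : m.nat 4 = k
  accuracy : m.nat 6 = N
  features : ∀ i < nS * nA, rowVec d m 0 i = F i
  matrix : toMatrix d m 13 = G
  center : rowVec d m 15 0 = c
  radius : m.real 3 0 0 = R

variable {d nS nA s k N : ℕ} {F : ℕ → Fin d → ℝ} {G : Matrix (Fin d) (Fin d) ℝ}
  {c : Fin d → ℝ} {R : ℝ} {m : Memory}

theorem PlanData.congr {m' : Memory} (h : PlanData d nS nA s k N F G c R m)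
    (hn : ∀ r < 7, m'.nat r = m.nat r) (h0 : m'.real 0 = m.real 0) (h3 : m'.real 3 = m.real 3)
    (h13 : m'.real 13 = m.real 13) (h15 : m'.real 15 = m.real 15) :
    PlanData d nS nA s k N F G c R m' where
  dim := by rw [hn 0 (by norm_num), h.dim]
  states := by rw [hn 1 (by norm_num), h.states]
  actions := by rw [hn 2 (by norm_num), h.actions]
  initial := by rw [hn 3 (by norm_num), h.initial]
  past := by rw [hn 4 (by norm_num), h.past]
  accuracy := by rw [hn 6 (by norm_num), h.accuracy]
  features i hi := by rw [rowVec_congr h0, h.features i hi]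
  matrix := by rw [toMatrix_congr h13, h.matrix]
  center := by rw [rowVec_congr h15, h.center]
  radius := by rw [h3, h.radius]

theorem PlanData.setNat (h : PlanData d nS nA s k N F G c R m) {i : ℕ} (hi : 7 ≤ i) (t : ℕ) :
    PlanData d nS nA s k N F G c R (m.setNat i t) :=
  h.congr (fun r hr => setNat_nat_of_ne _ _ (by omega)) rfl rfl rfl rfl

theorem PlanData.exec (h : PlanData d nS nA s k N F G c R m) (p : ArrayProg)
    (hp : (∀ r < 7, r ∉ p.counters) ∧ 0 ∉ p.arrays ∧ 3 ∉ p.arrays ∧ 13 ∉ p.arrays ∧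
      15 ∉ p.arrays) : PlanData d nS nA s k N F G c R (p.exec m) :=
  h.congr (fun r hr => exec_nat p m (hp.1 r hr)) (exec_real p m hp.2.1) (exec_real p m hp.2.2.1)
    (exec_real p m hp.2.2.2.1) (exec_real p m hp.2.2.2.2)

theorem passProg_exec (h : PlanData d nS nA s k N F G c R m)
    (ha : s * nA + m.nat 9 < nS * nA) :
    rowVec d (passProg.exec m) 20 0 = relaxPass F (nS * nA) (F (s * nA + m.nat 9))
      ((m.nat 8 : ℝ) / (2 * N) - 1) G c R (1 / (2 * N)) (rowVec d m 20 0) := by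
  rw [passProg, exec_seq, exec_seq, exec_seq, exec_seq, exec_seq]
  obtain ⟨m₁, e₁, n₁, r₁, v₁⟩ := exec_assign 28 (lit 1) (lit 1) (num (lit 0) - num (lit 1)) m
  have D₁ : PlanData d nS nA s k N F G c R m₁ :=
    e₁ ▸ h.exec _ (by simp [counters, arrays])
  have v₁ : m₁.real 28 0 0 = -1 := by rw [v₁ 0 0 (by simp) (by simp)]; simp
  rw [e₁]
  obtain ⟨m₂, e₂⟩ : ∃ m₂, (loop 11 (NExp.mul (reg 1) (reg 2)) (.seq
    (assign 29 (lit 1) (reg 0) (cell 0 (reg 11) (reg 21))) linProg)).exec m₁ = m₂ := ⟨_, rfl⟩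
  have hL := exec_loop_induction (i := 11) (e := NExp.mul (reg 1) (reg 2)) (m := m₁) (p := .seq
    (assign 29 (lit 1) (reg 0) (cell 0 (reg 11) (reg 21))) linProg)
    (fun n m' => PlanData d nS nA s k N F G c R m' ∧ m'.real 28 0 0 = -1 ∧ m'.nat 8 = m.nat 8 ∧
      m'.nat 9 = m.nat 9 ∧ rowVec d m' 20 0 =
        relaxSweep (fun i => linRelax (F i) (-1) (1 / (2 * N))) n (rowVec d m 20 0))
    ⟨D₁, v₁, by rw [n₁], by rw [n₁], rowVec_congr (r₁ 20 (by norm_num))⟩ (by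
      rintro n hn m' ⟨g1, g2, g3, g4, g5⟩
      have hn' : n < nS * nA := by simpa [D₁.states, D₁.actions] using hn
      have g1' := g1.setNat (i := 11) (by norm_num) n
      refine ⟨g1'.exec _ (by simp [counters, arrays, linProg]), ?_, ?_, ?_, ?_⟩
      · rw [exec_real _ _ (by simp [arrays, linProg])]; exact g2
      · rw [exec_nat _ _ (by simp [counters, linProg])]; simpa using g3
      · rw [exec_nat _ _ (by simp [counters, linProg])]; simpa using g4
      · rw [exec_seq]
        obtain ⟨m₃, e₃, n₃, r₃, v₃⟩ := exec_assign 29 (lit 1) (reg 0) (cell 0 (reg 11) (reg 21))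
          (m'.setNat 11 n)
        have D₃ : PlanData d nS nA s k N F G c R m₃ :=
          e₃ ▸ g1'.exec _ (by simp [counters, arrays])
        rw [e₃, linProg_exec D₃.dim, rowVec_congr (r₃ 20 (by norm_num)), r₃ 28 (by norm_num),
          D₃.accuracy]
        have hrow : rowVec d m₃ 29 0 = F n := by
          rw [← g1.features n hn']
          funext j
          rw [rowVec, v₃ 0 j (by simp) (by simp [g1.dim])]
          simp [rowVec]
        rw [hrow, setNat_real, g2, rowVec_congr (congrFun (setNat_real m' 11 n) 20), g5]
        rfl)
  rw [e₂] at hL ⊢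
  have hT : (NExp.mul (reg 1) (reg 2)).eval m₁ = nS * nA := by simp [D₁.states, D₁.actions]
  rw [hT] at hL
  obtain ⟨D₂, -, q8, q9, q20⟩ := hL
  obtain ⟨m₃, e₃, n₃, r₃, v₃⟩ := exec_assign 28 (lit 1) (lit 1) level m₂
  have D₃ : PlanData d nS nA s k N F G c R m₃ := e₃ ▸ D₂.exec _ (by simp [counters, arrays])
  have v₃ : m₃.real 28 0 0 = (m.nat 8 : ℝ) / (2 * N) - 1 := by
    rw [v₃ 0 0 (by simp) (by simp)]; simp [level, q8, D₂.accuracy]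
  rw [e₃]
  obtain ⟨m₄, e₄, n₄, r₄, v₄⟩ := exec_assign 29 (lit 1) (reg 0) (cell 0 pairIndex (reg 21)) m₃
  have D₄ : PlanData d nS nA s k N F G c R m₄ := e₄ ▸ D₃.exec _ (by simp [counters, arrays])
  have v₄ : rowVec d m₄ 29 0 = F (s * nA + m.nat 9) := by
    rw [← D₃.features _ ha]
    funext j
    rw [rowVec, v₄ 0 j (by simp) (by simp [D₃.dim])]
    simp [rowVec, pairIndex, D₃.initial, D₃.actions, n₃, q9]
  rw [e₄]
  have D₅ : PlanData d nS nA s k N F G c R (linProg.exec m₄) :=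
    D₄.exec _ (by simp [counters, arrays, linProg])
  rw [ellProg_exec D₅.dim, D₅.matrix, D₅.center, D₅.radius, D₅.accuracy, linProg_exec D₄.dim, v₄,
    r₄ 28 (by norm_num), v₃, D₄.accuracy, rowVec_congr (r₄ 20 (by norm_num)),
    rowVec_congr (r₃ 20 (by norm_num)), q20]
  rfl

theorem checkProg_exec (h : PlanData d nS nA s k N F G c R m)
    (ha : s * nA + m.nat 9 < nS * nA) :
    (checkProg.exec m).real 26 0 0 ≤ 0 ↔ PassSat F (nS * nA) (F (s * nA + m.nat 9))
      ((m.nat 8 : ℝ) / (2 * N) - 1) G c R (1 / (2 * N)) (rowVec d m 20 0) := by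
  rw [checkProg, exec_seq, exec_seq, exec_seq]
  have h24 := (ellValueProg_exec (m := m) h.dim).2
  rw [h.matrix, h.center] at h24
  have D₁ : PlanData d nS nA s k N F G c R (ellValueProg.exec m) :=
    h.exec _ (by simp [counters, arrays, ellValueProg])
  have h20 : (ellValueProg.exec m).real 20 = m.real 20 :=
    exec_real _ _ (by simp [ellValueProg, arrays])
  have hn : (ellValueProg.exec m).nat = m.nat := rfl
  set m₁ := ellValueProg.exec m
  obtain ⟨m₂, e₂, n₂, r₂, v₂⟩ := exec_assign 25 (lit 1) (NExp.mul (reg 1) (reg 2)) (.sum 22 (reg 0)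
    (cell 0 (reg 21) (reg 22) * cell 20 (lit 0) (reg 22))) m₁
  have D₂ : PlanData d nS nA s k N F G c R m₂ := e₂ ▸ D₁.exec _ (by simp [counters, arrays])
  have v₂ : ∀ i < nS * nA, m₂.real 25 0 i = F i ⬝ᵥ rowVec d m 20 0 := by
    intro i hi
    rw [v₂ 0 i (by simp) (by simpa [D₁.states, D₁.actions] using hi), ← D₁.features i hi,
      rowVec_dotProduct]
    simp [D₁.dim, h20]
  rw [e₂]
  obtain ⟨m₃, e₃, n₃, r₃, v₃⟩ := exec_assign 21 (lit 1) (lit 1) (.sum 22 (reg 0)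
    (cell 0 pairIndex (reg 22) * cell 20 (lit 0) (reg 22))) m₂
  have D₃ : PlanData d nS nA s k N F G c R m₃ := e₃ ▸ D₂.exec _ (by simp [counters, arrays])
  have v₃ : m₃.real 21 0 0 = F (s * nA + m.nat 9) ⬝ᵥ rowVec d m 20 0 := by
    rw [v₃ 0 0 (by simp) (by simp), ← D₂.features _ ha, rowVec_dotProduct]
    simp [D₂.dim, pairIndex, D₂.initial, D₂.actions, n₂, hn, r₂ 20, h20]
  rw [e₃, exec_assign_self _ _ _ _ _ (by simp) (by simp)]
  have hr25 : m₃.real 25 = m₂.real 25 := r₃ 25 (by norm_num)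
  have hr24 : m₃.real 24 0 0 = m₁.real 24 0 0 := by rw [r₃ 24 (by norm_num), r₂ 24 (by norm_num)]
  have h8 : m₃.nat 8 = m.nat 8 := by rw [n₃, n₂, hn]
  simp [tol, level, radiusSq, D₃.states, D₃.actions, D₃.accuracy, h8, hr25, hr24, h24, v₃,
    D₃.radius]
  have hind : ∀ (p q : Prop) [Decidable p] [Decidable q],
      (if p then if q then (0 : ℝ) else 1 else 1) = if p ∧ q then 0 else 1 := by
    intro p q _ _
    by_cases hp : p <;> simp [hp]
  have hnn : ∀ (p : Prop) [Decidable p], 0 ≤ (if p then (0 : ℝ) else 1) := by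
    intro p _
    split_ifs <;> norm_num
  have hz : ∀ (p : Prop) [Decidable p], (if p then (0 : ℝ) else 1) = 0 ↔ p := by
    intro p _
    by_cases hp : p <;> simp [hp]
  have hsum : ∀ x y z : ℝ, 0 ≤ x → 0 ≤ y → 0 ≤ z → (x + y + z ≤ 0 ↔ (x = 0 ∧ y = 0) ∧ z = 0) := by
    intro x y z hx hy hz
    exact ⟨fun h => ⟨⟨by linarith, by linarith⟩, by linarith⟩,
      fun h => by rw [h.1.1, h.1.2, h.2]; norm_num⟩
  simp only [hind]
  rw [hsum _ _ _ (Finset.sum_nonneg fun _ _ => hnn _) (hnn _) (hnn _), hz, hz,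
    Finset.sum_eq_zero_iff_of_nonneg fun _ _ => hnn _]
  simp only [hz, Finset.mem_range, PassSat, LinSat, EllSat]
  refine and_congr (and_congr (forall₂_congr fun i hi => ?_) ?_) ?_
  · rw [v₂ i hi, sub_le_iff_le_add]
  · rw [sub_le_iff_le_add, sub_le_iff_le_add, add_right_comm]
  · rw [sub_dotProduct, sub_le_iff_le_add, sq]

theorem searchProg_exec (h : PlanData d nS nA s k N F G c R m)
    (ha : s * nA + m.nat 9 < nS * nA) {f : (Fin d → ℝ) → Fin d → ℝ}
    (hf : f = relaxPass F (nS * nA) (F (s * nA + m.nat 9)) ((m.nat 8 : ℝ) / (2 * N) - 1) G c R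
      (1 / (2 * N))) {θ : Fin d → ℝ} (hθ : θ = f^[16 * (N * N * ((k + 1) * d)) + 1] 0) :
    (PassSat F (nS * nA) (F (s * nA + m.nat 9)) ((m.nat 8 : ℝ) / (2 * N) - 1) G c R (1 / (2 * N))
        θ ∧ rowVec d (searchProg.exec m) 4 0 = θ ∧ (searchProg.exec m).real 27 0 0 = m.nat 9) ∨
    (¬ PassSat F (nS * nA) (F (s * nA + m.nat 9)) ((m.nat 8 : ℝ) / (2 * N) - 1) G c R (1 / (2 * N))
        θ ∧ rowVec d (searchProg.exec m) 4 0 = rowVec d m 4 0 ∧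
        (searchProg.exec m).real 27 0 0 = m.real 27 0 0) := by
  rw [searchProg, exec_seq, exec_seq, exec_seq]
  obtain ⟨m₁, e₁, n₁, r₁, v₁⟩ := exec_assign 20 (lit 1) (reg 0) (num (lit 0)) m
  have D₁ : PlanData d nS nA s k N F G c R m₁ := e₁ ▸ h.exec _ (by simp [counters, arrays])
  have v₁ : rowVec d m₁ 20 0 = 0 := by
    funext j
    rw [rowVec, v₁ 0 j (by simp) (by simp [h.dim])]
    simp
  rw [e₁]
  obtain ⟨m₂, e₂⟩ : ∃ m₂, (loop 10 passes passProg).exec m₁ = m₂ := ⟨_, rfl⟩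
  have hL := exec_loop_induction (i := 10) (e := passes) (m := m₁) (p := passProg)
    (fun n m' => PlanData d nS nA s k N F G c R m' ∧ m'.nat 8 = m.nat 8 ∧ m'.nat 9 = m.nat 9 ∧
      m'.real 4 = m.real 4 ∧ m'.real 27 = m.real 27 ∧ rowVec d m' 20 0 = f^[n] 0)
    ⟨D₁, by rw [n₁], by rw [n₁], r₁ 4 (by norm_num), r₁ 27 (by norm_num), v₁⟩ (by
      rintro n - m' ⟨g1, g2, g3, g4, g5, g6⟩
      have g1' := g1.setNat (i := 10) (by norm_num) n
      have c1 : ∀ r < 7, r ∉ passProg.counters := by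
        simp [passProg, counters, linProg, ellProg, ellValueProg]
        omega
      refine ⟨g1'.exec _ ⟨c1, by simp [passProg, arrays, linProg, ellProg, ellValueProg]⟩,
        ?_, ?_, ?_, ?_, ?_⟩
      · rw [exec_nat _ _ (by simp [passProg, counters, linProg, ellProg, ellValueProg])]
        simpa using g2
      · rw [exec_nat _ _ (by simp [passProg, counters, linProg, ellProg, ellValueProg])]
        simpa using g3
      · rw [exec_real _ _ (by simp [passProg, arrays, linProg, ellProg, ellValueProg])]
        exact g4
      · rw [exec_real _ _ (by simp [passProg, arrays, linProg, ellProg, ellValueProg])]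
        exact g5
      · have h9 : (m'.setNat 10 n).nat 9 = m.nat 9 := by simpa using g3
        have h8 : (m'.setNat 10 n).nat 8 = m.nat 8 := by simpa using g2
        rw [passProg_exec g1' (by rw [h9]; exact ha), h9, h8, ← hf,
          rowVec_congr (congrFun (setNat_real m' 10 n) 20), g6, Function.iterate_succ_apply'])
  have hT : passes.eval m₁ = 16 * (N * N * ((k + 1) * d)) + 1 := by
    simp [passes, D₁.accuracy, D₁.past, D₁.dim]
  rw [e₂, hT] at hL
  rw [e₂]
  obtain ⟨D₂, h8, h9, q4, q27, q20⟩ := hL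
  rw [← hθ] at q20
  have hc := checkProg_exec D₂ (by rw [h9]; exact ha)
  rw [h8, h9, q20] at hc
  have D₃ : PlanData d nS nA s k N F G c R (checkProg.exec m₂) :=
    D₂.exec _ (by simp [checkProg, counters, arrays, ellValueProg])
  have p20 : (checkProg.exec m₂).real 20 = m₂.real 20 :=
    exec_real _ _ (by simp [checkProg, arrays, ellValueProg])
  have p4 : (checkProg.exec m₂).real 4 = m₂.real 4 :=
    exec_real _ _ (by simp [checkProg, arrays, ellValueProg])
  have p27 : (checkProg.exec m₂).real 27 = m₂.real 27 :=
    exec_real _ _ (by simp [checkProg, arrays, ellValueProg])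
  have p9 : (checkProg.exec m₂).nat 9 = m.nat 9 := h9
  set m₃ := checkProg.exec m₂
  rw [recordProg, exec_seq]
  obtain ⟨m₄, e₄, n₄, r₄, v₄⟩ := exec_assign 4 (lit 1) (reg 0)
    (.ite (cell 26 (lit 0) (lit 0)) (num (lit 0)) (cell 20 (lit 0) (reg 21))
      (cell 4 (lit 0) (reg 21))) m₃
  rw [e₄]
  have f4 : ∀ j : Fin d, ((assign 27 (lit 1) (lit 1) (.ite (cell 26 (lit 0) (lit 0)) (num (lit 0))
      (num (reg 9)) (cell 27 (lit 0) (lit 0)))).exec m₄).real 4 0 j =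
      if m₃.real 26 0 0 ≤ 0 then m₂.real 20 0 j else m.real 4 0 j := by
    intro j
    rw [exec_real _ _ (by simp [arrays]), v₄ 0 j (by simp) (by simp [D₃.dim])]
    simp [p20, p4, q4]
  have f27 : ((assign 27 (lit 1) (lit 1) (.ite (cell 26 (lit 0) (lit 0)) (num (lit 0))
      (num (reg 9)) (cell 27 (lit 0) (lit 0)))).exec m₄).real 27 0 0 =
      if m₃.real 26 0 0 ≤ 0 then (m.nat 9 : ℝ) else m.real 27 0 0 := by
    rw [exec_assign_self _ _ _ _ _ (by simp) (by simp)]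
    simp [r₄ 26, r₄ 27, n₄, p9, p27, q27]
  by_cases hsat : m₃.real 26 0 0 ≤ 0
  · refine Or.inl ⟨hc.1 hsat, ?_, by rw [f27, if_pos hsat]⟩
    funext j
    rw [rowVec, f4, if_pos hsat, ← q20]
    rfl
  · refine Or.inr ⟨fun h => hsat (hc.2 h), ?_, by rw [f27, if_neg hsat]⟩
    funext j
    rw [rowVec, f4, if_neg hsat]
    rfl

/-- The recorded solution is feasible up to the tolerance and optimal up to twice the tolerance. -/
theorem planProg_exec (h : PlanData d nS nA s k N F G c R m) (hs : s < nS) (hN : 1 ≤ N)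
    (hG : G.PosDef) (hGκ : ∀ y, (G *ᵥ y) ⬝ᵥ (G *ᵥ y) ≤ ((k : ℝ) + 1) * (y ⬝ᵥ (G *ᵥ y)))
    (hR : 0 ≤ R) (hF : ∀ i < nS * nA, F i ⬝ᵥ F i ≤ 1) {z : Fin d → ℝ} (hzd : z ⬝ᵥ z ≤ d)
    (hFz : ∀ i < nS * nA, |F i ⬝ᵥ z| ≤ 1) (hz : (z - c) ⬝ᵥ (G *ᵥ (z - c)) ≤ R ^ 2)
    {b : ℕ} (hb : b < nA) :
    ∃ a < nA, (planProg.exec m).real 27 0 0 = a ∧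
      (∀ i < nS * nA, LinSat (F i) (-1) (1 / (2 * N)) (rowVec d (planProg.exec m) 4 0)) ∧
      EllSat G c R (1 / (2 * N)) (rowVec d (planProg.exec m) 4 0) ∧
      F (s * nA + b) ⬝ᵥ z ≤ F (s * nA + a) ⬝ᵥ rowVec d (planProg.exec m) 4 0 + 1 / N := by
  have hN' : (0 : ℝ) < N := by exact_mod_cast hN
  have hε : (0 : ℝ) < 1 / (2 * N) := by positivity
  have hpair : ∀ a < nA, s * nA + a < nS * nA := fun a ha => by
    have : (s + 1) * nA ≤ nS * nA := Nat.mul_le_mul_right _ hs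
    rw [add_mul, one_mul] at this
    omega
  set v := F (s * nA + b) ⬝ᵥ z with hv
  have hvb := abs_le.1 (hFz _ (hpair b hb))
  rw [← hv] at hvb
  set l := ⌊(v + 1) * (2 * N)⌋₊ with hl
  have hl0 : 0 ≤ (v + 1) * (2 * N) := mul_nonneg (by linarith) (by positivity)
  have hl1 : (l : ℝ) / (2 * N) - 1 ≤ v := by
    have := Nat.floor_le hl0
    rw [sub_le_iff_le_add, div_le_iff₀ (by positivity)]
    exact this
  have hl2 : ∀ j : ℕ, l ≤ j → v ≤ (j : ℝ) / (2 * N) - 1 + 1 / (2 * N) := by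
    intro j hj
    have h1 := (Nat.lt_floor_add_one ((v + 1) * (2 * N))).le
    have h2 : (l : ℝ) ≤ j := by exact_mod_cast hj
    have h3 : v + 1 ≤ ((j : ℝ) + 1) / (2 * N) := by
      rw [le_div_iff₀ (by positivity)]
      rw [← hl] at h1
      linarith
    rw [add_div] at h3
    linarith
  have hl4 : l < 4 * N + 1 := by
    have h1 := Nat.floor_le hl0
    have h2 : (l : ℝ) ≤ (4 * N : ℕ) := by
      push_cast
      nlinarith
    have : l ≤ 4 * N := by exact_mod_cast h2
    omega
  let Rec : Memory → Prop := fun m' => ∃ j, l ≤ j ∧ ∃ a < nA, m'.real 27 0 0 = a ∧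
    PassSat F (nS * nA) (F (s * nA + a)) ((j : ℝ) / (2 * N) - 1) G c R (1 / (2 * N))
      (rowVec d m' 4 0)
  have hfinal : ∀ m', Rec m' → ∃ a < nA, m'.real 27 0 0 = a ∧
      (∀ i < nS * nA, LinSat (F i) (-1) (1 / (2 * N)) (rowVec d m' 4 0)) ∧
      EllSat G c R (1 / (2 * N)) (rowVec d m' 4 0) ∧
      v ≤ F (s * nA + a) ⬝ᵥ rowVec d m' 4 0 + 1 / N := by
    rintro m' ⟨j, hj, a, ha, h27, hsat⟩
    refine ⟨a, ha, h27, hsat.1.1, hsat.2, ?_⟩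
    have h1 := hsat.1.2.1
    have h2 := hl2 j hj
    have h3 : (1 : ℝ) / N = 1 / (2 * N) + 1 / (2 * N) := by field_simp; norm_num
    linarith
  apply hfinal
  have hstep : ∀ m', PlanData d nS nA s k N F G c R m' → m'.nat 9 < nA →
      Rec m' ∨ (m'.nat 8 = l ∧ m'.nat 9 = b) → l ≤ m'.nat 8 → Rec (searchProg.exec m') := by
      intro m' D h9 hor hle
      rcases searchProg_exec D (hpair _ h9) rfl rfl with ⟨h1, h2, h3⟩ | ⟨h1, h2, h3⟩
      · exact ⟨_, hle, _, h9, h3, by rw [h2]; exact h1⟩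
      · rcases hor with ⟨j, hj, a, ha, h27, hsat⟩ | ⟨e8, e9⟩
        · exact ⟨j, hj, a, ha, by rw [h3]; exact h27, by rw [h2]; exact hsat⟩
        · exfalso
          apply h1
          rw [e8, e9]
          have hrel := isRelaxation_relaxPass (F := F) (n := nS * nA) (a := F (s * nA + b))
            (l := (l : ℝ) / (2 * N) - 1) hG hR hε (by linarith [(Nat.cast_nonneg k : (0 : ℝ) ≤ k)])
            hGκ hF hFz (hF _ (hpair b hb)) hl1 hvb.2 hz
          refine hrel.sat_iterate (lt_of_le_of_lt hzd ?_)
          push_cast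
          have hk : (0 : ℝ) < (k : ℝ) + 1 := by positivity
          have e : (16 * ((N : ℝ) * N * ((k + 1) * d)) + 1) *
              ((1 / (2 * N)) ^ 2 / (4 * ((k : ℝ) + 1))) =
              d + (1 / (2 * N)) ^ 2 / (4 * ((k : ℝ) + 1)) := by
            field_simp
            ring
          rw [e]
          have : (0 : ℝ) < (1 / (2 * N)) ^ 2 / (4 * ((k : ℝ) + 1)) := by positivity
          linarith
  have cs : ∀ r ∈ searchProg.counters, r = 10 ∨ r = 11 := by
    simp [searchProg, passProg, checkProg, recordProg, counters, linProg, ellProg, ellValueProg]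
  have as : 0 ∉ searchProg.arrays ∧ 3 ∉ searchProg.arrays ∧ 13 ∉ searchProg.arrays ∧
      15 ∉ searchProg.arrays := by
    simp [searchProg, passProg, checkProg, recordProg, arrays, linProg, ellProg, ellValueProg]
  have hD : ∀ m', PlanData d nS nA s k N F G c R m' →
      PlanData d nS nA s k N F G c R (searchProg.exec m') := fun m' D =>
    D.exec _ ⟨fun r hr hr' => by rcases cs r hr' with h | h <;> omega, as⟩
  have h8 : ∀ m', (searchProg.exec m').nat 8 = m'.nat 8 := fun m' =>
    exec_nat _ _ fun hr => by rcases cs 8 hr with h | h <;> omega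
  rw [planProg, exec_seq]
  have D₁ : PlanData d nS nA s k N F G c R
      ((assign 27 (lit 1) (lit 1) (num (lit 0))).exec m) := h.exec _ (by simp [counters, arrays])
  set m₁ := (assign 27 (lit 1) (lit 1) (num (lit 0))).exec m
  have houter := exec_loop_induction (i := 8) (e := NExp.add (NExp.mul (lit 4) (reg 6)) (lit 1))
    (p := loop 9 (reg 2) searchProg) (m := m₁)
    (fun n m' => PlanData d nS nA s k N F G c R m' ∧ (l < n → Rec m'))
    ⟨D₁, fun h => absurd h (Nat.not_lt_zero _)⟩ (by
      rintro n - m' ⟨D, hrec⟩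
      have D' := D.setNat (i := 8) (by norm_num) n
      have hinner := exec_loop_induction (i := 9) (e := reg 2) (p := searchProg)
        (m := m'.setNat 8 n)
        (fun a m'' => PlanData d nS nA s k N F G c R m'' ∧ m''.nat 8 = n ∧
          (l < n ∨ (l = n ∧ b < a) → Rec m''))
        ⟨D', by simp, fun h => by
          rcases h with h | h
          · exact hrec h
          · exact absurd h.2 (Nat.not_lt_zero _)⟩ (by
          rintro a ha m'' ⟨E, e8, hr⟩
          have ha' : a < nA := by
            have : (reg 2).eval (m'.setNat 8 n) = nA := by simp [D.actions]
            omega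
          have E' := E.setNat (i := 9) (by norm_num) a
          have e9 : (m''.setNat 9 a).nat 9 = a := by simp
          have e8' : (m''.setNat 9 a).nat 8 = n := by simpa using e8
          refine ⟨hD _ E', by rw [h8, e8'], fun hcond => ?_⟩
          refine hstep _ E' (by rw [e9]; exact ha') ?_ (by rw [e8']; omega)
          by_cases hc : l < n ∨ (l = n ∧ b < a)
          · exact Or.inl (hr hc)
          · refine Or.inr ⟨by rw [e8']; omega, by rw [e9]; omega⟩)
      have hA : (reg 2).eval (m'.setNat 8 n) = nA := by simp [D.actions]
      rw [hA] at hinner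
      obtain ⟨E, -, hr⟩ := hinner
      exact ⟨E, fun hln => hr (by omega)⟩)
  have hLev : (NExp.add (NExp.mul (lit 4) (reg 6)) (lit 1)).eval m₁ = 4 * N + 1 := by
    simp [D₁.accuracy]
  rw [hLev] at houter
  exact houter.2 hl4

end RealProgram

namespace RealProgram

open SumExp NExp ArrayProg LinearBandit

/-- The memory holds the data of the least squares problem of episode `k`. -/
structure RidgeData (d k ref : ℕ) (X : ℕ → Fin d → ℝ) (Y : ℕ → ℝ) (m : Memory) : Prop where
  dim : m.nat 0 = d
  past : m.nat 4 = k
  ref : m.nat 5 = ref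
  visited : ∀ τ < k, rowVec d m 1 τ = X τ
  rewards : ∀ τ < k, m.real 2 τ 0 = Y τ

/-- The quantities of the least squares problem after `n` episodes. -/
structure RidgeState (d ref : ℕ) (X : ℕ → Fin d → ℝ) (Y : ℕ → ℝ) (n : ℕ) (m : Memory) :
    Prop where
  inverse : toMatrix d m 10 = (design 1 X n)⁻¹
  matrix : toMatrix d m 13 = design 1 X n
  vector : rowVec d m 14 0 = ∑ τ ∈ Finset.range n, Y τ • X τ
  det : m.real 16 0 0 = (design 1 X n).det
  det_ref : m.real 17 0 0 = (design 1 X (min ref (n - 1))).det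

variable {d k ref : ℕ} {X : ℕ → Fin d → ℝ} {Y : ℕ → ℝ} {m : Memory}

theorem RidgeData.exec (h : RidgeData d k ref X Y m) (p : ArrayProg)
    (hp : 0 ∉ p.counters ∧ 4 ∉ p.counters ∧ 5 ∉ p.counters ∧ 1 ∉ p.arrays ∧ 2 ∉ p.arrays) :
    RidgeData d k ref X Y (p.exec m) where
  dim := by rw [exec_nat _ _ hp.1, h.dim]
  past := by rw [exec_nat _ _ hp.2.1, h.past]
  ref := by rw [exec_nat _ _ hp.2.2.1, h.ref]
  visited τ hτ := by rw [rowVec_congr (exec_real _ _ hp.2.2.2.1), h.visited τ hτ]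
  rewards τ hτ := by rw [exec_real _ _ hp.2.2.2.2, h.rewards τ hτ]

theorem setOne_exec (hd : m.nat 0 = d) (a : ℕ) : toMatrix d ((setOne a).exec m) a = 1 := by
  subst hd
  ext i j
  rw [toMatrix, setOne, exec_assign_self _ _ _ _ _ (by simp [NExp.eval]) (by simp [NExp.eval])]
  simp only [SumExp.eval_ite, SumExp.eval_num, NExp.eval, setNat_nat, one_apply, Nat.cast_le,
    Fin.ext_iff]
  split_ifs <;> first | omega | simp

attribute [local simp] SumExp.eval_add SumExp.eval_sub SumExp.eval_mul SumExp.eval_div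
  SumExp.eval_num SumExp.eval_cell SumExp.eval_sum SumExp.eval_ite NExp.eval

theorem rankOneUpdate_exec {n : ℕ} (h : RidgeData d k ref X Y m) (hn : n < k) (h7 : m.nat 7 = n)
    (hs : RidgeState d ref X Y n m) : RidgeState d ref X Y (n + 1) (rankOneUpdate.exec m) := by
  have hX := h.visited n hn
  have hY := h.rewards n hn
  have hXj : ∀ j : Fin d, m.real 1 n j = X n j := fun j => congrFun hX j
  have hd := h.dim
  rw [rankOneUpdate, exec_seq, exec_seq, exec_seq, exec_seq, exec_seq, exec_seq]
  obtain ⟨m₁, e₁, n₁, r₁, v₁⟩ := exec_assign 17 (lit 1) (lit 1) (.ite (num (reg 7)) (num (reg 5))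
    (cell 16 (lit 0) (lit 0)) (cell 17 (lit 0) (lit 0))) m
  have w₁ : m₁.real 17 0 0 = (design 1 X (min ref n)).det := by
    rw [v₁ 0 0 (by simp) (by simp)]
    simp only [SumExp.eval_ite, SumExp.eval_num, SumExp.eval_cell, NExp.eval, setNat_nat,
      setNat_real, Nat.cast_le]
    norm_num
    rw [h7, h.ref, hs.det, hs.det_ref]
    split_ifs with hle
    · rw [min_eq_right hle]
    · rw [min_eq_left (by omega), min_eq_left (by omega)]
  rw [e₁]
  obtain ⟨m₂, e₂, n₂, r₂, v₂⟩ := exec_assign 11 (lit 1) (reg 0) (.sum 22 (reg 0)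
    (cell 10 (reg 21) (reg 22) * cell 1 (reg 7) (reg 22))) m₁
  have w₂ : rowVec d m₂ 11 0 = (design 1 X n)⁻¹ *ᵥ X n := by
    funext j
    rw [rowVec, v₂ 0 j (by simp) (by simp [n₁, hd]), ← hs.inverse, ← hX, mulVec, dotProduct]
    simp [n₁, hd, h7, r₁ 10, r₁ 1, Finset.sum_range, toMatrix, rowVec]
  rw [e₂]
  obtain ⟨m₃, e₃, n₃, r₃, v₃⟩ := exec_assign 18 (lit 1) (lit 1) (num (lit 1) + .sum 22 (reg 0)
    (cell 1 (reg 7) (reg 22) * cell 11 (lit 0) (reg 22))) m₂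
  have w₃ : m₃.real 18 0 0 = 1 + X n ⬝ᵥ ((design 1 X n)⁻¹ *ᵥ X n) := by
    rw [v₃ 0 0 (by simp) (by simp), ← w₂, ← hX, rowVec_dotProduct]
    simp [n₂, n₁, hd, h7, r₂ 1, r₁ 1]
  rw [e₃]
  obtain ⟨m₄, e₄, n₄, r₄, v₄⟩ := exec_assign 16 (lit 1) (lit 1)
    (cell 16 (lit 0) (lit 0) * cell 18 (lit 0) (lit 0)) m₃
  have w₄ : m₄.real 16 0 0 = (design 1 X (n + 1)).det := by
    rw [v₄ 0 0 (by simp) (by simp), design_det_succ, ← w₃, ← hs.det]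
    simp [r₃ 16, r₂ 16, r₁ 16]
  rw [e₄]
  have u11 : ∀ j : Fin d, m₄.real 11 0 j = ((design 1 X n)⁻¹ *ᵥ X n) j := fun j => by
    rw [r₄ 11 (by norm_num), r₃ 11 (by norm_num), ← w₂]; rfl
  have u18 : m₄.real 18 0 0 = 1 + X n ⬝ᵥ ((design 1 X n)⁻¹ *ᵥ X n) := by
    rw [r₄ 18 (by norm_num), w₃]
  obtain ⟨m₅, e₅, n₅, r₅, v₅⟩ := exec_assign 10 (reg 0) (reg 0) (cell 10 (reg 20) (reg 21) -
    cell 11 (lit 0) (reg 20) * cell 11 (lit 0) (reg 21) / cell 18 (lit 0) (lit 0)) m₄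
  have w₅ : toMatrix d m₅ 10 = (design 1 X (n + 1))⁻¹ := by
    rw [design_succ, inv_add_vecMulVec_self (design_posDef X n)]
    ext i j
    have u10 : m.real 10 i j = (design 1 X n)⁻¹ i j := congrFun (congrFun hs.inverse i) j
    rw [toMatrix, v₅ i j (by simp [n₄, n₃, n₂, n₁, hd]) (by simp [n₄, n₃, n₂, n₁, hd])]
    simp [u10, u11, u18, r₄ 10, r₃ 10, r₂ 10, r₁ 10, vecMulVec_apply]
    ring
  rw [e₅]
  obtain ⟨m₆, e₆, n₆, r₆, v₆⟩ := exec_assign 13 (reg 0) (reg 0) (cell 13 (reg 20) (reg 21) +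
    cell 1 (reg 7) (reg 20) * cell 1 (reg 7) (reg 21)) m₅
  have w₆ : toMatrix d m₆ 13 = design 1 X (n + 1) := by
    rw [design_succ, ← hs.matrix]
    ext i j
    rw [toMatrix, v₆ i j (by simp [n₅, n₄, n₃, n₂, n₁, hd]) (by simp [n₅, n₄, n₃, n₂, n₁, hd])]
    simp [n₅, n₄, n₃, n₂, n₁, h7, r₅ 13, r₄ 13, r₃ 13, r₂ 13, r₁ 13, r₅ 1, r₄ 1, r₃ 1, r₂ 1, r₁ 1,
      toMatrix, vecMulVec_apply, hXj]
  rw [e₆]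
  obtain ⟨m₇, e₇, n₇, r₇, v₇⟩ := exec_assign 14 (lit 1) (reg 0) (cell 14 (lit 0) (reg 21) +
    cell 2 (reg 7) (lit 0) * cell 1 (reg 7) (reg 21)) m₆
  rw [e₇]
  refine ⟨?_, ?_, ?_, ?_, ?_⟩
  · rw [toMatrix_congr (r₇ 10 (by norm_num)), toMatrix_congr (r₆ 10 (by norm_num)), w₅]
  · rw [toMatrix_congr (r₇ 13 (by norm_num)), w₆]
  · rw [Finset.sum_range_succ, ← hs.vector]
    funext j
    rw [rowVec, v₇ 0 j (by simp) (by simp [n₆, n₅, n₄, n₃, n₂, n₁, hd])]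
    simp [n₆, n₅, n₄, n₃, n₂, n₁, h7, r₆ 14, r₅ 14, r₄ 14, r₃ 14, r₂ 14, r₁ 14, r₆ 1, r₅ 1, r₄ 1,
      r₃ 1, r₂ 1, r₁ 1, r₆ 2, r₅ 2, r₄ 2, r₃ 2, r₂ 2, r₁ 2, rowVec, hXj, hY]
  · rw [r₇ 16 (by norm_num), r₆ 16 (by norm_num), r₅ 16 (by norm_num), w₄]
  · rw [r₇ 17 (by norm_num), r₆ 17 (by norm_num), r₅ 17 (by norm_num), r₄ 17 (by norm_num),
      r₃ 17 (by norm_num), r₂ 17 (by norm_num), w₁, Nat.add_sub_cancel]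

theorem ridgeProg_exec (h : RidgeData d k ref X Y m) :
    toMatrix d (ridgeProg.exec m) 13 = design 1 X k ∧
    rowVec d (ridgeProg.exec m) 15 0 = ridge 1 X Y k ∧
    (ridgeProg.exec m).real 16 0 0 = (design 1 X k).det ∧
    (ridgeProg.exec m).real 17 0 0 = (design 1 X (min ref (k - 1))).det := by
  rw [ridgeProg, exec_seq, exec_seq, exec_seq, exec_seq, exec_seq, exec_seq]
  have w₁ := setOne_exec h.dim 10
  have D₁ : RidgeData d k ref X Y ((setOne 10).exec m) :=
    h.exec _ (by simp [setOne, counters, arrays])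
  set m₁ := (setOne 10).exec m
  have w₂ := setOne_exec D₁.dim 13
  have D₂ : RidgeData d k ref X Y ((setOne 13).exec m₁) :=
    D₁.exec _ (by simp [setOne, counters, arrays])
  have r₂ : ((setOne 13).exec m₁).real 10 = m₁.real 10 := exec_real _ _ (by simp [setOne, arrays])
  set m₂ := (setOne 13).exec m₁
  obtain ⟨m₃, e₃, n₃, r₃, v₃⟩ := exec_assign 14 (lit 1) (reg 0) (num (lit 0)) m₂
  have D₃ : RidgeData d k ref X Y m₃ := e₃ ▸ D₂.exec _ (by simp [counters, arrays])
  rw [e₃]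
  obtain ⟨m₄, e₄, n₄, r₄, v₄⟩ := exec_assign 16 (lit 1) (lit 1) (num (lit 1)) m₃
  have D₄ : RidgeData d k ref X Y m₄ := e₄ ▸ D₃.exec _ (by simp [counters, arrays])
  rw [e₄]
  obtain ⟨m₅, e₅, n₅, r₅, v₅⟩ := exec_assign 17 (lit 1) (lit 1) (num (lit 1)) m₄
  have D₅ : RidgeData d k ref X Y m₅ := e₅ ▸ D₄.exec _ (by simp [counters, arrays])
  rw [e₅]
  have S₅ : RidgeState d ref X Y 0 m₅ := by
    refine ⟨?_, ?_, ?_, ?_, ?_⟩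
    · rw [toMatrix_congr (r₅ 10 (by norm_num)), toMatrix_congr (r₄ 10 (by norm_num)),
        toMatrix_congr (r₃ 10 (by norm_num)), toMatrix_congr r₂, w₁, design_zero, inv_one]
    · rw [toMatrix_congr (r₅ 13 (by norm_num)), toMatrix_congr (r₄ 13 (by norm_num)),
        toMatrix_congr (r₃ 13 (by norm_num)), w₂, design_zero]
    · funext j
      rw [rowVec, r₅ 14 (by norm_num), r₄ 14 (by norm_num), v₃ 0 j (by simp) (by simp [D₂.dim])]
      simp
    · rw [r₅ 16 (by norm_num), v₄ 0 0 (by simp) (by simp), design_zero]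
      simp
    · rw [v₅ 0 0 (by simp) (by simp), Nat.zero_sub, Nat.min_zero, design_zero]
      simp
  have hL := exec_loop_induction (i := 7) (e := reg 4) (p := rankOneUpdate) (m := m₅)
    (fun n m' => RidgeData d k ref X Y m' ∧ RidgeState d ref X Y n m') ⟨D₅, S₅⟩ (by
      rintro n hn m' ⟨D, S⟩
      have hn : n < k := by simpa [D₅.past] using hn
      have D' : RidgeData d k ref X Y (m'.setNat 7 n) :=
        ⟨by simpa using D.dim, by simpa using D.past, by simpa using D.ref, D.visited, D.rewards⟩
      have S' : RidgeState d ref X Y n (m'.setNat 7 n) := ⟨S.1, S.2, S.3, S.4, S.5⟩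
      exact ⟨D'.exec _ (by simp [rankOneUpdate, counters, arrays]),
        rankOneUpdate_exec D' hn (by simp) S'⟩)
  have hk : (reg 4).eval m₅ = k := D₅.past
  rw [hk] at hL
  obtain ⟨D₆, S₆⟩ := hL
  set m₆ := (loop 7 (reg 4) rankOneUpdate).exec m₅
  obtain ⟨m₇, e₇, n₇, r₇, v₇⟩ := exec_assign 15 (lit 1) (reg 0) (.sum 22 (reg 0)
    (cell 10 (reg 21) (reg 22) * cell 14 (lit 0) (reg 22))) m₆
  rw [e₇]
  refine ⟨?_, ?_, ?_, ?_⟩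
  · rw [toMatrix_congr (r₇ 13 (by norm_num)), S₆.matrix]
  · rw [ridge, ← S₆.vector, ← S₆.inverse]
    funext j
    rw [rowVec, v₇ 0 j (by simp) (by simp [D₆.dim]), mulVec, dotProduct]
    simp [D₆.dim, Finset.sum_range, toMatrix, rowVec]
  · rw [r₇ 16 (by norm_num), S₆.det]
  · rw [r₇ 17 (by norm_num), S₆.det_ref]

end RealProgram

theorem LinearBandit.lastChange_succ_le {d : ℕ} (lam C : ℝ) (X : ℕ → Fin d → ℝ) (t : ℕ) :
    LinearBandit.lastChange lam C X (t + 1) ≤ t := by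
  have := LinearBandit.lastChange_le lam C X t
  unfold LinearBandit.lastChange
  split_ifs <;> omega

namespace RealProgram

open SumExp NExp ArrayProg LinearBandit

open Classical in
theorem run_ifLe_fst (x y : RExp) (p q : Prog) (m : Memory) :
    ((Prog.ifLe x y p q).run m).1 =
      if x.eval m ≤ y.eval m then (p.run m).1 else (q.run m).1 := by
  rw [Prog.run]
  split_ifs <;> rfl

theorem mainProg_counters : ∀ r < 7, r ∉ mainProg.counters := by
  intro r hr
  simp [mainProg, ridgeProg, setOne, rankOneUpdate, planProg, searchProg, passProg, checkProg,
    recordProg, counters, linProg, ellProg, ellValueProg]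
  omega

/-- The results of the episode in terms of the memory after the main part. -/
theorem episodeProg_run (m : Memory) :
    ((episodeProg.run m).1.nat 0 = 1 ↔ m.nat 4 = 0 ∨
      2 * (mainProg.exec m).real 17 0 0 ≤ (mainProg.exec m).real 16 0 0) ∧
    (∀ a < m.nat 2, (mainProg.exec m).real 27 0 0 = a → (episodeProg.run m).1.nat 1 = a) ∧
    (episodeProg.run m).1.real 4 = (mainProg.exec m).real 4 := by
  have hA := compile_run mainProg_wellFormed m
  have hn : ∀ r < 7, (mainProg.compile.run m).1.nat r = m.nat r := fun r hr => by
    rw [hA.1 r (by omega), exec_nat _ _ (mainProg_counters r hr)]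
  have e4 : (mainProg.compile.run m).1.real 4 = (mainProg.exec m).real 4 := hA.2 4 (by norm_num)
  rw [← hA.2 16 (by norm_num), ← hA.2 17 (by norm_num), ← hA.2 27 (by norm_num), ← e4,
    ← hn 4 (by norm_num), ← hn 2 (by norm_num)]
  rw [episodeProg, run_seq_fst, run_seq_fst, run_seq_fst, run_seq_fst, run_loop_fst]
  generalize (mainProg.compile.run m).1 = m₁
  set p : Prog := .ifLe (.entry 27 (lit 0) (lit 0)) (.ofNat (reg 7))
    (.ifLe (.ofNat (reg 7)) (.entry 27 (lit 0) (lit 0)) (.setNat 8 (reg 7)) .skip) .skip with hp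
  have hL : ∀ n, (loopMemory p 7 m₁ n).real = m₁.real ∧
      (∀ r, r ≠ 7 → r ≠ 8 → (loopMemory p 7 m₁ n).nat r = m₁.nat r) ∧
      ∀ a < n, m₁.real 27 0 0 = a → (loopMemory p 7 m₁ n).nat 8 = a := by
    intro n
    induction n with
    | zero => exact ⟨rfl, fun _ _ _ => rfl, fun a ha => absurd ha (Nat.not_lt_zero a)⟩
    | succ n ih =>
      obtain ⟨h1, h2, h3⟩ := ih
      have hstep : loopMemory p 7 m₁ (n + 1) =
          if m₁.real 27 0 0 = n then ((loopMemory p 7 m₁ n).setNat 7 n).setNat 8 n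
          else (loopMemory p 7 m₁ n).setNat 7 n := by
        rw [loopMemory, hp, run_ifLe_fst, run_ifLe_fst, ← hp]
        simp only [RExp.eval, NExp.eval, setNat_real, h1, setNat_nat_self, Prog.run]
        rcases lt_trichotomy (m₁.real 27 0 0) (n : ℝ) with h | h | h
        · rw [if_pos h.le, if_neg h.not_ge, if_neg h.ne]
        · rw [if_pos h.le, if_pos h.ge, if_pos h]
        · rw [if_neg h.not_ge, if_neg h.ne']
      rw [hstep]
      split_ifs with hc
      · refine ⟨h1, fun r hr7 hr8 => by simp [hr7, hr8, h2], fun a ha h27 => ?_⟩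
        rw [hc] at h27
        simpa using h27
      · refine ⟨h1, fun r hr7 hr8 => by simp [hr7, h2 r hr7 hr8], fun a ha h27 => ?_⟩
        have : a ≠ n := fun h => hc (by rw [h27, h])
        simpa using h3 a (by omega) h27
  obtain ⟨h1, h2, h3⟩ := hL ((reg 2).eval m₁)
  generalize loopMemory p 7 m₁ ((reg 2).eval m₁) = m₂ at h1 h2 h3
  have h4 := h2 4 (by norm_num) (by norm_num)
  simp only [RExp.eval, NExp.eval, Prog.run, h1, h4]
  have e0 : ((m₁.nat 4 : ℕ) : ℝ) ≤ ((0 : ℕ) : ℝ) ↔ m₁.nat 4 = 0 := by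
    rw [Nat.cast_le, Nat.le_zero]
  refine ⟨?_, fun a ha h27 => ?_, ?_⟩
  · by_cases c1 : m₁.nat 4 = 0 <;>
      by_cases c2 : 2 * m₁.real 17 0 0 ≤ m₁.real 16 0 0 <;> simp [c1, c2]
  · have := h3 a ha h27
    split_ifs <;> simpa using this
  · split_ifs <;> simp [h1]

end RealProgram

namespace FeatureMDP

open RealProgram LinearBandit

variable {nS nA : ℕ} {M : FeatureMDP (Fin nS) (Fin nA) 1} {K : ℕ} {δ : ℝ}
  {ep : ℕ → Episode (Fin nS) (Fin nA) 1} {k N : ℕ} {m : Memory}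

/-- The program solves the planning problem of every episode up to the error `1 / N`. -/
theorem solvesEpisode_episodeProg (hnA : 0 < nA) (hM : M.Standing) (hN : 1 ≤ N)
    (hm : M.EncodesEpisode K δ ep k N m) : M.SolvesEpisode K δ ep k N (episodeProg.run m).1 := by
  obtain ⟨hup, hact, hreal⟩ := episodeProg_run m
  set X : ℕ → Fin (M.d 0) → ℝ := fun τ => M.visited (ep τ) 0 with hX
  set Y : ℕ → ℝ := fun τ => (ep τ).reward 0 with hY
  have hridge : RidgeData (M.d 0) k (M.refIndex ep k) X Y m :=
    ⟨hm.dim, hm.past, hm.ref, fun τ hτ => funext fun j => hm.visited τ hτ j, hm.rewards⟩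
  obtain ⟨h13, h15, h16, h17⟩ := ridgeProg_exec hridge
  have hcr : ∀ r < 7, r ∉ ridgeProg.counters := fun r hr hr' =>
    mainProg_counters r hr (by simp [mainProg, ArrayProg.counters, hr'])
  have hr : ∀ b ∈ [0, 3], (ridgeProg.exec m).real b = m.real b := fun b hb =>
    ArrayProg.exec_real _ _ (by
      rcases List.mem_pair.1 hb with rfl | rfl <;>
        simp [ridgeProg, setOne, rankOneUpdate, ArrayProg.arrays])
  have hp : ∀ b ∈ [16, 17], (planProg.exec (ridgeProg.exec m)).real b = (ridgeProg.exec m).real b :=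
    fun b hb => ArrayProg.exec_real _ _ (by
      rcases List.mem_pair.1 hb with rfl | rfl <;>
        simp [planProg, searchProg, passProg, checkProg, recordProg, ArrayProg.arrays, linProg,
          ellProg, ellValueProg])
  have hmain : mainProg.exec m = planProg.exec (ridgeProg.exec m) := rfl
  refine ⟨?_, fun ⟨ξ₀, θhat₀, θbar₀, hfeas₀⟩ => ?_⟩
  · rw [hup, hm.past, hmain, hp 16 (by simp), hp 17 (by simp), h16, h17, M.updates_iff ep k,
      ← hX, one_add_one_eq_two]
    refine or_congr_right' fun hk => ?_
    obtain ⟨n, rfl⟩ := Nat.exists_eq_succ_of_ne_zero hk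
    have hmin : min (lastChange 1 1 X n.succ) (n.succ - 1) = lastChange 1 1 X n.succ :=
      min_eq_left (lastChange_succ_le 1 1 X n)
    rw [M.refIndex_eq_lastChange, ← hX, hmin]
  · set F : ℕ → Fin (M.d 0) → ℝ := fun i => rowVec (M.d 0) m 0 i with hF
    have hFφ : ∀ (s : Fin nS) (a : Fin nA), F (s * nA + a) = M.φ 0 s a := fun s a =>
      funext fun j => hm.features s a j
    have hidx : ∀ i < nS * nA, ∃ (s : Fin nS) (a : Fin nA), F i = M.φ 0 s a := fun i hi => by
      refine ⟨⟨i / nA, Nat.div_lt_of_lt_mul (by rwa [mul_comm] at hi)⟩,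
          ⟨i % nA, Nat.mod_lt _ hnA⟩, ?_⟩
      rw [← hFφ]
      simp only [Nat.div_add_mod']
    have hXle : ∀ τ < k, X τ ⬝ᵥ X τ ≤ 1 := fun τ _ => M.feature_dotProduct_self_le hM _ _
    have hD : PlanData (M.d 0) nS nA M.s₁ k N F (design 1 X k) (ridge 1 X Y k)
        (confRadius (M.d 0) K δ k) (ridgeProg.exec m) := by
      refine ⟨?_, ?_, ?_, ?_, ?_, ?_, fun i _ => rowVec_congr (hr 0 (by simp)), h13, h15, ?_⟩
      · rw [ArrayProg.exec_nat _ _ (hcr 0 (by norm_num)), hm.dim]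
      · rw [ArrayProg.exec_nat _ _ (hcr 1 (by norm_num)), hm.states]
      · rw [ArrayProg.exec_nat _ _ (hcr 2 (by norm_num)), hm.actions]
      · rw [ArrayProg.exec_nat _ _ (hcr 3 (by norm_num)), hm.initial]
      · rw [ArrayProg.exec_nat _ _ (hcr 4 (by norm_num)), hm.past]
      · rw [ArrayProg.exec_nat _ _ (hcr 6 (by norm_num)), hm.accuracy]
      · rw [hr 3 (by simp), hm.radius, M.sqrtAlpha_eq]
    have hplan : ∀ ξ θhat θbar, M.PlanFeasible K δ 0 ep k ξ θhat θbar → ∀ b : Fin nA,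
        ∃ a < nA, (planProg.exec (ridgeProg.exec m)).real 27 0 0 = a ∧
          (∀ i < nS * nA, LinSat (F i) (-1) (1 / (2 * N))
            (rowVec (M.d 0) (planProg.exec (ridgeProg.exec m)) 4 0)) ∧
          EllSat (design 1 X k) (ridge 1 X Y k) (confRadius (M.d 0) K δ k) (1 / (2 * N))
            (rowVec (M.d 0) (planProg.exec (ridgeProg.exec m)) 4 0) ∧
          F (M.s₁ * nA + b) ⬝ᵥ θbar 0 ≤ F (M.s₁ * nA + a) ⬝ᵥ
            rowVec (M.d 0) (planProg.exec (ridgeProg.exec m)) 4 0 + 1 / N := by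
      intro ξ θhat θbar hfeas b
      have hmem := hfeas.mem_confSet
      refine planProg_exec hD M.s₁.2 hN (design_posDef X k) (design_mulVec_sq_le X hXle)
        (confRadius_nonneg _ _ _ _) (fun i hi => ?_) (M.param_dotProduct_self_le hM hmem.1)
        (fun i hi => ?_) ?_ b.2
      · obtain ⟨s, a, e⟩ := hidx i hi
        rw [e]
        exact M.feature_dotProduct_self_le hM s a
      · obtain ⟨s, a, e⟩ := hidx i hi
        rw [e]
        exact hmem.1 s a
      · exact (Real.sqrt_le_left (confRadius_nonneg _ _ _ _)).1 hmem.2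
    obtain ⟨a, ha, h27, hlin, hell, -⟩ := hplan _ _ _ hfeas₀ ⟨0, hnA⟩
    have hθ : ∃ θ : M.Params, θ 0 = rowVec (M.d 0) (planProg.exec (ridgeProg.exec m)) 4 0 :=
      ⟨fun h j => (planProg.exec (ridgeProg.exec m)).real 4 0 j, rfl⟩
    obtain ⟨θ, hθ⟩ := hθ
    rw [← hθ] at hlin hell
    have hN' : (0 : ℝ) < N := by exact_mod_cast hN
    have hε : (1 : ℝ) / (2 * N) ≤ 1 / N := by
      rw [div_le_div_iff₀ (by positivity) hN']
      linarith
    have hε0 : (0 : ℝ) ≤ 1 / (2 * N) := by positivity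
    refine ⟨⟨a, ha⟩, θ, hact a (by rw [hm.actions]; exact ha) (by rw [hmain, h27]), fun j => ?_,
      fun s a' => ?_, ?_, fun ξ θhat θbar hfeas => ?_⟩
    · rw [hreal, hmain, hθ]
      rfl
    · have hi : (s : ℕ) * nA + a' < nS * nA := by
        calc (s : ℕ) * nA + a' < (s + 1) * nA := by rw [add_mul, one_mul]; omega
          _ ≤ nS * nA := Nat.mul_le_mul_right _ s.2
      obtain ⟨l1, l2⟩ := hlin _ hi
      rw [hFφ] at l1 l2
      rw [abs_le]
      constructor <;> linarith
    · rw [M.leastSquares_eq_ridge, M.gram_eq_design, M.sqrtAlpha_eq]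
      have := confRadius_nonneg (M.d 0) K δ k
      exact (Real.sqrt_le_left (by linarith)).2
        (hell.trans (pow_le_pow_left₀ (by linarith) (by linarith) 2))
    · obtain ⟨b, hb⟩ := hM.max_attained 0 M.s₁ (θbar 0) (hfeas.mem 0)
      obtain ⟨a', ha', h27', -, -, hopt⟩ := hplan _ _ _ hfeas b
      have haa : a' = a := by
        rw [h27] at h27'
        exact_mod_cast h27'.symm
      subst haa
      have : Nonempty (Fin nA) := ⟨b⟩
      rw [M.layerValue_zero]
      refine (ciSup_le hb).trans ?_
      rw [hFφ M.s₁ b, hFφ M.s₁ ⟨a', ha⟩, ← hθ] at hopt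
      exact hopt

end FeatureMDP

theorem corollary1 :
    ∃ C : ℝ, 0 < C ∧
      (∀ (S : Type u) (A : Type v) [MeasurableSpace S] [MeasurableSpace A] [Nonempty A]
        (M : FeatureMDP S A 1), M.Standing → M.inherentBellmanError = 0 →
        -- the MDP is a linear bandit of dimension `d`
        (∃ θstar ∈ M.paramSet 0,
          (∀ s a, M.meanReward 0 s a = M.φ 0 s a ⬝ᵥ θstar) ∧
          ∀ (Ω : Type w) (mΩ : MeasurableSpace Ω) (P : Measure Ω) [IsProbabilityMeasure P]
            (ℱ : Filtration ℕ mΩ) (K : ℕ) (ep : ℕ → Ω → Episode S A 1)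
            (π : ℕ → Ω → FeatureMDP.Policy S A 1),
            M.IsInteraction P ℱ K ep π →
            LinearBandit.IsInteraction P ℱ (Set.range (M.φ 0 M.s₁)) θstar K
              (fun k ω => M.visited (ep k ω) 0) (fun k ω => (ep k ω).reward 0) ∧
            ∀ ω, M.regret K (fun k => π k ω) =
              LinearBandit.regret (Set.range (M.φ 0 M.s₁)) θstar K
                (fun k => M.visited (ep k ω) 0)) ∧
        (∀ (K : ℕ) (δ : ℝ), 1 ≤ K → 0 < δ → δ < 1 →
          -- the algorithm is RARELY SWITCHING OFUL
          (∀ (X : ℕ → Fin (M.d 0) → ℝ) (Y : ℕ → ℝ),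
            (∃ (ep : ℕ → Episode S A 1) (π : ℕ → FeatureMDP.Policy S A 1),
              M.IsEleanorRun K δ 0 ep π ∧
              ∀ k < K, X k = M.visited (ep k) 0 ∧ Y k = (ep k).reward 0) ↔
            LinearBandit.IsRarelySwitchingOFUL (Set.range (M.φ 0 M.s₁)) 1 1 (M.paramSet 0)
              (fun t => Real.sqrt (M.d 0 * Real.log (1 + (t + 1) / M.d 0) +
                Real.log (2 * K / δ)) + 1 + Real.sqrt (M.d 0)) K X Y) ∧
          -- switching cost and regret
          (∀ (ep : ℕ → Episode S A 1) (π : ℕ → FeatureMDP.Policy S A 1),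
            M.IsEleanorRun K δ 0 ep π →
            (FeatureMDP.switchingCost K π : ℝ) ≤ C * (M.d 0 * Real.log K)) ∧
          (∀ (Ω : Type w) (mΩ : MeasurableSpace Ω) (P : Measure Ω) [IsProbabilityMeasure P]
            (ℱ : Filtration ℕ mΩ) (ep : ℕ → Ω → Episode S A 1)
            (π : ℕ → Ω → FeatureMDP.Policy S A 1),
            M.IsInteraction P ℱ K ep π →
            (∀ ω, M.IsEleanorRun K δ 0 (fun k => ep k ω) (fun k => π k ω)) →
            ENNReal.ofReal (1 - δ) ≤
              P {ω | M.regret K (fun k => π k ω) ≤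
                C * (M.d 0 * Real.sqrt K * Real.log (2 * K / δ))}))) ∧
      -- computational efficiency for finitely many states and actions
      (∃ (prog : RealProgram.Prog) (c : ℕ),
        ∀ (nS nA : ℕ) (M : FeatureMDP (Fin nS) (Fin nA) 1), 0 < nA →
          M.Standing → M.inherentBellmanError = 0 →
          ∀ (K : ℕ) (δ : ℝ), 1 ≤ K → 0 < δ → δ < 1 →
          ∀ (ep : ℕ → Episode (Fin nS) (Fin nA) 1) (k N : ℕ), k < K → 1 ≤ N →
          ∀ m : RealProgram.Memory, M.EncodesEpisode K δ ep k N m →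
            M.SolvesEpisode K δ ep k N (prog.run m).1 ∧
            (prog.run m).2 ≤ c * (nS + nA + M.d 0 + k + N) ^ c) := by
  refine ⟨24, by norm_num, ?_, RealProgram.episodeProg, ?_⟩
  · intro S A _ _ _ M hM h0
    obtain ⟨θstar, hθ, hr⟩ := M.exists_meanReward_eq hM h0
    refine ⟨⟨θstar, hθ, hr, fun Ω mΩ P _ ℱ K ep π h => ⟨h.linearBandit hM hr, fun ω =>
      FeatureMDP.regret_eq hM hθ hr fun k hk => h.deploy k hk ω⟩⟩, fun K δ hK hδ hδ1 =>
      ⟨fun X Y => ⟨?_, fun h => M.exists_isEleanorRun hM h⟩, fun ep π h => ?_,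
        fun Ω mΩ P _ ℱ ep π h hrun => FeatureMDP.regret_bound hM hθ hr hK hδ hδ1 h hrun⟩⟩
    · rintro ⟨ep, π, h, hXY⟩
      exact h.isRarelySwitchingOFUL.congr (fun k hk => (hXY k hk).1.symm)
        fun k hk => (hXY k hk).2.symm
    · refine (h.switchingCost_le hM hK).trans (mul_le_mul_of_nonneg_right ?_ ?_)
      · have h2 := Real.log_two_gt_d9
        rw [inv_le_comm₀ (by linarith) (by norm_num)]
        linarith
      · exact mul_nonneg (Nat.cast_nonneg _) (Real.log_nonneg (by exact_mod_cast hK))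
  · obtain ⟨c, hc⟩ := RealProgram.episodeProg_cost
    refine ⟨c, fun nS nA M hnA hM _ K δ _ _ _ ep k N _ hN m hm =>
      ⟨FeatureMDP.solvesEpisode_episodeProg hnA hM hN hm, hc m _ (fun r hr => ?_) (by omega)⟩⟩
    have href := LinearBandit.lastChange_le 1 1 (fun τ => M.visited (ep τ) 0) k
    rw [← M.refIndex_eq_lastChange] at href
    have hs := M.s₁.2
    have := hm.dim
    have := hm.states
    have := hm.actions
    have := hm.initial
    have := hm.past
    have := hm.ref
    have := hm.accuracy
    interval_cases r <;> omega
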